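/- Let $A$ and $B$ be associative unital rings (for instance algebras over a commutative ring $k$), let $\mathfrak C$ be an $A$-coring and $\mathfrak D$ a $B$-coring, and suppose that the modules ${}_A\mathfrak C$, $\mathfrak C_A$, ${}_B\mathfrak D$ and $\mathfrak D_B$ are flat. Let $X\in{}^{\mathfrak C}\mathcal M^{\mathfrak D}$ and $\Lambda\in{}^{\mathfrak D}\mathcal M^{\mathfrak C}$ be bicomodules. Conventions. $\mathcal M^{\mathfrak C}$ and ${}^{\mathfrak C}\mathcal M$ are the categories of right and left $\mathfrak C$-comodules. For $M\in\mathcal M^{\mathfrak C}$ and $N\in{}^{\mathfrak C}\mathcal M$, $M\square_{\mathfrak C}N$ is the kernel of $\rho_M\otimes_AN-M\otimes_A\lambda_N:M\otimes_AN\to M\otimes_A\mathfrak C\otimes_AN$; under the flatness assumptions $-\square_{\mathfrak C}X:\mathcal M^{\mathfrak C}\to\mathcal M^{\mathfrak D}$ and $X\square_{\mathfrak D}-:{}^{\mathfrak D}\mathcal M\to{}^{\mathfrak C}\mathcal M$ are functors (and similarly for $\Lambda$). A pair of functors $(F,G)$ is a Frobenius pair if $G$ is both a left and a right adjoint of $F$.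 A right comodule $M$ over a coring $\mathfrak C$ is coflat if $M\square_{\mathfrak C}-$, from ${}^{\mathfrak C}\mathcal M$ to abelian groups, is exact; coflat left comodules are defined symmetrically. A bicomodule $N\in{}^{\mathfrak C}\mathcal M^{\mathfrak D}$ is quasi-finite (resp. an injector) as a right $\mathfrak D$-comodule if the functor $-\otimes_AN$ from right $A$-modules to $\mathcal M^{\mathfrak D}$ has a left adjoint (resp. preserves injective objects), and quasi-finite (resp. an injector) as a left $\mathfrak C$-comodule if $N\otimes_B-$, from left $B$-modules to ${}^{\mathfrak C}\mathcal M$, has a left adjoint (resp. preserves injective objects). For $\Lambda$ quasi-finite as a right $\mathfrak C$-comodule, the co-hom functor $h_{\mathfrak C}(\Lambda,-):\mathcal M^{\mathfrak C}\to\mathcal M^{\mathfrak D}$ is the left adjoint of $-\square_{\mathfrak D}\Lambda$; $h_{\mathfrak C}(\Lambda,\mathfrak C)$ is a $\mathfrak C$-$\mathfrak D$-bicomodule, with the left action of $A$ obtained by applying the functor to the left multiplications of $\mathfrak C$, and with the left coaction obtained by applying it to $\Delta_{\mathfrak C}$ and composing with the inverse of the canonical isomorphism $\mathfrak C\otimes_Ah_{\mathfrak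 C}(\Lambda,\mathfrak C)\cong h_{\mathfrak C}(\Lambda,\mathfrak C\otimes_A\mathfrak C)$, $c\otimes x\mapsto h_{\mathfrak C}(\Lambda,c\otimes-)(x)$. The bicomodule $h_{\mathfrak D}(X,\mathfrak D)$ is defined likewise. A coring $\mathfrak C$ is coseparable if $\Delta_{\mathfrak C}$ is a split monomorphism of $\mathfrak C$-bicomodules. Theorem. The following statements are equivalent: (1) $(-\square_{\mathfrak C}X,\,-\square_{\mathfrak D}\Lambda)$ is a Frobenius pair, and $X_{\mathfrak D}$ and $\Lambda_{\mathfrak C}$ are coflat; (2) $(\Lambda\square_{\mathfrak C}-,\,X\square_{\mathfrak D}-)$ is a Frobenius pair, and ${}_{\mathfrak C}X$ and ${}_{\mathfrak D}\Lambda$ are coflat; (3) $X$ and $\Lambda$ are coflat quasi-finite injectors on both sides, $X\cong h_{\mathfrak C}(\Lambda,\mathfrak C)$ in ${}^{\mathfrak C}\mathcal M^{\mathfrak D}$, and $\Lambda\cong h_{\mathfrak D}(X,\mathfrak D)$ in ${}^{\mathfrak D}\mathcal M^{\mathfrak C}$. If moreover $\mathfrak C$ and $\mathfrak D$ are coseparable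 (resp. $A$ and $B$ are von Neumann regular), then the following statements are equivalent: (1') $(-\square_{\mathfrak C}X,\,-\square_{\mathfrak D}\Lambda)$ is a Frobenius pair; (2') $(\Lambda\square_{\mathfrak C}-,\,X\square_{\mathfrak D}-)$ is a Frobenius pair; (3') $X$ and $\Lambda$ are quasi-finite (resp. quasi-finite injectors) on both sides, $X\cong h_{\mathfrak C}(\Lambda,\mathfrak C)$ in ${}^{\mathfrak C}\mathcal M^{\mathfrak D}$, and $\Lambda\cong h_{\mathfrak D}(X,\mathfrak D)$ in ${}^{\mathfrak D}\mathcal M^{\mathfrak C}$. -/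

import Mathlib

open CategoryTheory MulOpposite
open scoped TensorProduct

universe u

namespace Corings

/-! ## Tensor products of modules over an arbitrary ring

A right `A`-module is a module over `Aᵐᵒᵖ`; an `A`-`B`-bimodule carries commuting `Module A` and
`Module Bᵐᵒᵖ` structures. -/

section Tensor

/-- `f` is linear over `R`. Linearity of an additive map on one or on both sides of a bimodule is
recorded through this class (with `R = A` for left and `R = Aᵐᵒᵖ` for right `A`-linearity). -/
class IsLin (R : Type*) [Ring R] {M N : Type*} [AddCommGroup M] [AddCommGroup N] [Module R M]
    [Module R N] (f : M →+ N) : Prop where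
  smul : ∀ (r : R) (m : M), f (r • m) = r • f m

instance (R : Type*) [Ring R] (M : Type*) [AddCommGroup M] [Module R M] :
    IsLin R (AddMonoidHom.id M) := ⟨fun _ _ => rfl⟩

instance (R : Type*) [Ring R] {M N P : Type*} [AddCommGroup M] [AddCommGroup N] [AddCommGroup P]
    [Module R M] [Module R N] [Module R P] (g : N →+ P) (f : M →+ N) [IsLin R g] [IsLin R f] :
    IsLin R (g.comp f) :=
  ⟨fun r m => by simp [IsLin.smul (f := f), IsLin.smul (f := g)]⟩

instance (R : Type*) [Ring R] {M N : Type*} [AddCommGroup M] [AddCommGroup N] [Module R M]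
    [Module R N] (f : M →ₗ[R] N) : IsLin R f.toAddMonoidHom :=
  ⟨fun r m => f.map_smul r m⟩

/-- An additive map that is linear over `R`, as a linear map. -/
def IsLin.toLin (R : Type*) [Ring R] {M N : Type*} [AddCommGroup M] [AddCommGroup N] [Module R M]
    [Module R N] (f : M →+ N) [IsLin R f] : M →ₗ[R] N :=
  { f with map_smul' := fun r m => IsLin.smul r m }

variable (A : Type*) [Ring A]

/-- The relations `ma ⊗ n = m ⊗ an`. -/
def Ten.rel (M N : Type*) [AddCommGroup M] [Module Aᵐᵒᵖ M] [AddCommGroup N] [Module A N] :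
    AddSubgroup (M ⊗[ℤ] N) :=
  AddSubgroup.closure {t | ∃ (m : M) (a : A) (n : N), t = (op a • m) ⊗ₜ[ℤ] n - m ⊗ₜ[ℤ] (a • n)}

/-- The tensor product `M ⊗_A N` of a right `A`-module and a left `A`-module. -/
def Ten (M N : Type*) [AddCommGroup M] [Module Aᵐᵒᵖ M] [AddCommGroup N] [Module A N] : Type _ :=
  (M ⊗[ℤ] N) ⧸ Ten.rel A M N

namespace Ten

variable {A}
variable {M N P : Type*} [AddCommGroup M] [Module Aᵐᵒᵖ M] [AddCommGroup N] [Module A N]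
  [AddCommGroup P]

instance : AddCommGroup (Ten A M N) :=
  inferInstanceAs (AddCommGroup ((M ⊗[ℤ] N) ⧸ Ten.rel A M N))

variable (A) in
/-- The pure tensor `m ⊗ n`. -/
def tmul (m : M) (n : N) : Ten A M N := QuotientAddGroup.mk' (Ten.rel A M N) (m ⊗ₜ[ℤ] n)

theorem tmul_add (m : M) (n n' : N) : tmul A m (n + n') = tmul A m n + tmul A m n' := by
  simp only [tmul, TensorProduct.tmul_add, map_add]; rfl

theorem add_tmul (m m' : M) (n : N) : tmul A (m + m') n = tmul A m n + tmul A m' n := by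
  simp only [tmul, TensorProduct.add_tmul, map_add]; rfl

@[simp] theorem tmul_zero (m : M) : tmul A m (0 : N) = 0 := by
  simp only [tmul, TensorProduct.tmul_zero, map_zero]; rfl

@[simp] theorem zero_tmul (n : N) : tmul A (0 : M) n = 0 := by
  simp only [tmul, TensorProduct.zero_tmul, map_zero]; rfl

theorem smul_tmul (m : M) (a : A) (n : N) : tmul A (op a • m) n = tmul A m (a • n) := by
  refine (QuotientAddGroup.eq_iff_sub_mem).2 ?_
  exact AddSubgroup.subset_closure ⟨m, a, n, rfl⟩

@[elab_as_elim]
theorem induction {p : Ten A M N → Prop} (t : Ten A M N) (h0 : p 0)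
    (h1 : ∀ m n, p (tmul A m n)) (h2 : ∀ s t, p s → p t → p (s + t)) : p t := by
  obtain ⟨t, rfl⟩ := QuotientAddGroup.mk'_surjective _ t
  induction t using TensorProduct.induction_on with
  | zero => exact h0
  | tmul m n => exact h1 m n
  | add x y hx hy => exact h2 _ _ hx hy

/-- The map out of `M ⊗_A N` given by a balanced biadditive map. -/
def lift (φ : M →+ N →+ P) (h : ∀ m (a : A) n, φ (op a • m) n = φ m (a • n)) : Ten A M N →+ P :=
  QuotientAddGroup.lift (Ten.rel A M N)
    (TensorProduct.liftAddHom φ (fun r m n => by simp)) (by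
      refine (AddSubgroup.closure_le _).2 ?_
      rintro _ ⟨m, a, n, rfl⟩
      simp [h])

@[simp]
theorem lift_tmul (φ : M →+ N →+ P) (h : ∀ m (a : A) n, φ (op a • m) n = φ m (a • n)) (m : M)
    (n : N) : lift φ h (tmul A m n) = φ m n := by
  simp only [lift, tmul]
  erw [QuotientAddGroup.lift_mk']

theorem hom_ext {f g : Ten A M N →+ P} (h : ∀ m n, f (tmul A m n) = g (tmul A m n)) : f = g := by
  ext t
  induction t using Ten.induction with
  | h0 => simp
  | h1 m n => exact h m n
  | h2 s t hs ht => simp [hs, ht]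

variable (A M) in
/-- The biadditive map `(m, n) ↦ m ⊗ n`. -/
def mk : M →+ N →+ Ten A M N :=
  AddMonoidHom.mk' (fun m => AddMonoidHom.mk' (fun n => tmul A m n) (tmul_add m))
    (fun m m' => by ext n; exact add_tmul m m' n)

@[simp] theorem mk_apply (m : M) (n : N) : mk A M m n = tmul A m n := rfl

variable {M' N' M'' N'' : Type*} [AddCommGroup M'] [Module Aᵐᵒᵖ M'] [AddCommGroup N'] [Module A N']
  [AddCommGroup M''] [Module Aᵐᵒᵖ M''] [AddCommGroup N''] [Module A N'']

variable (A) in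
/-- The map `f ⊗_A g`. -/
def map (f : M →+ M') (g : N →+ N') [IsLin Aᵐᵒᵖ f] [IsLin A g] : Ten A M N →+ Ten A M' N' :=
  lift (((mk A M').compr₂ (AddMonoidHom.id _)).comp f |>.compl₂ g) (fun m a n => by
    simp [IsLin.smul (f := f), IsLin.smul (f := g), smul_tmul])

@[simp]
theorem map_tmul (f : M →+ M') (g : N →+ N') [IsLin Aᵐᵒᵖ f] [IsLin A g] (m : M) (n : N) :
    map A f g (tmul A m n) = tmul A (f m) (g n) := by
  simp [map]

theorem map_map (f : M →+ M') (g : N →+ N') [IsLin Aᵐᵒᵖ f] [IsLin A g] (f' : M' →+ M'')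
    (g' : N' →+ N'') [IsLin Aᵐᵒᵖ f'] [IsLin A g'] (t : Ten A M N) :
    map A f' g' (map A f g t) = map A (f'.comp f) (g'.comp g) t := by
  induction t using Ten.induction with
  | h0 => simp
  | h1 m n => simp
  | h2 s t hs ht => simp [hs, ht]

theorem map_id (t : Ten A M N) : map A (AddMonoidHom.id M) (AddMonoidHom.id N) t = t := by
  induction t using Ten.induction with
  | h0 => simp
  | h1 m n => simp
  | h2 s t hs ht => simp [hs, ht]

/-- Left multiplication, as an additive map. -/
def lmul (R : Type*) [Ring R] (M : Type*) [AddCommGroup M] [Module R M] (r : R) : M →+ M :=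
  DistribSMul.toAddMonoidHom M r

@[simp] theorem lmul_apply (R : Type*) [Ring R] (M : Type*) [AddCommGroup M] [Module R M] (r : R)
    (m : M) : lmul R M r m = r • m := rfl

instance (R S M : Type*) [Ring R] [Ring S] [AddCommGroup M] [Module R M] [Module S M]
    [SMulCommClass R S M] (r : R) : IsLin S (lmul R M r) :=
  ⟨fun s m => by simp [smul_comm]⟩

instance isLin_lmul' (R S M : Type*) [Ring R] [Ring S] [AddCommGroup M] [Module R M] [Module S M]
    [SMulCommClass R S M] (s : S) : IsLin R (lmul S M s) :=
  ⟨fun r m => by simp [smul_comm]⟩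

section actions

variable {R S : Type*} [Ring R] [Ring S]

/-- `r (m ⊗ n) = rm ⊗ n`. -/
instance leftModule [Module R M] [SMulCommClass R Aᵐᵒᵖ M] : Module R (Ten A M N) where
  smul r t := map A (lmul R M r) (AddMonoidHom.id N) t
  one_smul t := by
    change map A _ _ t = t
    induction t using Ten.induction with
    | h0 => simp
    | h1 m n => simp
    | h2 s t hs ht => simp [hs, ht]
  mul_smul r r' t := by
    change map A _ _ t = map A _ _ (map A _ _ t)
    induction t using Ten.induction with
    | h0 => simp
    | h1 m n => simp [mul_smul]
    | h2 s t hs ht => simp [hs, ht]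
  smul_zero r := (map A _ _).map_zero
  smul_add r := (map A _ _).map_add
  add_smul r r' t := by
    change map A _ _ t = map A _ _ t + map A _ _ t
    induction t using Ten.induction with
    | h0 => simp
    | h1 m n => simp [add_smul, add_tmul]
    | h2 s t hs ht => simp only [map_add, hs, ht]; abel
  zero_smul t := by
    change map A _ _ t = 0
    induction t using Ten.induction with
    | h0 => simp
    | h1 m n => simp
    | h2 s t hs ht => simp [hs, ht]

/-- `(m ⊗ n) s = m ⊗ ns`. -/
instance rightModule [Module Sᵐᵒᵖ N] [SMulCommClass A Sᵐᵒᵖ N] : Module Sᵐᵒᵖ (Ten A M N) where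
  smul s t := map A (AddMonoidHom.id M) (lmul Sᵐᵒᵖ N s) t
  one_smul t := by
    change map A _ _ t = t
    induction t using Ten.induction with
    | h0 => simp
    | h1 m n => simp
    | h2 s t hs ht => simp [hs, ht]
  mul_smul r r' t := by
    change map A _ _ t = map A _ _ (map A _ _ t)
    induction t using Ten.induction with
    | h0 => simp
    | h1 m n => simp [mul_smul]
    | h2 s t hs ht => simp [hs, ht]
  smul_zero s := (map A _ _).map_zero
  smul_add s := (map A _ _).map_add
  add_smul r r' t := by
    change map A _ _ t = map A _ _ t + map A _ _ t
    induction t using Ten.induction with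
    | h0 => simp
    | h1 m n => simp [add_smul, tmul_add]
    | h2 s t hs ht => simp only [map_add, hs, ht]; abel
  zero_smul t := by
    change map A _ _ t = 0
    induction t using Ten.induction with
    | h0 => simp
    | h1 m n => simp
    | h2 s t hs ht => simp [hs, ht]

theorem left_smul_tmul [Module R M] [SMulCommClass R Aᵐᵒᵖ M] (r : R) (m : M) (n : N) :
    r • tmul A m n = tmul A (r • m) n := by
  change map A _ _ _ = _
  simp

theorem right_smul_tmul [Module Sᵐᵒᵖ N] [SMulCommClass A Sᵐᵒᵖ N] (s : Sᵐᵒᵖ) (m : M) (n : N) :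
    s • tmul A m n = tmul A m (s • n) := by
  change map A _ _ _ = _
  simp

instance [Module R M] [SMulCommClass R Aᵐᵒᵖ M] [Module Sᵐᵒᵖ N] [SMulCommClass A Sᵐᵒᵖ N] :
    SMulCommClass R Sᵐᵒᵖ (Ten A M N) where
  smul_comm r s t := by
    induction t using Ten.induction with
    | h0 => simp
    | h1 m n => simp [left_smul_tmul, right_smul_tmul]
    | h2 s t hs ht => simp only [smul_add, hs, ht]

instance isLin_map_left [Module R M] [SMulCommClass R Aᵐᵒᵖ M] [Module R M']
    [SMulCommClass R Aᵐᵒᵖ M'] (f : M →+ M') (g : N →+ N') [IsLin Aᵐᵒᵖ f] [IsLin A g] [IsLin R f] :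
    IsLin R (map A f g) where
  smul r t := by
    induction t using Ten.induction with
    | h0 => simp
    | h1 m n => simp [left_smul_tmul, IsLin.smul (f := f)]
    | h2 s t hs ht => simp only [smul_add, map_add, hs, ht]

instance isLin_map_right [Module Sᵐᵒᵖ N] [SMulCommClass A Sᵐᵒᵖ N] [Module Sᵐᵒᵖ N']
    [SMulCommClass A Sᵐᵒᵖ N'] (f : M →+ M') (g : N →+ N') [IsLin Aᵐᵒᵖ f] [IsLin A g]
    [IsLin Sᵐᵒᵖ g] : IsLin Sᵐᵒᵖ (map A f g) where
  smul r t := by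
    induction t using Ten.induction with
    | h0 => simp
    | h1 m n => simp [right_smul_tmul, IsLin.smul (f := g)]
    | h2 s t hs ht => simp only [smul_add, map_add, hs, ht]

/-- `m ⊗ -` is right linear. -/
instance isLin_mk [Module Sᵐᵒᵖ N] [SMulCommClass A Sᵐᵒᵖ N] (m : M) :
    IsLin Sᵐᵒᵖ (mk A M m : N →+ Ten A M N) :=
  ⟨fun s n => (right_smul_tmul s m n).symm⟩

/-- `- ⊗ n` is left linear. -/
instance isLin_mk_flip [Module R M] [SMulCommClass R Aᵐᵒᵖ M] (n : N) :
    IsLin R ((mk A M (N := N)).flip n) :=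
  ⟨fun r m => (left_smul_tmul r m n).symm⟩

variable (N) in
/-- The canonical map `A ⊗_A N → N`. -/
def lid : Ten A A N →+ N :=
  lift (AddMonoidHom.mk' (fun a => lmul A N a) (fun a b => by ext; simp [add_smul]))
    (fun a b n => by simp [mul_smul])

@[simp] theorem lid_tmul (a : A) (n : N) : lid N (tmul A a n) = a • n := by simp [lid]

variable (M) in
/-- The canonical map `M ⊗_A A → M`. -/
def rid : Ten A M A →+ M :=
  lift (AddMonoidHom.mk' (fun m => AddMonoidHom.mk' (fun a : A => op a • m)
    (fun a b => by simp [add_smul])) (fun a b => by ext; simp))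
    (fun a b n => by simp [mul_smul])

@[simp] theorem rid_tmul (a : A) (m : M) : rid M (tmul A m a) = op a • m := by simp [rid]

end actions

section assoc

variable {B : Type*} [Ring B] {L : Type*} [AddCommGroup L] [Module B L]
  [Module Bᵐᵒᵖ N] [SMulCommClass A Bᵐᵒᵖ N]

variable (A B M N L) in
/-- `(m ⊗ n) ⊗ l ↦ m ⊗ (n ⊗ l)`. -/
def assocHom : Ten B (Ten A M N) L →+ Ten A M (Ten B N L) :=
  lift (lift (AddMonoidHom.mk' (fun m => AddMonoidHom.mk' (fun n => (mk A M m).comp (mk B N n))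
      (fun n n' => by
        ext l
        change tmul A m (tmul B (n + n') l) = tmul A m (tmul B n l) + tmul A m (tmul B n' l)
        rw [add_tmul, tmul_add]))
      (fun m m' => by
        ext n l
        exact add_tmul m m' (tmul B n l)))
      (fun m a n => by
        ext l
        change tmul A (op a • m) (tmul B n l) = tmul A m (tmul B (a • n) l)
        rw [smul_tmul, left_smul_tmul]))
    (fun t b l => by
      induction t using Ten.induction with
      | h0 => simp
      | h1 m n =>
        rw [right_smul_tmul, lift_tmul, lift_tmul]
        change tmul A m (tmul B (op b • n) l) = tmul A m (tmul B n (b • l))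
        rw [smul_tmul]
      | h2 s t hs ht => simp only [smul_add, map_add, AddMonoidHom.add_apply, hs, ht])

variable (A B M N L) in
/-- `m ⊗ (n ⊗ l) ↦ (m ⊗ n) ⊗ l`. -/
def assocInv : Ten A M (Ten B N L) →+ Ten B (Ten A M N) L :=
  lift (AddMonoidHom.mk' (fun m => map B (mk A M m) (AddMonoidHom.id L))
      (fun m m' => hom_ext fun n l => by simp [add_tmul]))
    (fun m a t => by
      induction t using Ten.induction with
      | h0 => simp
      | h1 n l =>
        rw [left_smul_tmul]
        change map B (mk A M _) _ _ = map B (mk A M m) _ _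
        simp only [map_tmul, mk_apply, smul_tmul]
      | h2 s t hs ht => simp only [smul_add, map_add, hs, ht])

@[simp] theorem assocHom_tmul (m : M) (n : N) (l : L) :
    assocHom A M N B L (tmul B (tmul A m n) l) = tmul A m (tmul B n l) := by
  rw [assocHom, lift_tmul, lift_tmul]; rfl

theorem assocInv_tmul' (m : M) (t : Ten B N L) :
    assocInv A M N B L (tmul A m t) = map B (mk A M m) (AddMonoidHom.id L) t := by
  rw [assocInv, lift_tmul]; rfl

@[simp] theorem assocInv_tmul (m : M) (n : N) (l : L) :
    assocInv A M N B L (tmul A m (tmul B n l)) = tmul B (tmul A m n) l := by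
  rw [assocInv_tmul', map_tmul]; rfl

theorem assocInv_assocHom (t : Ten B (Ten A M N) L) :
    assocInv A M N B L (assocHom A M N B L t) = t := by
  induction t using Ten.induction with
  | h0 => simp
  | h1 t l =>
    induction t using Ten.induction with
    | h0 => simp
    | h1 m n => simp
    | h2 s t hs ht => simp only [add_tmul, map_add, hs, ht]
  | h2 s t hs ht => simp only [map_add, hs, ht]

theorem assocHom_assocInv (t : Ten A M (Ten B N L)) :
    assocHom A M N B L (assocInv A M N B L t) = t := by
  induction t using Ten.induction with
  | h0 => simp
  | h1 m t =>
    induction t using Ten.induction with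
    | h0 => simp
    | h1 n l => simp
    | h2 s t hs ht => simp only [tmul_add, map_add, hs, ht]
  | h2 s t hs ht => simp only [map_add, hs, ht]

/-- Induction for `(M ⊗ N) ⊗ L`. -/
theorem hom_ext₃ {f g : Ten B (Ten A M N) L →+ P}
    (h : ∀ m n l, f (tmul B (tmul A m n) l) = g (tmul B (tmul A m n) l)) : f = g := by
  refine hom_ext fun t l => ?_
  have : (f.comp ((mk B (Ten A M N)).flip l)) = g.comp ((mk B (Ten A M N)).flip l) :=
    hom_ext fun m n => h m n l
  exact DFunLike.congr_fun this t

variable (A B M N L) in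
/-- The associativity isomorphism `(M ⊗_A N) ⊗_B L ≃ M ⊗_A (N ⊗_B L)`. -/
def assoc : Ten B (Ten A M N) L ≃+ Ten A M (Ten B N L) :=
  { assocHom A M N B L with
    invFun := assocInv A M N B L
    left_inv := assocInv_assocHom
    right_inv := assocHom_assocInv }

@[simp] theorem assoc_tmul (m : M) (n : N) (l : L) :
    assoc A M N B L (tmul B (tmul A m n) l) = tmul A m (tmul B n l) := assocHom_tmul m n l

theorem assoc_symm_tmul' (m : M) (t : Ten B N L) :
    (assoc A M N B L).symm (tmul A m t) = map B (mk A M m) (AddMonoidHom.id L) t :=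
  assocInv_tmul' m t

@[simp] theorem assoc_symm_tmul (m : M) (n : N) (l : L) :
    (assoc A M N B L).symm (tmul A m (tmul B n l)) = tmul B (tmul A m n) l :=
  assocInv_tmul m n l

section
variable {R S : Type*} [Ring R] [Ring S]

instance [Module R M] [SMulCommClass R Aᵐᵒᵖ M] : IsLin R (assoc A M N B L).toAddMonoidHom where
  smul r t := by
    have : ((assoc A M N B L).toAddMonoidHom.comp (lmul R _ r)) =
        (lmul R _ r).comp (assoc A M N B L).toAddMonoidHom := hom_ext₃ fun m n l => by
      change assoc A M N B L (r • tmul B (tmul A m n) l) =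
        r • assoc A M N B L (tmul B (tmul A m n) l)
      simp only [left_smul_tmul, assoc_tmul]
    exact DFunLike.congr_fun this t

instance [Module Sᵐᵒᵖ L] [SMulCommClass B Sᵐᵒᵖ L] :
    IsLin Sᵐᵒᵖ (assoc A M N B L).toAddMonoidHom where
  smul r t := by
    have : ((assoc A M N B L).toAddMonoidHom.comp (lmul Sᵐᵒᵖ _ r)) =
        (lmul Sᵐᵒᵖ _ r).comp (assoc A M N B L).toAddMonoidHom := hom_ext₃ fun m n l => by
      change assoc A M N B L (r • tmul B (tmul A m n) l) =
        r • assoc A M N B L (tmul B (tmul A m n) l)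
      simp only [right_smul_tmul, assoc_tmul]
    exact DFunLike.congr_fun this t

instance [Module R M] [SMulCommClass R Aᵐᵒᵖ M] :
    IsLin R (assoc A M N B L).symm.toAddMonoidHom where
  smul r t := by
    apply (assoc A M N B L).injective
    have := IsLin.smul (f := (assoc A M N B L).toAddMonoidHom) r ((assoc A M N B L).symm t)
    refine Eq.trans ?_ this.symm
    change assoc A M N B L ((assoc A M N B L).symm (r • t)) =
      r • assoc A M N B L ((assoc A M N B L).symm t)
    simp only [AddEquiv.apply_symm_apply]

instance [Module Sᵐᵒᵖ L] [SMulCommClass B Sᵐᵒᵖ L] :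
    IsLin Sᵐᵒᵖ (assoc A M N B L).symm.toAddMonoidHom where
  smul r t := by
    apply (assoc A M N B L).injective
    have := IsLin.smul (f := (assoc A M N B L).toAddMonoidHom) r ((assoc A M N B L).symm t)
    refine Eq.trans ?_ this.symm
    change assoc A M N B L ((assoc A M N B L).symm (r • t)) =
      r • assoc A M N B L ((assoc A M N B L).symm t)
    simp only [AddEquiv.apply_symm_apply]

end

theorem map_congr {f f' : M →+ M'} {g g' : N →+ N'} [IsLin Aᵐᵒᵖ f] [IsLin A g] [IsLin Aᵐᵒᵖ f']
    [IsLin A g'] (hf : ∀ m, f m = f' m) (hg : ∀ n, g n = g' n) (t : Ten A M N) :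
    map A f g t = map A f' g' t := by
  obtain rfl : f = f' := AddMonoidHom.ext hf
  obtain rfl : g = g' := AddMonoidHom.ext hg
  rfl

theorem assoc_map {L' : Type*} [AddCommGroup L'] [Module B L'] [Module Bᵐᵒᵖ N']
    [SMulCommClass A Bᵐᵒᵖ N'] (f : M →+ M') (g : N →+ N') (h : L →+ L') [IsLin Aᵐᵒᵖ f] [IsLin A g]
    [IsLin Bᵐᵒᵖ g] [IsLin B h] (t : Ten B (Ten A M N) L) :
    assoc A M' N' B L' (map B (map A f g) h t) = map A f (map B g h) (assoc A M N B L t) := by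
  have : (assoc A M' N' B L').toAddMonoidHom.comp (map B (map A f g) h) =
      (map A f (map B g h)).comp (assoc A M N B L).toAddMonoidHom := hom_ext₃ fun m n l => by
    change assoc A M' N' B L' (map B (map A f g) h (tmul B (tmul A m n) l)) =
      map A f (map B g h) (assoc A M N B L (tmul B (tmul A m n) l))
    simp only [map_tmul, assoc_tmul]
  exact DFunLike.congr_fun this t

theorem assoc_symm_map {L' : Type*} [AddCommGroup L'] [Module B L'] [Module Bᵐᵒᵖ N']
    [SMulCommClass A Bᵐᵒᵖ N'] (f : M →+ M') (g : N →+ N') (h : L →+ L') [IsLin Aᵐᵒᵖ f] [IsLin A g]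
    [IsLin Bᵐᵒᵖ g] [IsLin B h] (t : Ten A M (Ten B N L)) :
    (assoc A M' N' B L').symm (map A f (map B g h) t) =
      map B (map A f g) h ((assoc A M N B L).symm t) := by
  rw [AddEquiv.symm_apply_eq, assoc_map, AddEquiv.apply_symm_apply]

theorem pentagon {S Q : Type*} [Ring S] [Module Sᵐᵒᵖ L] [SMulCommClass B Sᵐᵒᵖ L] [AddCommGroup Q]
    [Module S Q] (t : Ten S (Ten B (Ten A M N) L) Q) :
    map A (AddMonoidHom.id M) (assoc B N L S Q).toAddMonoidHom
      (assoc A M (Ten B N L) S Q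
        (map S (assoc A M N B L).toAddMonoidHom (AddMonoidHom.id Q) t)) =
      assoc A M N B (Ten S L Q) (assoc B (Ten A M N) L S Q t) := by
  induction t using Ten.induction with
  | h0 => simp only [map_zero]
  | h2 s t hs ht => simp only [map_add, hs, ht]
  | h1 t q =>
    induction t using Ten.induction with
    | h0 => simp only [map_zero, zero_tmul]
    | h2 s t hs ht => simp only [map_add, add_tmul, hs, ht]
    | h1 t l =>
      induction t using Ten.induction with
      | h0 => simp only [map_zero, zero_tmul]
      | h2 s t hs ht => simp only [map_add, add_tmul, hs, ht]
      | h1 m n =>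
        rw [map_tmul]
        change map A _ _ (assoc A M (Ten B N L) S Q
          (tmul S (assoc A M N B L (tmul B (tmul A m n) l)) q)) = _
        simp only [assoc_tmul, map_tmul]
        exact congrArg (tmul A m) (assoc_tmul n l q)

end assoc

end Ten

end Tensor

/-! ## Flat modules -/

section Flat

variable (A : Type u) [Ring A]

/-- A left `A`-module `N` is flat if `- ⊗_A N` preserves injections. -/
def FlatLeft (N : Type u) [AddCommGroup N] [Module A N] : Prop :=
  ∀ (M M' : Type u) [AddCommGroup M] [AddCommGroup M'] [Module Aᵐᵒᵖ M] [Module Aᵐᵒᵖ M']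
    (f : M →+ M') [IsLin Aᵐᵒᵖ f], Function.Injective f →
      Function.Injective (Ten.map A f (AddMonoidHom.id N))

/-- A right `A`-module `M` is flat if `M ⊗_A -` preserves injections. -/
def FlatRight (M : Type u) [AddCommGroup M] [Module Aᵐᵒᵖ M] : Prop :=
  ∀ (N N' : Type u) [AddCommGroup N] [AddCommGroup N'] [Module A N] [Module A N']
    (f : N →+ N') [IsLin A f], Function.Injective f →
      Function.Injective (Ten.map A (AddMonoidHom.id M) f)

variable {A}

theorem FlatLeft.exact {N : Type u} [AddCommGroup N] [Module A N] (hN : FlatLeft A N)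
    {M M' : Type u} [AddCommGroup M] [AddCommGroup M'] [Module Aᵐᵒᵖ M] [Module Aᵐᵒᵖ M']
    (f : M →+ M') [IsLin Aᵐᵒᵖ f] (K : Submodule Aᵐᵒᵖ M) (hK : ∀ m, f m = 0 → m ∈ K)
    (t : Ten A M N) (ht : Ten.map A f (AddMonoidHom.id N) t = 0) :
    ∃ s : Ten A K N, Ten.map A K.subtype.toAddMonoidHom (AddMonoidHom.id N) s = t := by
  let R := LinearMap.range (IsLin.toLin Aᵐᵒᵖ f)
  let q : M →ₗ[Aᵐᵒᵖ] R := (IsLin.toLin Aᵐᵒᵖ f).rangeRestrict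
  have hfac : ∀ t : Ten A M N, Ten.map A f (AddMonoidHom.id N) t =
      Ten.map A R.subtype.toAddMonoidHom (AddMonoidHom.id N)
        (Ten.map A q.toAddMonoidHom (AddMonoidHom.id N) t) := fun t => by
    rw [Ten.map_map]; exact Ten.map_congr (fun _ => rfl) (fun _ => rfl) t
  have hq : Ten.map A q.toAddMonoidHom (AddMonoidHom.id N) t = 0 := by
    apply hN _ _ R.subtype.toAddMonoidHom R.injective_subtype
    rw [← hfac, ht, map_zero]
  let J := (Ten.map A K.subtype.toAddMonoidHom (AddMonoidHom.id N)).range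
  let π := QuotientAddGroup.mk' J
  have key : ∀ (m m' : M) (n : N), q m = q m' → π (Ten.tmul A m n) = π (Ten.tmul A m' n) := by
    intro m m' n h
    rw [← sub_eq_zero, ← map_sub]
    refine (QuotientAddGroup.eq_zero_iff _).2 ?_
    refine ⟨Ten.tmul A (⟨m - m', hK _ ?_⟩ : K) n, ?_⟩
    · have := congrArg Subtype.val h
      rw [map_sub, sub_eq_zero]; exact this
    · rw [Ten.map_tmul]
      change Ten.tmul A (m - m') n = _
      rw [eq_sub_iff_add_eq, ← Ten.add_tmul, sub_add_cancel]
  have hs : Function.Surjective q := (IsLin.toLin Aᵐᵒᵖ f).surjective_rangeRestrict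
  let g : Ten A R N →+ Ten A M N ⧸ J := Ten.lift
    (AddMonoidHom.mk' (fun r => π.comp (Ten.mk A M (Function.surjInv hs r))) (fun r r' => by
      ext n
      change π (Ten.tmul A _ n) = π (Ten.tmul A _ n) + π (Ten.tmul A _ n)
      rw [← map_add, ← Ten.add_tmul]
      apply key
      rw [map_add, Function.surjInv_eq hs, Function.surjInv_eq hs, Function.surjInv_eq hs]))
    (fun r a n => by
      change π (Ten.tmul A _ n) = π (Ten.tmul A _ (a • n))
      rw [← Ten.smul_tmul]
      apply key
      rw [map_smul, Function.surjInv_eq hs, Function.surjInv_eq hs])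
  have hg : ∀ t, g (Ten.map A q.toAddMonoidHom (AddMonoidHom.id N) t) = π t := fun t => by
    have : g.comp (Ten.map A q.toAddMonoidHom (AddMonoidHom.id N)) = π := Ten.hom_ext fun m n => by
      rw [AddMonoidHom.comp_apply, Ten.map_tmul, Ten.lift_tmul]
      exact key _ _ _ (Function.surjInv_eq hs _)
    exact DFunLike.congr_fun this t
  have := hg t
  rw [hq, map_zero] at this
  exact (QuotientAddGroup.eq_zero_iff _).1 this.symm

theorem FlatRight.exact {M : Type u} [AddCommGroup M] [Module Aᵐᵒᵖ M] (hM : FlatRight A M)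
    {N N' : Type u} [AddCommGroup N] [AddCommGroup N'] [Module A N] [Module A N']
    (f : N →+ N') [IsLin A f] (K : Submodule A N) (hK : ∀ n, f n = 0 → n ∈ K)
    (t : Ten A M N) (ht : Ten.map A (AddMonoidHom.id M) f t = 0) :
    ∃ s : Ten A M K, Ten.map A (AddMonoidHom.id M) K.subtype.toAddMonoidHom s = t := by
  let R := LinearMap.range (IsLin.toLin A f)
  let q : N →ₗ[A] R := (IsLin.toLin A f).rangeRestrict
  have hfac : ∀ t : Ten A M N, Ten.map A (AddMonoidHom.id M) f t =
      Ten.map A (AddMonoidHom.id M) R.subtype.toAddMonoidHom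
        (Ten.map A (AddMonoidHom.id M) q.toAddMonoidHom t) := fun t => by
    rw [Ten.map_map]; exact Ten.map_congr (fun _ => rfl) (fun _ => rfl) t
  have hq : Ten.map A (AddMonoidHom.id M) q.toAddMonoidHom t = 0 := by
    apply hM _ _ R.subtype.toAddMonoidHom R.injective_subtype
    rw [← hfac, ht, map_zero]
  let J := (Ten.map A (AddMonoidHom.id M) K.subtype.toAddMonoidHom).range
  let π := QuotientAddGroup.mk' J
  have key : ∀ (m : M) (n n' : N), q n = q n' → π (Ten.tmul A m n) = π (Ten.tmul A m n') := by
    intro m n n' h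
    rw [← sub_eq_zero, ← map_sub]
    refine (QuotientAddGroup.eq_zero_iff _).2 ?_
    refine ⟨Ten.tmul A m (⟨n - n', hK _ ?_⟩ : K), ?_⟩
    · have := congrArg Subtype.val h
      rw [map_sub, sub_eq_zero]; exact this
    · rw [Ten.map_tmul]
      change Ten.tmul A m (n - n') = _
      rw [eq_sub_iff_add_eq, ← Ten.tmul_add, sub_add_cancel]
  have hs : Function.Surjective q := (IsLin.toLin A f).surjective_rangeRestrict
  let g : Ten A M R →+ Ten A M N ⧸ J := Ten.lift
    (AddMonoidHom.mk' (fun m => AddMonoidHom.mk'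
      (fun r => π (Ten.tmul A m (Function.surjInv hs r))) (fun r r' => by
        rw [← map_add, ← Ten.tmul_add]
        apply key
        rw [map_add, Function.surjInv_eq hs, Function.surjInv_eq hs, Function.surjInv_eq hs]))
      (fun m m' => by
        ext r
        change π _ = π _ + π _
        rw [← map_add, ← Ten.add_tmul]))
    (fun m a r => by
      change π (Ten.tmul A _ _) = π (Ten.tmul A _ _)
      rw [Ten.smul_tmul]
      apply key
      rw [map_smul, Function.surjInv_eq hs, Function.surjInv_eq hs])
  have hg : ∀ t, g (Ten.map A (AddMonoidHom.id M) q.toAddMonoidHom t) = π t := fun t => by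
    have : g.comp (Ten.map A (AddMonoidHom.id M) q.toAddMonoidHom) = π := Ten.hom_ext fun m n => by
      rw [AddMonoidHom.comp_apply, Ten.map_tmul, Ten.lift_tmul]
      exact key _ _ _ (Function.surjInv_eq hs _)
    exact DFunLike.congr_fun this t
  have := hg t
  rw [hq, map_zero] at this
  exact (QuotientAddGroup.eq_zero_iff _).1 this.symm

end Flat

/-! ## Corings, comodules and bicomodules -/

open Ten (map lid rid assoc tmul)

/-- The identity map of the additive group `M`. -/
abbrev idh (M : Type*) [AddCommGroup M] : M →+ M := AddMonoidHom.id M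

/-- An `A`-coring: an `A`-bimodule with a coassociative and counital comultiplication. -/
structure Coring (A : Type u) [Ring A] where
  /-- the underlying bimodule -/
  carrier : Type u
  [addCommGroup : AddCommGroup carrier]
  [leftMod : Module A carrier]
  [rightMod : Module Aᵐᵒᵖ carrier]
  [comm : SMulCommClass A Aᵐᵒᵖ carrier]
  /-- the comultiplication -/
  Δ : carrier →+ Ten A carrier carrier
  [Δ_left : IsLin A Δ]
  [Δ_right : IsLin Aᵐᵒᵖ Δ]
  /-- the counit -/
  ε : carrier →+ A
  [ε_left : IsLin A ε]
  [ε_right : IsLin Aᵐᵒᵖ ε]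
  coassoc : ∀ c, assoc A carrier carrier A carrier (map A Δ (idh carrier) (Δ c)) =
    map A (idh carrier) Δ (Δ c)
  counit_left : ∀ c, lid carrier (map A ε (idh carrier) (Δ c)) = c
  counit_right : ∀ c, rid carrier (map A (idh carrier) ε (Δ c)) = c

instance (A : Type u) [Ring A] : CoeSort (Coring A) (Type u) := ⟨Coring.carrier⟩

attribute [instance] Coring.addCommGroup Coring.leftMod Coring.rightMod Coring.comm Coring.Δ_left
  Coring.Δ_right Coring.ε_left Coring.ε_right

variable {A B : Type u} [Ring A] [Ring B]

/-- A right comodule over the coring `C`. -/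
structure RComod (C : Coring A) where
  /-- the underlying right module -/
  carrier : Type u
  [addCommGroup : AddCommGroup carrier]
  [rightMod : Module Aᵐᵒᵖ carrier]
  /-- the coaction -/
  rho : carrier →+ Ten A carrier C
  [rho_right : IsLin Aᵐᵒᵖ rho]
  coassoc : ∀ m, assoc A carrier C A C (map A rho (idh C) (rho m)) = map A (idh carrier) C.Δ (rho m)
  counit : ∀ m, rid carrier (map A (idh carrier) C.ε (rho m)) = m

instance (C : Coring A) : CoeSort (RComod C) (Type u) := ⟨RComod.carrier⟩

attribute [instance] RComod.addCommGroup RComod.rightMod RComod.rho_right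

/-- A left comodule over the coring `C`. -/
structure LComod (C : Coring A) where
  /-- the underlying left module -/
  carrier : Type u
  [addCommGroup : AddCommGroup carrier]
  [leftMod : Module A carrier]
  /-- the coaction -/
  lam : carrier →+ Ten A C carrier
  [lam_left : IsLin A lam]
  coassoc : ∀ m, assoc A C C A carrier (map A C.Δ (idh carrier) (lam m)) = map A (idh C) lam (lam m)
  counit : ∀ m, lid carrier (map A C.ε (idh carrier) (lam m)) = m

instance (C : Coring A) : CoeSort (LComod C) (Type u) := ⟨LComod.carrier⟩

attribute [instance] LComod.addCommGroup LComod.leftMod LComod.lam_left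

/-- A `C`-`D`-bicomodule: a bimodule with a left `C`-coaction and a right `D`-coaction, both of them
bimodule maps, that commute. -/
structure Bicomod (C : Coring A) (D : Coring B) where
  /-- the underlying bimodule -/
  carrier : Type u
  [addCommGroup : AddCommGroup carrier]
  [leftMod : Module A carrier]
  [rightMod : Module Bᵐᵒᵖ carrier]
  [comm : SMulCommClass A Bᵐᵒᵖ carrier]
  /-- the left coaction -/
  lam : carrier →+ Ten A C carrier
  [lam_left : IsLin A lam]
  [lam_right : IsLin Bᵐᵒᵖ lam]
  /-- the right coaction -/
  rho : carrier →+ Ten B carrier D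
  [rho_left : IsLin A rho]
  [rho_right : IsLin Bᵐᵒᵖ rho]
  lam_coassoc : ∀ x, assoc A C C A carrier (map A C.Δ (idh carrier) (lam x)) =
    map A (idh C) lam (lam x)
  lam_counit : ∀ x, lid carrier (map A C.ε (idh carrier) (lam x)) = x
  rho_coassoc : ∀ x, assoc B carrier D B D (map B rho (idh D) (rho x)) =
    map B (idh carrier) D.Δ (rho x)
  rho_counit : ∀ x, rid carrier (map B (idh carrier) D.ε (rho x)) = x
  compat : ∀ x, assoc A C carrier B D (map B lam (idh D) (rho x)) = map A (idh C) rho (lam x)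

instance (C : Coring A) (D : Coring B) : CoeSort (Bicomod C D) (Type u) := ⟨Bicomod.carrier⟩

attribute [instance] Bicomod.addCommGroup Bicomod.leftMod Bicomod.rightMod Bicomod.comm
  Bicomod.lam_left Bicomod.lam_right Bicomod.rho_left Bicomod.rho_right

/-- Morphisms of right comodules. -/
@[ext]
structure RComod.Hom {C : Coring A} (M N : RComod C) where
  /-- the underlying map -/
  hom : M →+ N
  [lin : IsLin Aᵐᵒᵖ hom]
  colin : ∀ m, map A hom (idh C) (M.rho m) = N.rho (hom m)

/-- Morphisms of left comodules. -/
@[ext]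
structure LComod.Hom {C : Coring A} (M N : LComod C) where
  /-- the underlying map -/
  hom : M →+ N
  [lin : IsLin A hom]
  colin : ∀ m, map A (idh C) hom (M.lam m) = N.lam (hom m)

/-- Morphisms of bicomodules. -/
@[ext]
structure Bicomod.Hom {C : Coring A} {D : Coring B} (X Y : Bicomod C D) where
  /-- the underlying map -/
  hom : X →+ Y
  [lin_left : IsLin A hom]
  [lin_right : IsLin Bᵐᵒᵖ hom]
  colin_left : ∀ x, map A (idh C) hom (X.lam x) = Y.lam (hom x)
  colin_right : ∀ x, map B hom (idh D) (X.rho x) = Y.rho (hom x)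

attribute [instance] RComod.Hom.lin LComod.Hom.lin Bicomod.Hom.lin_left Bicomod.Hom.lin_right

/-- The category of right `C`-comodules. -/
instance (C : Coring A) : Category (RComod C) where
  Hom M N := RComod.Hom M N
  id M := { hom := idh M, colin := fun m => Ten.map_id _ }
  comp f g :=
    { hom := g.hom.comp f.hom
      colin := fun m => by
        rw [AddMonoidHom.comp_apply, ← g.colin, ← f.colin, Ten.map_map]
        exact Ten.map_congr (fun _ => rfl) (fun _ => rfl) _ }

/-- The category of left `C`-comodules. -/
instance (C : Coring A) : Category (LComod C) where
  Hom M N := LComod.Hom M N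
  id M := { hom := idh M, colin := fun m => Ten.map_id _ }
  comp f g :=
    { hom := g.hom.comp f.hom
      colin := fun m => by
        rw [AddMonoidHom.comp_apply, ← g.colin, ← f.colin, Ten.map_map]
        exact Ten.map_congr (fun _ => rfl) (fun _ => rfl) _ }

/-- The category of `C`-`D`-bicomodules. -/
instance (C : Coring A) (D : Coring B) : Category (Bicomod C D) where
  Hom M N := Bicomod.Hom M N
  id M := { hom := idh M, colin_left := fun m => Ten.map_id _, colin_right := fun m => Ten.map_id _ }
  comp f g :=
    { hom := g.hom.comp f.hom
      colin_left := fun m => by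
        rw [AddMonoidHom.comp_apply, ← g.colin_left, ← f.colin_left, Ten.map_map]
        exact Ten.map_congr (fun _ => rfl) (fun _ => rfl) _
      colin_right := fun m => by
        rw [AddMonoidHom.comp_apply, ← g.colin_right, ← f.colin_right, Ten.map_map]
        exact Ten.map_congr (fun _ => rfl) (fun _ => rfl) _ }

theorem RComod.hom_ext' {C : Coring A} {M N : RComod C} {f g : M ⟶ N}
    (h : ∀ m, f.hom m = g.hom m) : f = g :=
  RComod.Hom.ext (AddMonoidHom.ext h)

theorem LComod.hom_ext' {C : Coring A} {M N : LComod C} {f g : M ⟶ N}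
    (h : ∀ m, f.hom m = g.hom m) : f = g :=
  LComod.Hom.ext (AddMonoidHom.ext h)

section Basic

variable {C : Coring A} {D : Coring B}

/-- The underlying left comodule of a bicomodule. -/
abbrev Bicomod.toL (X : Bicomod C D) : LComod C where
  carrier := X
  lam := X.lam
  coassoc := X.lam_coassoc
  counit := X.lam_counit

/-- The underlying right comodule of a bicomodule. -/
abbrev Bicomod.toR (X : Bicomod C D) : RComod D where
  carrier := X
  rho := X.rho
  coassoc := X.rho_coassoc
  counit := X.rho_counit

/-- The bicomodule `C`. -/
abbrev Coring.regular (C : Coring A) : Bicomod C C where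
  carrier := C
  lam := C.Δ
  rho := C.Δ
  lam_coassoc := C.coassoc
  lam_counit := C.counit_left
  rho_coassoc := C.coassoc
  rho_counit := C.counit_right
  compat := C.coassoc

/-- A coring is coseparable if its comultiplication `C → C ⊗_A C` has a left inverse that is a
morphism of bicomodules (`C ⊗_A C` has left coaction `Δ ⊗ C` and right coaction `C ⊗ Δ`). -/
def Coring.IsCoseparable (C : Coring A) : Prop :=
  ∃ (π : Ten A C C →+ C) (_ : IsLin A π) (_ : IsLin Aᵐᵒᵖ π),
    (∀ c, π (C.Δ c) = c) ∧
    (∀ t, map A (idh C) π (assoc A C C A C (map A C.Δ (idh C) t)) = C.Δ (π t)) ∧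
    (∀ t, map A π (idh C) ((assoc A C C A C).symm (map A (idh C) C.Δ t)) = C.Δ (π t))

/-- The right `D`-comodule `V ⊗_A X`. -/
abbrev Bicomod.tenR (X : Bicomod C D) (V : Type u) [AddCommGroup V] [Module Aᵐᵒᵖ V] : RComod D where
  carrier := Ten A V X
  rho := (assoc A V X B D).symm.toAddMonoidHom.comp (map A (idh V) X.rho)
  coassoc t := by
    induction t using Ten.induction with
    | h0 => simp only [map_zero]
    | h2 s t hs ht => simp only [map_add, hs, ht]
    | h1 v x =>
      have hρ : ∀ x, (assoc A V X B D).symm.toAddMonoidHom.comp (map A (idh V) X.rho)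
          (tmul A v x) = map B (Ten.mk A V v) (idh D) (X.rho x) := fun x => by
        rw [AddMonoidHom.comp_apply, Ten.map_tmul]
        exact Ten.assoc_symm_tmul' v (X.rho x)
      rw [hρ, Ten.map_map, Ten.map_map]
      rw [Ten.map_congr (f' := (map B (Ten.mk A V v) (idh D)).comp X.rho)
        (g' := (idh D).comp (idh D)) hρ (fun _ => rfl), ← Ten.map_map, Ten.assoc_map, X.rho_coassoc,
        Ten.map_map]
      refine Ten.map_congr (fun _ => rfl) (fun d => ?_) _
      exact Ten.map_id _
  counit t := by
    induction t using Ten.induction with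
    | h0 => simp only [map_zero]
    | h2 s t hs ht => simp only [map_add, hs, ht]
    | h1 v x =>
      have hρ : (assoc A V X B D).symm.toAddMonoidHom.comp (map A (idh V) X.rho)
          (tmul A v x) = map B (Ten.mk A V v) (idh D) (X.rho x) := by
        rw [AddMonoidHom.comp_apply, Ten.map_tmul]
        exact Ten.assoc_symm_tmul' v (X.rho x)
      rw [hρ, Ten.map_map]
      have key : ∀ y : Ten B X D, rid (Ten A V X)
          (map B ((idh (Ten A V X)).comp (Ten.mk A V v)) (D.ε.comp (idh D)) y) =
          tmul A v (rid X (map B (idh X) D.ε y)) := fun y => by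
        induction y using Ten.induction with
        | h0 => simp only [map_zero, Ten.tmul_zero]
        | h2 s t hs ht => simp only [map_add, hs, ht, Ten.tmul_add]
        | h1 x d =>
          simp only [Ten.map_tmul, Ten.rid_tmul]
          exact Ten.right_smul_tmul _ v x
      rw [key, X.rho_counit]

/-- The left `C`-comodule `X ⊗_B V`. -/
abbrev Bicomod.tenL (X : Bicomod C D) (V : Type u) [AddCommGroup V] [Module B V] : LComod C where
  carrier := Ten B X V
  lam := (assoc A C X B V).toAddMonoidHom.comp (map B X.lam (idh V))
  coassoc t := by
    induction t using Ten.induction with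
    | h0 => simp only [map_zero]
    | h2 s t hs ht => simp only [map_add, hs, ht]
    | h1 x v =>
      have hρ : ∀ x, (assoc A C X B V).toAddMonoidHom.comp (map B X.lam (idh V))
          (tmul B x v) = map A (idh C) ((Ten.mk B X (N := V)).flip v) (X.lam x) := fun x => by
        rw [AddMonoidHom.comp_apply, Ten.map_tmul]
        change assoc A C X B V (tmul B (X.lam x) v) = _
        induction X.lam x using Ten.induction with
        | h0 => simp only [map_zero, Ten.zero_tmul]
        | h2 s t hs ht => simp only [map_add, Ten.add_tmul, hs, ht]
        | h1 c x => simp only [Ten.assoc_tmul, Ten.map_tmul]; rfl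
      rw [hρ, Ten.map_map, Ten.map_map]
      rw [Ten.map_congr (A := A) (f := (idh C).comp (idh C)) (f' := (idh C).comp (idh C))
        (g' := (map A (idh C) ((Ten.mk B X (N := V)).flip v)).comp X.lam) (fun _ => rfl) hρ]
      refine Eq.trans ?_ (Ten.map_map _ _ _ _ _)
      rw [← X.lam_coassoc, ← Ten.assoc_map, Ten.map_map]
      congr 1
      refine Ten.map_congr (fun c => ?_) (fun _ => rfl) _
      exact (Ten.map_id _).symm
  counit t := by
    induction t using Ten.induction with
    | h0 => simp only [map_zero]
    | h2 s t hs ht => simp only [map_add, hs, ht]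
    | h1 x v =>
      have hρ : ∀ x, (assoc A C X B V).toAddMonoidHom.comp (map B X.lam (idh V))
          (tmul B x v) = map A (idh C) ((Ten.mk B X (N := V)).flip v) (X.lam x) := fun x => by
        rw [AddMonoidHom.comp_apply, Ten.map_tmul]
        change assoc A C X B V (tmul B (X.lam x) v) = _
        induction X.lam x using Ten.induction with
        | h0 => simp only [map_zero, Ten.zero_tmul]
        | h2 s t hs ht => simp only [map_add, Ten.add_tmul, hs, ht]
        | h1 c x => simp only [Ten.assoc_tmul, Ten.map_tmul]; rfl
      rw [hρ, Ten.map_map]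
      have key : ∀ y : Ten A C X, lid (Ten B X V)
          (map A (C.ε.comp (idh C)) ((idh (Ten B X V)).comp ((Ten.mk B X (N := V)).flip v)) y) =
          tmul B (lid X (map A C.ε (idh X) y)) v := fun y => by
        induction y using Ten.induction with
        | h0 => simp only [map_zero, Ten.zero_tmul]
        | h2 s t hs ht => simp only [map_add, hs, ht, Ten.add_tmul]
        | h1 c x =>
          simp only [Ten.map_tmul, Ten.lid_tmul]
          exact Ten.left_smul_tmul _ x v
      rw [key, X.lam_counit]

/-- The functor `- ⊗_A X` from right `A`-modules to right `D`-comodules. -/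
def Bicomod.tensorR (X : Bicomod C D) : ModuleCat.{u} Aᵐᵒᵖ ⥤ RComod D where
  obj V := X.tenR V
  map {V W} f :=
    { hom := map A f.hom.toAddMonoidHom (idh X)
      lin := inferInstanceAs (IsLin Bᵐᵒᵖ (map A f.hom.toAddMonoidHom (idh X)))
      colin := fun (t : Ten A V X) => by
        change map B (map A f.hom.toAddMonoidHom (idh X)) (idh D)
          ((assoc A V X B D).symm (map A (idh V) X.rho t)) =
          (assoc A W X B D).symm (map A (idh W) X.rho (map A f.hom.toAddMonoidHom (idh X) t))
        rw [← Ten.assoc_symm_map, Ten.map_map, Ten.map_map]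
        congr 1
        refine Ten.map_congr (fun _ => rfl) (fun x => ?_) t
        exact Ten.map_id _ }
  map_id V := RComod.hom_ext' fun t => Ten.map_id t
  map_comp {U V W} f g := RComod.hom_ext' fun (t : Ten A U X) => by
    change map A (f ≫ g).hom.toAddMonoidHom (idh X) t =
      map A g.hom.toAddMonoidHom (idh X) (map A f.hom.toAddMonoidHom (idh X) t)
    rw [Ten.map_map]
    exact Ten.map_congr (fun _ => rfl) (fun _ => rfl) t

/-- The functor `X ⊗_B -` from left `B`-modules to left `C`-comodules. -/
def Bicomod.tensorL (X : Bicomod C D) : ModuleCat.{u} B ⥤ LComod C where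
  obj V := X.tenL V
  map {V W} f :=
    { hom := map B (idh X) f.hom.toAddMonoidHom
      lin := inferInstanceAs (IsLin A (map B (idh X) f.hom.toAddMonoidHom))
      colin := fun (t : Ten B X V) => by
        change map A (idh C) (map B (idh X) f.hom.toAddMonoidHom)
          (assoc A C X B V (map B X.lam (idh V) t)) =
          assoc A C X B W (map B X.lam (idh W) (map B (idh X) f.hom.toAddMonoidHom t))
        rw [← Ten.assoc_map, Ten.map_map, Ten.map_map]
        congr 1
        refine Ten.map_congr (fun x => ?_) (fun _ => rfl) t
        exact Ten.map_id _ }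
  map_id V := LComod.hom_ext' fun t => Ten.map_id t
  map_comp {U V W} f g := LComod.hom_ext' fun (t : Ten B X U) => by
    change map B (idh X) (f ≫ g).hom.toAddMonoidHom t =
      map B (idh X) g.hom.toAddMonoidHom (map B (idh X) f.hom.toAddMonoidHom t)
    rw [Ten.map_map]
    exact Ten.map_congr (fun _ => rfl) (fun _ => rfl) t

end Basic

/-! ## Subcomodules -/

section Sub

variable {C : Coring A}

/-- A submodule `K` whose coaction factors through `K ⊗_A C`, as a right comodule (here `_A C` is
flat, so that `K ⊗_A C` is contained in `M ⊗_A C`). -/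
noncomputable def RComod.sub (hC : FlatLeft A C) (M : RComod C) (K : Submodule Aᵐᵒᵖ M)
    (hK : ∀ k : K, ∃ s : Ten A K C, map A K.subtype.toAddMonoidHom (idh C) s = M.rho k) :
    RComod C :=
  have inj : Function.Injective (map A K.subtype.toAddMonoidHom (idh C)) :=
    hC _ _ _ K.injective_subtype
  let r : K →+ Ten A K C := AddMonoidHom.mk' (fun k => (hK k).choose) (fun k k' => by
    apply inj
    rw [map_add, (hK _).choose_spec, (hK _).choose_spec, (hK _).choose_spec]
    exact map_add M.rho _ _)
  have hr : ∀ k, map A K.subtype.toAddMonoidHom (idh C) (r k) = M.rho k :=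
    fun k => (hK k).choose_spec
  haveI : IsLin Aᵐᵒᵖ r := ⟨fun a k => by
    apply inj
    rw [IsLin.smul a (r k), hr, hr]
    exact IsLin.smul a (k : M)⟩
  { carrier := K
    rho := r
    coassoc := fun k => by
      have inj2 : Function.Injective (map A K.subtype.toAddMonoidHom (idh (Ten A C C))) := by
        intro x y h
        obtain ⟨x, rfl⟩ := (assoc A K C A C).surjective x
        obtain ⟨y, rfl⟩ := (assoc A K C A C).surjective y
        have e : ∀ z, map A K.subtype.toAddMonoidHom (idh (Ten A C C)) (assoc A K C A C z) =
            assoc A M C A C (map A (map A K.subtype.toAddMonoidHom (idh C)) (idh C) z) :=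
          fun z => by
            rw [Ten.assoc_map]
            exact Ten.map_congr (fun _ => rfl) (fun c => (Ten.map_id c).symm) _
        rw [e, e] at h
        exact congrArg _ (hC _ _ _ inj ((assoc A M C A C).injective h))
      apply inj2
      have e : ∀ z, map A K.subtype.toAddMonoidHom (idh (Ten A C C)) (assoc A K C A C z) =
          assoc A M C A C (map A (map A K.subtype.toAddMonoidHom (idh C)) (idh C) z) :=
        fun z => by
          rw [Ten.assoc_map]
          exact Ten.map_congr (fun _ => rfl) (fun c => (Ten.map_id c).symm) _
      rw [e, Ten.map_map, Ten.map_congr (f' := M.rho.comp K.subtype.toAddMonoidHom)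
        (g' := (idh C).comp (idh C)) hr (fun _ => rfl), ← Ten.map_map, hr, M.coassoc,
        ← hr, Ten.map_map, Ten.map_map]
      exact Ten.map_congr (fun _ => rfl) (fun _ => rfl) _
    counit := fun k => by
      apply K.injective_subtype
      have e : ∀ z, K.subtype (rid K (map A (idh K) C.ε z)) =
          rid M (map A (idh M) C.ε (map A K.subtype.toAddMonoidHom (idh C) z)) := fun z => by
        induction z using Ten.induction with
        | h0 => simp only [map_zero]
        | h2 s t hs ht => simp only [map_add, hs, ht]
        | h1 k c => simp only [Ten.map_tmul, Ten.rid_tmul]; rfl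
      rw [e, hr, M.counit]; rfl }

theorem RComod.sub_rho (hC : FlatLeft A C) (M : RComod C) (K : Submodule Aᵐᵒᵖ M)
    (hK : ∀ k : K, ∃ s : Ten A K C, map A K.subtype.toAddMonoidHom (idh C) s = M.rho k) (k : K) :
    map A K.subtype.toAddMonoidHom (idh C) ((RComod.sub hC M K hK).rho k) = M.rho k :=
  (hK k).choose_spec

/-- A submodule `K` whose coaction factors through `C ⊗_A K`, as a left comodule (here `C_A` is
flat, so that `C ⊗_A K` is contained in `C ⊗_A M`). -/
noncomputable def LComod.sub (hC : FlatRight A C) (M : LComod C) (K : Submodule A M)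
    (hK : ∀ k : K, ∃ s : Ten A C K, map A (idh C) K.subtype.toAddMonoidHom s = M.lam k) :
    LComod C :=
  have inj : Function.Injective (map A (idh C) K.subtype.toAddMonoidHom) :=
    hC _ _ _ K.injective_subtype
  let r : K →+ Ten A C K := AddMonoidHom.mk' (fun k => (hK k).choose) (fun k k' => by
    apply inj
    rw [map_add, (hK _).choose_spec, (hK _).choose_spec, (hK _).choose_spec]
    exact map_add M.lam _ _)
  have hr : ∀ k, map A (idh C) K.subtype.toAddMonoidHom (r k) = M.lam k :=
    fun k => (hK k).choose_spec
  haveI : IsLin A r := ⟨fun a k => by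
    apply inj
    rw [IsLin.smul a (r k), hr, hr]
    exact IsLin.smul a (k : M)⟩
  { carrier := K
    lam := r
    coassoc := fun k => by
      have e : ∀ z, map A (idh C) (map A (idh C) K.subtype.toAddMonoidHom) (assoc A C C A K z) =
          assoc A C C A M (map A (idh (Ten A C C)) K.subtype.toAddMonoidHom z) :=
        fun z => by
          rw [← Ten.assoc_map]
          exact congrArg _ (Ten.map_congr (fun c => Ten.map_id c) (fun _ => rfl) _)
      apply hC _ _ (map A (idh C) K.subtype.toAddMonoidHom) inj
      rw [e, Ten.map_map, Ten.map_map]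
      rw [Ten.map_congr (A := A) (f := (idh C).comp (idh C)) (f' := (idh C).comp (idh C))
        (g' := M.lam.comp K.subtype.toAddMonoidHom) (fun _ => rfl) hr]
      refine Eq.trans ?_ (Ten.map_map _ _ _ _ _)
      rw [hr, ← M.coassoc, ← hr, Ten.map_map]
      exact congrArg _ (Ten.map_congr (fun _ => rfl) (fun _ => rfl) _)
    counit := fun k => by
      apply K.injective_subtype
      have e : ∀ z, K.subtype (lid K (map A C.ε (idh K) z)) =
          lid M (map A C.ε (idh M) (map A (idh C) K.subtype.toAddMonoidHom z)) := fun z => by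
        induction z using Ten.induction with
        | h0 => simp only [map_zero]
        | h2 s t hs ht => simp only [map_add, hs, ht]
        | h1 c k => simp only [Ten.map_tmul, Ten.lid_tmul]; rfl
      rw [e, hr, M.counit]; rfl }

theorem LComod.sub_lam (hC : FlatRight A C) (M : LComod C) (K : Submodule A M)
    (hK : ∀ k : K, ∃ s : Ten A C K, map A (idh C) K.subtype.toAddMonoidHom s = M.lam k) (k : K) :
    map A (idh C) K.subtype.toAddMonoidHom ((LComod.sub hC M K hK).lam k) = M.lam k :=
  (hK k).choose_spec

end Sub

/-! ## Cotensor products -/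

section Cotensor

variable {C : Coring A} {D : Coring B}

/-- The map `ω = ρ_M ⊗ N - M ⊗ λ_N : M ⊗_A N → M ⊗_A C ⊗_A N`. -/
def omega (M : RComod C) (N : LComod C) : Ten A M N →+ Ten A M (Ten A C N) :=
  (assoc A M C A N).toAddMonoidHom.comp (map A M.rho (idh N)) - map A (idh M) N.lam

/-- The cotensor product `M □_C N`, the kernel of `ω`. -/
def cot (M : RComod C) (N : LComod C) : AddSubgroup (Ten A M N) := (omega M N).ker

theorem omega_natural {M M' : RComod C} {N N' : LComod C} (f : M ⟶ M') (g : N ⟶ N')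
    (t : Ten A M N) : omega M' N' (map A f.hom g.hom t) =
      map A f.hom (map A (idh C) g.hom) (omega M N t) := by
  change assoc A M' C A N' (map A M'.rho (idh N') (map A f.hom g.hom t)) -
    map A (idh M') N'.lam (map A f.hom g.hom t) =
    map A f.hom (map A (idh C) g.hom)
      (assoc A M C A N (map A M.rho (idh N) t) - map A (idh M) N.lam t)
  rw [map_sub, ← Ten.assoc_map]
  simp only [Ten.map_map]
  congr 1
  · exact congrArg _ (Ten.map_congr (fun m => (f.colin m).symm) (fun _ => rfl) t)
  · exact Ten.map_congr (fun _ => rfl) (fun n => (g.colin n).symm) t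

/-- The map `f □_C g`. -/
def cotMap {M M' : RComod C} {N N' : LComod C} (f : M ⟶ M') (g : N ⟶ N') :
    cot M N →+ cot M' N' :=
  ((map A f.hom g.hom).comp (cot M N).subtype).codRestrict (cot M' N') (fun t => by
    change omega M' N' (map A f.hom g.hom t) = 0
    rw [omega_natural, (show omega M N t = 0 from t.2), map_zero])

/-- `ω` for a right comodule and a bicomodule. -/
def omegaR (M : RComod C) (X : Bicomod C D) : Ten A M X →+ Ten A M (Ten A C X) :=
  omega M X.toL

/-- `ω` for a bicomodule and a left comodule. -/
def omegaL (X : Bicomod C D) (N : LComod D) : Ten B X N →+ Ten B X (Ten B D N) :=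
  omega X.toR N

instance (M : RComod C) (X : Bicomod C D) : IsLin Bᵐᵒᵖ (omegaR M X) where
  smul b t := by
    have h1 := IsLin.smul (f := (assoc A M C A X).toAddMonoidHom.comp (map A M.rho (idh X))) b t
    have h2 := IsLin.smul (f := map A (idh M) X.lam) b t
    exact (congrArg₂ (· - ·) h1 h2).trans (smul_sub b _ _).symm

instance (X : Bicomod C D) (N : LComod D) : IsLin A (omegaL X N) where
  smul b t := by
    have h1 := IsLin.smul (f := (assoc B X D B N).toAddMonoidHom.comp (map B X.rho (idh N))) b t
    have h2 := IsLin.smul (f := map B (idh X) N.lam) b t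
    exact (congrArg₂ (· - ·) h1 h2).trans (smul_sub b _ _).symm

/-- `M □_C X` as a right `B`-submodule of `M ⊗_A X`. -/
def cotR (M : RComod C) (X : Bicomod C D) : Submodule Bᵐᵒᵖ (X.tenR M) :=
  { cot M X.toL with
    smul_mem' := fun b t ht => by
      have e := IsLin.smul (f := omegaR M X) b t
      rw [(show omegaR M X t = 0 from ht), smul_zero] at e
      exact e }

/-- `X □_D N` as a left `A`-submodule of `X ⊗_B N`. -/
def cotL (X : Bicomod C D) (N : LComod D) : Submodule A (X.tenL N) :=
  { cot X.toR N with
    smul_mem' := fun b t ht => by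
      have e := IsLin.smul (f := omegaL X N) b t
      rw [(show omegaL X N t = 0 from ht), smul_zero] at e
      exact e }

theorem map_sub_left {M N M' N' : Type u} [AddCommGroup M] [Module Aᵐᵒᵖ M] [AddCommGroup N]
    [Module A N] [AddCommGroup M'] [Module Aᵐᵒᵖ M'] [AddCommGroup N'] [Module A N']
    (f f₁ f₂ : M →+ M') [IsLin Aᵐᵒᵖ f] [IsLin Aᵐᵒᵖ f₁] [IsLin Aᵐᵒᵖ f₂] (g : N →+ N') [IsLin A g]
    (h : ∀ m, f m = f₁ m - f₂ m) (t : Ten A M N) : map A f g t = map A f₁ g t - map A f₂ g t := by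
  induction t using Ten.induction with
  | h0 => simp only [map_zero, sub_zero]
  | h1 m n =>
    rw [eq_sub_iff_add_eq, Ten.map_tmul, Ten.map_tmul, Ten.map_tmul, h, ← Ten.add_tmul,
      sub_add_cancel]
  | h2 s t hs ht => rw [map_add, map_add, map_add, hs, ht]; abel

theorem map_sub_right {M N M' N' : Type u} [AddCommGroup M] [Module Aᵐᵒᵖ M] [AddCommGroup N]
    [Module A N] [AddCommGroup M'] [Module Aᵐᵒᵖ M'] [AddCommGroup N'] [Module A N']
    (g : M →+ M') [IsLin Aᵐᵒᵖ g] (f f₁ f₂ : N →+ N') [IsLin A f] [IsLin A f₁] [IsLin A f₂]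
    (h : ∀ m, f m = f₁ m - f₂ m) (t : Ten A M N) : map A g f t = map A g f₁ t - map A g f₂ t := by
  induction t using Ten.induction with
  | h0 => simp only [map_zero, sub_zero]
  | h1 m n =>
    rw [eq_sub_iff_add_eq, Ten.map_tmul, Ten.map_tmul, Ten.map_tmul, h, ← Ten.tmul_add,
      sub_add_cancel]
  | h2 s t hs ht => rw [map_add, map_add, map_add, hs, ht]; abel

theorem cotR_coaction (hD : FlatLeft B D) (M : RComod C) (X : Bicomod C D) (t : cotR M X) :
    ∃ s : Ten B (cotR M X) D,
      map B (cotR M X).subtype.toAddMonoidHom (idh D) s = (X.tenR M).rho t := by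
  refine hD.exact (omegaR M X) (cotR M X) (fun _ h => h) _ ?_
  obtain ⟨t, ht⟩ := t
  change Ten A M X at t
  replace ht : omegaR M X t = 0 := ht
  change map B (omegaR M X) (idh D) ((assoc A M X B D).symm (map A (idh M) X.rho t)) = 0
  have i1 : Function.Injective (assoc A M (Ten A C X) B D) := AddEquiv.injective _
  have i2 : Function.Injective
      (map A (idh M) (assoc A C X B D).toAddMonoidHom) := by
    intro x y h
    have := congrArg (map A (idh M) (assoc A C X B D).symm.toAddMonoidHom) h
    rw [Ten.map_map, Ten.map_map] at this
    have e : ∀ z, map A ((idh M).comp (idh M))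
        ((assoc A C X B D).symm.toAddMonoidHom.comp (assoc A C X B D).toAddMonoidHom) z = z :=
      fun z => (Ten.map_congr (fun _ => rfl)
        (fun n => (assoc A C X B D).symm_apply_apply n) z).trans (Ten.map_id z)
    rwa [e, e] at this
  apply i1
  apply i2
  rw [map_sub_left (omegaR M X) ((assoc A M C A X).toAddMonoidHom.comp (map A M.rho (idh X)))
    (map A (idh M) X.lam) (idh D) (fun _ => rfl), map_sub, map_sub, map_zero, map_zero]
  have e1 : map A (idh M) (assoc A C X B D).toAddMonoidHom (assoc A M (Ten A C X) B D
      (map B ((assoc A M C A X).toAddMonoidHom.comp (map A M.rho (idh X))) (idh D)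
        ((assoc A M X B D).symm (map A (idh M) X.rho t)))) =
      map A (idh M) (map A (idh C) X.rho) (assoc A M C A X (map A M.rho (idh X) t)) := by
    rw [← Ten.assoc_map, Ten.map_map]
    have := Ten.pentagon (map B (map A M.rho (idh X)) (idh D)
      ((assoc A M X B D).symm (map A (idh M) X.rho t)))
    rw [Ten.map_map, Ten.assoc_map, AddEquiv.apply_symm_apply, Ten.map_map] at this
    refine Eq.trans ?_ (this.trans ?_)
    · rfl
    · exact congrArg _ (Ten.map_congr (fun m => (Ten.map_id _).symm)
        (fun x => Ten.map_id (X.rho x)) t)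
  have e2 : map A (idh M) (assoc A C X B D).toAddMonoidHom (assoc A M (Ten A C X) B D
      (map B (map A (idh M) X.lam) (idh D)
        ((assoc A M X B D).symm (map A (idh M) X.rho t)))) =
      map A (idh M) (map A (idh C) X.rho) (map A (idh M) X.lam t) := by
    rw [Ten.assoc_map, AddEquiv.apply_symm_apply, Ten.map_map, Ten.map_map, Ten.map_map]
    exact Ten.map_congr (fun _ => rfl) X.compat t
  rw [e1, e2, ← map_sub]
  exact (congrArg _ ht).trans (map_zero _)

theorem cotL_coaction (hC : FlatRight A C) (X : Bicomod C D) (N : LComod D) (t : cotL X N) :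
    ∃ s : Ten A C (cotL X N),
      map A (idh C) (cotL X N).subtype.toAddMonoidHom s = (X.tenL N).lam t := by
  refine hC.exact (omegaL X N) (cotL X N) (fun _ h => h) _ ?_
  obtain ⟨t, ht⟩ := t
  change Ten B X N at t
  replace ht : omegaL X N t = 0 := ht
  change map A (idh C) (omegaL X N) (assoc A C X B N (map B X.lam (idh N) t)) = 0
  rw [map_sub_right (idh C) (omegaL X N)
    ((assoc B X D B N).toAddMonoidHom.comp (map B X.rho (idh N)))
    (map B (idh X) N.lam) (fun _ => rfl)]
  have e1 : map A (idh C) ((assoc B X D B N).toAddMonoidHom.comp (map B X.rho (idh N)))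
        (assoc A C X B N (map B X.lam (idh N) t)) =
      assoc A C X B (Ten B D N) (map B X.lam (idh (Ten B D N))
        (assoc B X D B N (map B X.rho (idh N) t))) := by
    have h1 := Ten.pentagon (map B (map B X.lam (idh D)) (idh N) (map B X.rho (idh N) t))
    rw [Ten.assoc_map, Ten.map_congr (f' := X.lam) (g' := idh (Ten B D N)) (fun _ => rfl)
      (fun z => Ten.map_id z)] at h1
    have h2 : map B (assoc A C X B D).toAddMonoidHom (idh N)
        (map B (map B X.lam (idh D)) (idh N) (map B X.rho (idh N) t)) =
        map B (map A (idh C) X.rho) (idh N) (map B X.lam (idh N) t) := by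
      rw [Ten.map_map, Ten.map_map, Ten.map_map]
      exact Ten.map_congr (fun x => X.compat x) (fun _ => rfl) t
    rw [← h1, h2, Ten.assoc_map, Ten.map_map]
    exact Ten.map_congr (fun _ => rfl) (fun _ => rfl) _
  have e2 : map A (idh C) (map B (idh X) N.lam) (assoc A C X B N (map B X.lam (idh N) t)) =
      assoc A C X B (Ten B D N) (map B X.lam (idh (Ten B D N)) (map B (idh X) N.lam t)) := by
    rw [← Ten.assoc_map, Ten.map_map, Ten.map_map]
    exact congrArg _ (Ten.map_congr (fun x => Ten.map_id _) (fun _ => rfl) t)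
  rw [e1, e2, ← map_sub, ← map_sub]
  exact (congrArg (fun z => assoc A C X B (Ten B D N) (map B X.lam (idh (Ten B D N)) z)) ht).trans
    (by rw [map_zero, map_zero])

/-- The right `D`-comodule `M □_C X`, a subcomodule of `M ⊗_A X`. -/
noncomputable def cotRComod (hD : FlatLeft B D) (M : RComod C) (X : Bicomod C D) : RComod D :=
  RComod.sub hD (X.tenR M) (cotR M X) (cotR_coaction hD M X)

/-- The left `C`-comodule `X □_D N`, a subcomodule of `X ⊗_B N`. -/
noncomputable def cotLComod (hC : FlatRight A C) (X : Bicomod C D) (N : LComod D) : LComod C :=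
  LComod.sub hC (X.tenL N) (cotL X N) (cotL_coaction hC X N)

theorem tenR_colin {M M' : RComod C} (f : M ⟶ M') (X : Bicomod C D) (t : Ten A M X) :
    map B (map A f.hom (idh X)) (idh D) ((X.tenR M).rho t) =
      (X.tenR M').rho (map A f.hom (idh X) t) := by
  change map B (map A f.hom (idh X)) (idh D) ((assoc A M X B D).symm (map A (idh M) X.rho t)) =
    (assoc A M' X B D).symm (map A (idh M') X.rho (map A f.hom (idh X) t))
  rw [← Ten.assoc_symm_map, Ten.map_map, Ten.map_map]
  exact congrArg _ (Ten.map_congr (fun _ => rfl) (fun x => Ten.map_id _) t)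

theorem tenL_colin (X : Bicomod C D) {N N' : LComod D} (f : N ⟶ N') (t : Ten B X N) :
    map A (idh C) (map B (idh X) f.hom) ((X.tenL N).lam t) =
      (X.tenL N').lam (map B (idh X) f.hom t) := by
  change map A (idh C) (map B (idh X) f.hom) (assoc A C X B N (map B X.lam (idh N) t)) =
    assoc A C X B N' (map B X.lam (idh N') (map B (idh X) f.hom t))
  rw [← Ten.assoc_map, Ten.map_map, Ten.map_map]
  exact congrArg _ (Ten.map_congr (fun x => Ten.map_id _) (fun _ => rfl) t)

/-- `f □_C X`, the restriction of `f ⊗_A X`. -/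
noncomputable def cotRMap (hD : FlatLeft B D) {M M' : RComod C} (f : M ⟶ M') (X : Bicomod C D) :
    cotRComod hD M X ⟶ cotRComod hD M' X :=
  let r : cotR M X →+ cotR M' X := cotMap f (𝟙 X.toL)
  haveI : IsLin Bᵐᵒᵖ r := ⟨fun b t => Subtype.ext
    (IsLin.smul (f := map A f.hom (idh X)) b (t : Ten A M X))⟩
  { hom := r
    lin := this
    colin := fun (t : cotR M X) => by
      apply hD _ _ (cotR M' X).subtype.toAddMonoidHom (cotR M' X).injective_subtype
      refine Eq.trans ?_ (RComod.sub_rho hD (X.tenR M') (cotR M' X) (cotR_coaction hD M' X)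
        (r t)).symm
      refine Eq.trans ?_ (tenR_colin f X (t : Ten A M X))
      refine Eq.trans ?_ (congrArg (map B (map A f.hom (idh X)) (idh D))
        (RComod.sub_rho hD (X.tenR M) (cotR M X) (cotR_coaction hD M X) t))
      change map B (cotR M' X).subtype.toAddMonoidHom (idh D) (map B r (idh D)
        ((RComod.sub hD (X.tenR M) (cotR M X) (cotR_coaction hD M X)).rho t)) = _
      refine (Ten.map_map _ _ _ _ _).trans (Eq.trans ?_ (Ten.map_map _ _ _ _ _).symm)
      exact Ten.map_congr (fun _ => rfl) (fun _ => rfl) _ }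

/-- `X □_D f`, the restriction of `X ⊗_B f`. -/
noncomputable def cotLMap (hC : FlatRight A C) (X : Bicomod C D) {N N' : LComod D} (f : N ⟶ N') :
    cotLComod hC X N ⟶ cotLComod hC X N' :=
  let r : cotL X N →+ cotL X N' := cotMap (𝟙 X.toR) f
  haveI : IsLin A r := ⟨fun b t => Subtype.ext
    (IsLin.smul (f := map B (idh X) f.hom) b (t : Ten B X N))⟩
  { hom := r
    lin := this
    colin := fun (t : cotL X N) => by
      apply hC _ _ (cotL X N').subtype.toAddMonoidHom (cotL X N').injective_subtype
      refine Eq.trans ?_ (LComod.sub_lam hC (X.tenL N') (cotL X N') (cotL_coaction hC X N')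
        (r t)).symm
      refine Eq.trans ?_ (tenL_colin X f (t : Ten B X N))
      refine Eq.trans ?_ (congrArg (map A (idh C) (map B (idh X) f.hom))
        (LComod.sub_lam hC (X.tenL N) (cotL X N) (cotL_coaction hC X N) t))
      change map A (idh C) (cotL X N').subtype.toAddMonoidHom (map A (idh C) r
        ((LComod.sub hC (X.tenL N) (cotL X N) (cotL_coaction hC X N)).lam t)) = _
      refine (Ten.map_map _ _ _ _ _).trans (Eq.trans ?_ (Ten.map_map _ _ _ _ _).symm)
      exact Ten.map_congr (fun _ => rfl) (fun _ => rfl) _ }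

/-- The functor `- □_C X` from right `C`-comodules to right `D`-comodules (for `_B D` flat). -/
noncomputable def cotensorR (hD : FlatLeft B D) (X : Bicomod C D) : RComod C ⥤ RComod D where
  obj M := cotRComod hD M X
  map f := cotRMap hD f X
  map_id M := RComod.hom_ext' fun t => Subtype.ext (Ten.map_id (t.1 : Ten A M X))
  map_comp {M₁ M₂ M₃} f g := RComod.hom_ext' fun t => Subtype.ext (by
    change map A (f ≫ g).hom (idh X) (t.1 : Ten A M₁ X) =
      map A g.hom (idh X) (map A f.hom (idh X) (t.1 : Ten A M₁ X))
    rw [Ten.map_map]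
    exact Ten.map_congr (fun _ => rfl) (fun _ => rfl) _)

/-- The functor `X □_D -` from left `D`-comodules to left `C`-comodules (for `C_A` flat). -/
noncomputable def cotensorL (hC : FlatRight A C) (X : Bicomod C D) : LComod D ⥤ LComod C where
  obj N := cotLComod hC X N
  map f := cotLMap hC X f
  map_id N := LComod.hom_ext' fun t => Subtype.ext (Ten.map_id (t.1 : Ten B X N))
  map_comp {N₁ N₂ N₃} f g := LComod.hom_ext' fun t => Subtype.ext (by
    change map B (idh X) (f ≫ g).hom (t.1 : Ten B X N₁) =
      map B (idh X) g.hom (map B (idh X) f.hom (t.1 : Ten B X N₁))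
    rw [Ten.map_map]
    exact Ten.map_congr (fun _ => rfl) (fun _ => rfl) _)

end Cotensor

/-! ## Coflat, quasi-finite and injector comodules, co-hom functors, Frobenius pairs -/

section Notions

variable {C : Coring A} {D : Coring B}

/-- A right comodule `M` is coflat if `M □_C -`, from left `C`-comodules to abelian groups, is
exact: it takes short exact sequences of left comodules to short exact sequences. -/
def RComod.IsCoflat (M : RComod C) : Prop :=
  ∀ (N₁ N₂ N₃ : LComod C) (f : N₁ ⟶ N₂) (g : N₂ ⟶ N₃), Function.Injective f.hom →
    Function.Exact f.hom g.hom → Function.Surjective g.hom →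
      Function.Injective (cotMap (𝟙 M) f) ∧ Function.Exact (cotMap (𝟙 M) f) (cotMap (𝟙 M) g) ∧
        Function.Surjective (cotMap (𝟙 M) g)

/-- A left comodule `N` is coflat if `- □_C N`, from right `C`-comodules to abelian groups, is
exact: it takes short exact sequences of right comodules to short exact sequences. -/
def LComod.IsCoflat (N : LComod C) : Prop :=
  ∀ (M₁ M₂ M₃ : RComod C) (f : M₁ ⟶ M₂) (g : M₂ ⟶ M₃), Function.Injective f.hom →
    Function.Exact f.hom g.hom → Function.Surjective g.hom →
      Function.Injective (cotMap f (𝟙 N)) ∧ Function.Exact (cotMap f (𝟙 N)) (cotMap g (𝟙 N)) ∧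
        Function.Surjective (cotMap g (𝟙 N))

/-- `X` is quasi-finite as a right `D`-comodule: `- ⊗_A X` has a left adjoint. -/
def Bicomod.QuasiFiniteR (X : Bicomod C D) : Prop := X.tensorR.IsRightAdjoint

/-- `X` is quasi-finite as a left `C`-comodule: `X ⊗_B -` has a left adjoint. -/
def Bicomod.QuasiFiniteL (X : Bicomod C D) : Prop := X.tensorL.IsRightAdjoint

/-- `X` is an injector as a right `D`-comodule: `- ⊗_A X` preserves injective objects. -/
def Bicomod.InjectorR (X : Bicomod C D) : Prop := X.tensorR.PreservesInjectiveObjects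

/-- `X` is an injector as a left `C`-comodule: `X ⊗_B -` preserves injective objects. -/
def Bicomod.InjectorL (X : Bicomod C D) : Prop := X.tensorL.PreservesInjectiveObjects

/-- `(F, G)` is a Frobenius pair: `G` is both left and right adjoint to `F`. -/
def IsFrobeniusPair {𝒞 : Type*} [Category 𝒞] {𝒟 : Type*} [Category 𝒟] (F : 𝒞 ⥤ 𝒟) (G : 𝒟 ⥤ 𝒞) :
    Prop := Nonempty (F ⊣ G) ∧ Nonempty (G ⊣ F)

/-- A ring is von Neumann regular if every `a` is of the form `a x a`. -/
def IsVonNeumannRegular (R : Type*) [Ring R] : Prop := ∀ a : R, ∃ x : R, a * x * a = a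

/-- Left multiplication by `a`, as an endomorphism of the right comodule `C`. -/
def Coring.lmulHom (C : Coring A) (a : A) : C.regular.toR ⟶ C.regular.toR where
  hom := Ten.lmul A C a
  lin := inferInstanceAs (IsLin Aᵐᵒᵖ (Ten.lmul A C a))
  colin c := (IsLin.smul (f := C.Δ) a c).symm

/-- `c ⊗ -`, as a morphism of right comodules `C → C ⊗_A C`. -/
def Coring.tmulHom (C : Coring A) (c : C) : C.regular.toR ⟶ C.regular.tenR C where
  hom := Ten.mk A C c
  lin := inferInstanceAs (IsLin Aᵐᵒᵖ (Ten.mk A C c))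
  colin c' := by
    change map A (Ten.mk A C c) (idh C) (C.Δ c') =
      (assoc A C C A C).symm (map A (idh C) C.Δ (tmul A c c'))
    rw [Ten.map_tmul]
    exact (Ten.assoc_symm_tmul' c (C.Δ c')).symm

/-- The comultiplication, as a morphism of right comodules `C → C ⊗_A C`. -/
def Coring.comulHom (C : Coring A) : C.regular.toR ⟶ C.regular.tenR C where
  hom := C.Δ
  lin := C.Δ_right
  colin c := by
    change map A C.Δ (idh C) (C.Δ c) = (assoc A C C A C).symm (map A (idh C) C.Δ (C.Δ c))
    rw [AddEquiv.eq_symm_apply, C.coassoc]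

/-- `e` identifies the bicomodule `H` with `F(C)`, equipped with the bicomodule structure that it
inherits from `C`: `A` acts on `F(C)` through `A → End(C) → End(F(C))`, and the left coaction is the
map `F(C) → C ⊗_A F(C)` whose composition with the canonical map
`Υ : C ⊗_A F(C) → F(C ⊗_A C)`, `c ⊗ x ↦ F(c ⊗ -)(x)`, is `F(Δ)`. -/
structure IsImageOfCoring (F : RComod C ⥤ RComod D) (H : Bicomod C D)
    (e : H.toR ≅ F.obj C.regular.toR) : Prop where
  smul : ∀ (a : A) (h : H), e.hom.hom (a • h) = (F.map (C.lmulHom a)).hom (e.hom.hom h)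
  coaction : ∃ Υ : Ten A C H →+ F.obj (C.regular.tenR C),
    (∀ (c : C) (h : H), Υ (tmul A c h) = (F.map (C.tmulHom c)).hom (e.hom.hom h)) ∧
      ∀ h : H, Υ (H.lam h) = (F.map C.comulHom).hom (e.hom.hom h)

/-- `X ≅ h_C(Λ, C)` as `C`-`D`-bicomodules, where the co-hom functor `h_C(Λ, -)` is the left adjoint
of `- □_D Λ`. -/
def IsoCohom (hC : FlatLeft A C) (Λ : Bicomod D C) (X : Bicomod C D) : Prop :=
  ∃ (h : RComod C ⥤ RComod D) (_ : h ⊣ cotensorR hC Λ) (H : Bicomod C D)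
    (e : H.toR ≅ h.obj C.regular.toR), IsImageOfCoring h H e ∧ Nonempty (X ≅ H)

end Notions

end Corings

open Corings

/-! The passage between right and left comodules rests on a Yoneda-type embedding. A left
`C`-comodule `N` can be recovered from the functor `- □_C N` on any class of right comodules that
contains `C` and is stable under `M ↦ M ⊗_A C`. Indeed `C □_C N` is `N`, and a natural
transformation is determined by its value at `C`, because every `M` embeds through its coaction in
the cofree comodule `M ⊗_A C` (`LComod.exists_of_natural`). Wherever `(M □_C X) □_D N = M □_C (X □_D
N)`, precomposition with `- □_C X` corresponds to `X □_D -`. Precomposition exchanges left and right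
adjoints, so an adjunction between cotensor functors on one side gives one, in the opposite
direction, on the other side (`adj_cotensorL_of_adj_cotensorR`, `adj_cotensorR_of_adj_cotensorL`).

Associativity is the technical point. Both iterated cotensor products are cut out of `M ⊗_A X ⊗_B N`
by the same two equations, provided that certain tensor products preserve the kernels defining `M
□_C X` and `X □_D N` (`AssocAt.of_pure`). This holds for coflat `M`, since `M` is then flat over `A`
and `(M □_C X) ⊗_B V ≅ M □_C (X ⊗_B V)`. It holds for all `M` over coseparable corings, where these
kernels are split, and over von Neumann regular rings, where all modules are flat. The embedding is
accordingly applied to the coflat comodules, or to all comodules.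

A Frobenius pair yields the rest of (3) formally. A functor with adjoints on both sides preserves
kernels and cokernels, which gives coflatness. Since `V ⊗_A X ≅ (V ⊗_A C) □_C X`, the functor `- ⊗_A
X` is a cotensor functor composed with the cofree functor, itself right adjoint to the forgetful
functor. Hence it has a left adjoint, and this left adjoint preserves monomorphisms, so injectives
are preserved. The isomorphism `C □_C X ≅ X` identifies the co-hom bicomodule.

Conversely, let `h` be left adjoint to `- □_D Λ`. The canonical map `V ⊗_A h(C) → h(V ⊗_A C)` is
invertible, as both sides corepresent the same functor (`IsImageOfCoring.isIso_can`). Every `M` is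
the equalizer of `M ⊗_A C ⇉ M ⊗_A C ⊗_A C`. If `h` preserves it, then `h(M)` is the equalizer of `M
⊗_A h(C) ⇉ M ⊗_A C ⊗_A h(C)`, that is, `M □_C h(C)` (`IsImageOfCoring.nonempty_iso`). Over a
coseparable coring the equalizer is split, so any functor preserves it. If `Λ` is an injector, `h`
preserves injections, and being right exact as well it preserves the equalizer. -/

namespace Corings

/-! ## Exactness of tensor products -/

instance isLin_add (R : Type*) [Ring R] {M N : Type*} [AddCommGroup M] [AddCommGroup N]
    [Module R M] [Module R N] (f g : M →+ N) [IsLin R f] [IsLin R g] : IsLin R (f + g) :=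
  ⟨fun r m => by simp [IsLin.smul (f := f), IsLin.smul (f := g)]⟩

instance isLin_neg (R : Type*) [Ring R] {M N : Type*} [AddCommGroup M] [AddCommGroup N]
    [Module R M] [Module R N] (f : M →+ N) [IsLin R f] : IsLin R (-f) :=
  ⟨fun r m => by simp [IsLin.smul (f := f)]⟩

instance isLin_zero (R : Type*) [Ring R] {M N : Type*} [AddCommGroup M] [AddCommGroup N]
    [Module R M] [Module R N] : IsLin R (0 : M →+ N) :=
  ⟨fun r m => by simp⟩

namespace Ten

variable {A : Type*} [Ring A]

section

variable {M M' M'' N N' N'' : Type*} [AddCommGroup M] [Module Aᵐᵒᵖ M] [AddCommGroup N] [Module A N]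
  [AddCommGroup M'] [Module Aᵐᵒᵖ M'] [AddCommGroup N'] [Module A N']
  [AddCommGroup M''] [Module Aᵐᵒᵖ M''] [AddCommGroup N''] [Module A N'']

theorem map_id' {f : M →+ M} {g : N →+ N} [IsLin Aᵐᵒᵖ f] [IsLin A g] (hf : ∀ m, f m = m)
    (hg : ∀ n, g n = n) (t : Ten A M N) : map A f g t = t :=
  (map_congr hf hg t).trans (map_id t)

theorem map_zero_left {f : M →+ M'} {g : N →+ N'} [IsLin Aᵐᵒᵖ f] [IsLin A g]
    (hf : ∀ m, f m = 0) (t : Ten A M N) : map A f g t = 0 := by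
  induction t using Ten.induction with
  | h0 => exact _root_.map_zero _
  | h1 m n => rw [map_tmul, hf, zero_tmul]
  | h2 s t hs ht => rw [map_add, hs, ht, add_zero]

theorem map_zero_right {f : M →+ M'} {g : N →+ N'} [IsLin Aᵐᵒᵖ f] [IsLin A g]
    (hg : ∀ m, g m = 0) (t : Ten A M N) : map A f g t = 0 := by
  induction t using Ten.induction with
  | h0 => exact _root_.map_zero _
  | h1 m n => rw [map_tmul, hg, tmul_zero]
  | h2 s t hs ht => rw [map_add, hs, ht, add_zero]

theorem map_add_left {f f₁ f₂ : M →+ M'} {g : N →+ N'} [IsLin Aᵐᵒᵖ f] [IsLin Aᵐᵒᵖ f₁]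
    [IsLin Aᵐᵒᵖ f₂] [IsLin A g] (hf : ∀ m, f m = f₁ m + f₂ m) (t : Ten A M N) :
    map A f g t = map A f₁ g t + map A f₂ g t := by
  induction t using Ten.induction with
  | h0 => simp
  | h1 m n => rw [map_tmul, map_tmul, map_tmul, hf, add_tmul]
  | h2 s t hs ht => rw [map_add, hs, ht, map_add, map_add]; abel

theorem map_add_right {f : M →+ M'} {g g₁ g₂ : N →+ N'} [IsLin Aᵐᵒᵖ f] [IsLin A g]
    [IsLin A g₁] [IsLin A g₂] (hg : ∀ n, g n = g₁ n + g₂ n) (t : Ten A M N) :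
    map A f g t = map A f g₁ t + map A f g₂ t := by
  induction t using Ten.induction with
  | h0 => simp
  | h1 m n => rw [map_tmul, map_tmul, map_tmul, hg, tmul_add]
  | h2 s t hs ht => rw [map_add, hs, ht, map_add, map_add]; abel

theorem map_surjective (f : M →+ M') (g : N →+ N') [IsLin Aᵐᵒᵖ f] [IsLin A g]
    (hf : Function.Surjective f) (hg : Function.Surjective g) :
    Function.Surjective (map A f g) := by
  intro t
  induction t using Ten.induction with
  | h0 => exact ⟨0, map_zero _⟩
  | h1 m n =>
    obtain ⟨m, rfl⟩ := hf m
    obtain ⟨n, rfl⟩ := hg n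
    exact ⟨tmul A m n, map_tmul _ _ _ _⟩
  | h2 s t hs ht =>
    obtain ⟨s, rfl⟩ := hs
    obtain ⟨t, rfl⟩ := ht
    exact ⟨s + t, map_add _ _ _⟩

/-- Right exactness of the tensor product. A set-theoretic section of `g` induces an additive map
from `M'' ⊗ N` back to the quotient of `M' ⊗ N` by the image of `f ⊗ N`, since two lifts of one
element differ by an element of that image. -/
theorem map_exact_left (f : M →+ M') (g : M' →+ M'') [IsLin Aᵐᵒᵖ f] [IsLin Aᵐᵒᵖ g]
    (hg : Function.Surjective g) (h : ∀ m, g m = 0 → ∃ x, f x = m) (t : Ten A M' N)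
    (ht : map A g (AddMonoidHom.id N) t = 0) : ∃ s, map A f (AddMonoidHom.id N) s = t := by
  let π := QuotientAddGroup.mk' (map A f (AddMonoidHom.id N)).range
  have key : ∀ (m m' : M') (n : N), g m = g m' → π (tmul A m n) = π (tmul A m' n) := by
    intro m m' n e
    obtain ⟨x, hx⟩ := h (m - m') (by rw [map_sub, e, sub_self])
    rw [← sub_eq_zero, ← map_sub]
    refine (QuotientAddGroup.eq_zero_iff _).2 ⟨tmul A x n, ?_⟩
    rw [map_tmul, hx, eq_sub_iff_add_eq]
    change tmul A _ n + _ = _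
    exact (add_tmul _ _ _).symm.trans (by rw [sub_add_cancel])
  -- By `key` the choice of lift is invisible in the quotient, so this is biadditive and balanced
  -- although `Function.surjInv` is neither additive nor linear.
  let q : Ten A M'' N →+ Ten A M' N ⧸ (map A f (AddMonoidHom.id N)).range := lift
    (AddMonoidHom.mk' (fun r => π.comp (mk A M' (Function.surjInv hg r))) (fun r r' => by
      ext n
      change π (tmul A _ n) = π (tmul A _ n) + π (tmul A _ n)
      rw [← map_add, ← add_tmul]
      apply key
      rw [map_add, Function.surjInv_eq hg, Function.surjInv_eq hg, Function.surjInv_eq hg]))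
    (fun r a n => by
      change π (tmul A _ n) = π (tmul A _ (a • n))
      rw [← smul_tmul]
      apply key
      rw [IsLin.smul (f := g), Function.surjInv_eq hg, Function.surjInv_eq hg])
  have hq : q.comp (map A g (AddMonoidHom.id N)) = π := hom_ext fun m n => by
    rw [AddMonoidHom.comp_apply, map_tmul, lift_tmul]
    exact key _ _ _ (Function.surjInv_eq hg _)
  have := DFunLike.congr_fun hq t
  rw [AddMonoidHom.comp_apply, ht, map_zero] at this
  exact (QuotientAddGroup.eq_zero_iff _).1 this.symm

theorem map_exact_right (f : N →+ N') (g : N' →+ N'') [IsLin A f] [IsLin A g]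
    (hg : Function.Surjective g) (h : ∀ m, g m = 0 → ∃ x, f x = m) (t : Ten A M N')
    (ht : map A (AddMonoidHom.id M) g t = 0) : ∃ s, map A (AddMonoidHom.id M) f s = t := by
  let π := QuotientAddGroup.mk' (map A (AddMonoidHom.id M) f).range
  have key : ∀ (m : M) (n n' : N'), g n = g n' → π (tmul A m n) = π (tmul A m n') := by
    intro m n n' e
    obtain ⟨x, hx⟩ := h (n - n') (by rw [map_sub, e, sub_self])
    rw [← sub_eq_zero, ← map_sub]
    refine (QuotientAddGroup.eq_zero_iff _).2 ⟨tmul A m x, ?_⟩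
    rw [map_tmul, hx, eq_sub_iff_add_eq]
    change tmul A m _ + _ = _
    exact (tmul_add _ _ _).symm.trans (by rw [sub_add_cancel])
  let q : Ten A M N'' →+ Ten A M N' ⧸ (map A (AddMonoidHom.id M) f).range := lift
    (AddMonoidHom.mk' (fun m => AddMonoidHom.mk'
      (fun r => π (tmul A m (Function.surjInv hg r))) (fun r r' => by
        rw [← map_add, ← tmul_add]
        apply key
        rw [map_add, Function.surjInv_eq hg, Function.surjInv_eq hg, Function.surjInv_eq hg]))
      (fun m m' => by
        ext r
        change π _ = π _ + π _
        rw [← map_add, ← add_tmul]))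
    (fun m a r => by
      change π (tmul A _ _) = π (tmul A _ _)
      rw [smul_tmul]
      apply key
      rw [IsLin.smul (f := g), Function.surjInv_eq hg, Function.surjInv_eq hg])
  have hq : q.comp (map A (AddMonoidHom.id M) g) = π := hom_ext fun m n => by
    rw [AddMonoidHom.comp_apply, map_tmul, lift_tmul]
    exact key _ _ _ (Function.surjInv_eq hg _)
  have := DFunLike.congr_fun hq t
  rw [AddMonoidHom.comp_apply, ht, map_zero] at this
  exact (QuotientAddGroup.eq_zero_iff _).1 this.symm

/-- The coordinates of an element of `M ⊗_A (S →₀ A)`. -/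
noncomputable def finsuppCoord (S : Type*) (M : Type*) [AddCommGroup M] [Module Aᵐᵒᵖ M] (s : S) :
    Ten A M (S →₀ A) →+ M :=
  (rid M).comp (map A (AddMonoidHom.id M) (Finsupp.lapply (R := A) s).toAddMonoidHom)

theorem finsupp_ext {S : Type*} {t : Ten A M (S →₀ A)} (h : ∀ s, finsuppCoord S M s t = 0) :
    t = 0 := by
  classical
  -- The expansion is asked for over every larger index set, so that the supports of two summands
  -- can be enlarged to their union.
  have e : ∀ t : Ten A M (S →₀ A), ∃ T : Finset S, ∀ T', T ⊆ T' →
      t = ∑ s ∈ T', tmul A (finsuppCoord S M s t) (Finsupp.single s 1) := by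
    intro t
    induction t using Ten.induction with
    | h0 => exact ⟨∅, fun T' _ => by simp⟩
    | h1 m n =>
      refine ⟨n.support, fun T' hT => ?_⟩
      conv_lhs => rw [← Finsupp.sum_single n, Finsupp.sum, Finset.sum_subset hT (fun s _ hs => by
        rw [Finsupp.notMem_support_iff.1 hs, Finsupp.single_zero])]
      rw [show tmul A m (∑ s ∈ T', Finsupp.single s (n s)) = (mk A M m) (∑ s ∈ T',
        Finsupp.single s (n s)) from rfl, map_sum]
      refine Finset.sum_congr rfl fun s _ => ?_
      simp only [finsuppCoord, AddMonoidHom.comp_apply, map_tmul, rid_tmul, smul_tmul, mk_apply]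
      simp
    | h2 s t hs ht =>
      obtain ⟨T₁, h₁⟩ := hs
      obtain ⟨T₂, h₂⟩ := ht
      refine ⟨T₁ ∪ T₂, fun T' hT => ?_⟩
      conv_lhs => rw [h₁ T' (Finset.union_subset_left hT), h₂ T' (Finset.union_subset_right hT)]
      rw [← Finset.sum_add_distrib]
      exact Finset.sum_congr rfl fun s _ => by rw [map_add, add_tmul]
  obtain ⟨T, hT⟩ := e t
  rw [hT T subset_rfl]
  exact Finset.sum_eq_zero fun s _ => by rw [h, zero_tmul]

/-- The coordinates of an element of `(S →₀ Aᵐᵒᵖ) ⊗_A N`. -/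
noncomputable def finsuppCoord' (S : Type*) (N : Type*) [AddCommGroup N] [Module A N] (s : S) :
    Ten A (S →₀ Aᵐᵒᵖ) N →+ N :=
  lift (AddMonoidHom.mk' (fun f => lmul A N (unop (f s))) (fun f g => by ext; simp [add_smul]))
    (fun f a n => by simp [mul_smul])

theorem finsupp_ext' {S : Type*} {t : Ten A (S →₀ Aᵐᵒᵖ) N}
    (h : ∀ s, finsuppCoord' S N s t = 0) : t = 0 := by
  classical
  have e : ∀ t : Ten A (S →₀ Aᵐᵒᵖ) N, ∃ T : Finset S, ∀ T', T ⊆ T' →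
      t = ∑ s ∈ T', tmul A (Finsupp.single s 1) (finsuppCoord' S N s t) := by
    intro t
    induction t using Ten.induction with
    | h0 => exact ⟨∅, fun T' _ => by simp⟩
    | h1 m n =>
      refine ⟨m.support, fun T' hT => ?_⟩
      conv_lhs => rw [← Finsupp.sum_single m, Finsupp.sum, Finset.sum_subset hT (fun s _ hs => by
        rw [Finsupp.notMem_support_iff.1 hs, Finsupp.single_zero])]
      rw [show tmul A (∑ s ∈ T', Finsupp.single s (m s)) n = (mk A _).flip n (∑ s ∈ T',
        Finsupp.single s (m s)) from rfl, map_sum]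
      refine Finset.sum_congr rfl fun s _ => ?_
      rw [finsuppCoord', lift_tmul]
      change _ = tmul A _ (unop (m s) • n)
      rw [← smul_tmul]
      simp
    | h2 s t hs ht =>
      obtain ⟨T₁, h₁⟩ := hs
      obtain ⟨T₂, h₂⟩ := ht
      refine ⟨T₁ ∪ T₂, fun T' hT => ?_⟩
      conv_lhs => rw [h₁ T' (Finset.union_subset_left hT), h₂ T' (Finset.union_subset_right hT)]
      rw [← Finset.sum_add_distrib]
      exact Finset.sum_congr rfl fun s _ => by rw [map_add, tmul_add]
  obtain ⟨T, hT⟩ := e t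
  rw [hT T subset_rfl]
  exact Finset.sum_eq_zero fun s _ => by rw [h, tmul_zero]

end

end Ten

open Corings.Ten (map lid rid assoc tmul)

/-! ### Flatness of free modules, tensor products and modules over regular rings -/

section Flat

variable {A B : Type u} [Ring A] [Ring B]

/-- The coordinate maps are jointly injective and commute with `f`, so injectivity can be tested one
coordinate at a time. -/
theorem flatLeft_finsupp (S : Type u) : FlatLeft A (S →₀ A) := by
  intro M M' _ _ _ _ f _ hf
  refine (injective_iff_map_eq_zero _).2 fun t ht => Ten.finsupp_ext fun s => hf ?_
  have e : f.comp (Ten.finsuppCoord S M s) =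
      (Ten.finsuppCoord S M' s).comp (map A f (AddMonoidHom.id _)) := Ten.hom_ext fun m n => by
    simp [Ten.finsuppCoord, IsLin.smul (f := f)]
  have := DFunLike.congr_fun e t
  rw [AddMonoidHom.comp_apply, AddMonoidHom.comp_apply, ht, map_zero] at this
  rw [this, map_zero]

theorem flatRight_finsupp (S : Type u) : FlatRight A (S →₀ Aᵐᵒᵖ) := by
  intro N N' _ _ _ _ f _ hf
  refine (injective_iff_map_eq_zero _).2 fun t ht => Ten.finsupp_ext' fun s => hf ?_
  have e : f.comp (Ten.finsuppCoord' S N s) =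
      (Ten.finsuppCoord' S N' s).comp (map A (AddMonoidHom.id _) f) := Ten.hom_ext fun m n => by
    simp [Ten.finsuppCoord', IsLin.smul (f := f)]
  have := DFunLike.congr_fun e t
  rw [AddMonoidHom.comp_apply, AddMonoidHom.comp_apply, ht, map_zero] at this
  rw [this, map_zero]

theorem FlatRight.ten {M N : Type u} [AddCommGroup M] [AddCommGroup N] [Module Aᵐᵒᵖ M] [Module A N]
    [Module Bᵐᵒᵖ N] [SMulCommClass A Bᵐᵒᵖ N] (hM : FlatRight A M) (hN : FlatRight B N) :
    FlatRight B (Ten A M N) := by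
  intro L L' _ _ _ _ f _ hf x y h
  apply (assoc A M N B L).injective
  apply hM _ _ (map B (AddMonoidHom.id N) f) (hN _ _ f hf)
  rw [← Ten.assoc_map, ← Ten.assoc_map]
  refine congrArg _ ((Ten.map_congr (fun t => Ten.map_id t) (fun _ => rfl) x).trans
    (h.trans (Ten.map_congr (fun t => Ten.map_id t) (fun _ => rfl) y).symm))

theorem FlatLeft.ten {N L : Type u} [AddCommGroup L] [AddCommGroup N] [Module B L] [Module A N]
    [Module Bᵐᵒᵖ N] [SMulCommClass A Bᵐᵒᵖ N] (hL : FlatLeft B L) (hN : FlatLeft A N) :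
    FlatLeft A (Ten B N L) := by
  intro M M' _ _ _ _ f _ hf x y h
  apply (assoc A M N B L).symm.injective
  apply hL _ _ (map A f (AddMonoidHom.id N)) (hN _ _ f hf)
  rw [← Ten.assoc_symm_map, ← Ten.assoc_symm_map]
  refine congrArg _ ((Ten.map_congr (fun _ => rfl) (fun t => Ten.map_id t) x).trans
    (h.trans (Ten.map_congr (fun _ => rfl) (fun t => Ten.map_id t) y).symm))

/-! ### Modules over a von Neumann regular ring are flat -/

/-- The characters of a right module, with their left module structure. -/
def RightChar (M : Type u) [AddCommGroup M] : Type u := M →+ AddCircle (1 : ℚ)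

instance (M : Type u) [AddCommGroup M] : AddCommGroup (RightChar M) :=
  inferInstanceAs (AddCommGroup (M →+ AddCircle (1 : ℚ)))

instance (M : Type u) [AddCommGroup M] [Module Aᵐᵒᵖ M] : Module A (RightChar M) where
  smul a φ := AddMonoidHom.comp φ (Ten.lmul Aᵐᵒᵖ M (op a))
  one_smul φ := AddMonoidHom.ext fun m => congrArg φ.toFun (one_smul Aᵐᵒᵖ m)
  mul_smul a b φ := AddMonoidHom.ext fun m => congrArg φ.toFun (mul_smul (op b) (op a) m)
  smul_zero _ := rfl
  smul_add _ _ _ := rfl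
  add_smul a b φ := AddMonoidHom.ext fun m =>
    (congrArg φ.toFun (add_smul (op a) (op b) m)).trans (AddMonoidHom.map_add φ _ _)
  zero_smul φ := AddMonoidHom.ext fun m =>
    (congrArg φ.toFun (zero_smul Aᵐᵒᵖ m)).trans (AddMonoidHom.map_zero φ)

/-- `AddCircle (1 : ℚ)` is `ℚ/ℤ`, which is divisible and therefore injective as an abelian group. -/
theorem exists_char_extension {M N : Type u} [AddCommGroup M] [AddCommGroup N] (f : M →+ N)
    (hf : Function.Injective f) (χ : M →+ AddCircle (1 : ℚ)) :
    ∃ χ' : N →+ AddCircle (1 : ℚ), χ'.comp f = χ :=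
  (Module.Baer.of_divisible _).extension_property_addMonoidHom f hf χ

/-- The left linear map `N → Hom(M, ℚ/ℤ)` given by a character of `M ⊗_A N`. -/
def rightCurry {M N : Type u} [AddCommGroup M] [Module Aᵐᵒᵖ M] [AddCommGroup N] [Module A N]
    (χ : Ten A M N →+ AddCircle (1 : ℚ)) : N →ₗ[A] RightChar M where
  toFun n := χ.comp ((Ten.mk A M).flip n)
  map_add' n n' := AddMonoidHom.ext fun m =>
    (congrArg χ (Ten.tmul_add m n n')).trans (map_add χ _ _)
  map_smul' a n := AddMonoidHom.ext fun m => congrArg χ (Ten.smul_tmul m a n).symm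

/-- The character of `M ⊗_A N` given by a left linear map `N → Hom(M, ℚ/ℤ)`. -/
def rightUncurry {M N : Type u} [AddCommGroup M] [Module Aᵐᵒᵖ M] [AddCommGroup N] [Module A N]
    (g : N →ₗ[A] RightChar M) : Ten A M N →+ AddCircle (1 : ℚ) :=
  Ten.lift (AddMonoidHom.flip (show N →+ (M →+ AddCircle (1 : ℚ)) from g.toAddMonoidHom))
    (fun m a n => (congrArg (fun φ : M →+ AddCircle (1 : ℚ) => φ m) (g.map_smul a n)).symm)

/-- Lambek's criterion. The hypothesis on ideals says through currying that `Hom(M, ℚ/ℤ)` satisfies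
Baer's condition, hence is injective. A nonzero element of the kernel of `M ⊗ f` would be detected
by a character; curried and extended along `f`, that character factors through `M ⊗ f` and so
vanishes on the element. -/
theorem flatRight_of_ideal {M : Type u} [AddCommGroup M] [Module Aᵐᵒᵖ M]
    (h : ∀ I : Ideal A, Function.Injective
      (map A (idh M) I.subtype.toAddMonoidHom : Ten A M I →+ Ten A M A)) :
    FlatRight A M := by
  have baer : Module.Baer A (RightChar M) := fun I g => by
    obtain ⟨χ, hχ⟩ := exists_char_extension _ (h I) (rightUncurry g)
    refine ⟨rightCurry χ, fun x hx => AddMonoidHom.ext fun m => ?_⟩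
    refine Eq.trans ?_ ((DFunLike.congr_fun hχ (tmul A m (⟨x, hx⟩ : I))).trans
      (Ten.lift_tmul _ _ _ _))
    rw [AddMonoidHom.comp_apply, Ten.map_tmul]
    rfl
  intro N N' _ _ _ _ f _ hf
  refine (injective_iff_map_eq_zero _).2 fun t ht => ?_
  by_contra hne
  obtain ⟨χ, hχ⟩ := CharacterModule.exists_character_apply_ne_zero_of_ne_zero hne
  obtain ⟨g, hg⟩ := baer.extension_property (IsLin.toLin A f) hf
    (rightCurry (show Ten A M N →+ AddCircle (1 : ℚ) from χ))
  have e : (rightUncurry g).comp (map A (idh M) f) = χ := Ten.hom_ext fun m n => by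
    rw [AddMonoidHom.comp_apply, Ten.map_tmul]
    refine (Ten.lift_tmul _ _ _ _).trans ?_
    exact congrArg (fun φ : M →+ AddCircle (1 : ℚ) => φ m) (LinearMap.congr_fun hg n)
  exact hχ ((DFunLike.congr_fun e t).symm.trans ((congrArg _ ht).trans (map_zero _)))

/-- The characters of a left module, with their right module structure. -/
def LeftChar (M : Type u) [AddCommGroup M] : Type u := M →+ AddCircle (1 : ℚ)

instance (M : Type u) [AddCommGroup M] : AddCommGroup (LeftChar M) :=
  inferInstanceAs (AddCommGroup (M →+ AddCircle (1 : ℚ)))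

instance (M : Type u) [AddCommGroup M] [Module A M] : Module Aᵐᵒᵖ (LeftChar M) where
  smul a φ := AddMonoidHom.comp φ (Ten.lmul A M (unop a))
  one_smul φ := AddMonoidHom.ext fun m => congrArg φ.toFun (one_smul A m)
  mul_smul a b φ := AddMonoidHom.ext fun m => congrArg φ.toFun (mul_smul (unop b) (unop a) m)
  smul_zero _ := rfl
  smul_add _ _ _ := rfl
  add_smul a b φ := AddMonoidHom.ext fun m =>
    (congrArg φ.toFun (add_smul (unop a) (unop b) m)).trans (AddMonoidHom.map_add φ _ _)
  zero_smul φ := AddMonoidHom.ext fun m =>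
    (congrArg φ.toFun (zero_smul A m)).trans (AddMonoidHom.map_zero φ)

/-- The right linear map `M → Hom(N, ℚ/ℤ)` given by a character of `M ⊗_A N`. -/
def leftCurry {M N : Type u} [AddCommGroup M] [Module Aᵐᵒᵖ M] [AddCommGroup N] [Module A N]
    (χ : Ten A M N →+ AddCircle (1 : ℚ)) : M →ₗ[Aᵐᵒᵖ] LeftChar N where
  toFun m := χ.comp (Ten.mk A M m)
  map_add' m m' := AddMonoidHom.ext fun n =>
    (congrArg χ (Ten.add_tmul m m' n)).trans (map_add χ _ _)
  map_smul' a m := AddMonoidHom.ext fun n => congrArg χ (Ten.smul_tmul m (unop a) n)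

/-- The character of `M ⊗_A N` given by a right linear map `M → Hom(N, ℚ/ℤ)`. -/
def leftUncurry {M N : Type u} [AddCommGroup M] [Module Aᵐᵒᵖ M] [AddCommGroup N] [Module A N]
    (g : M →ₗ[Aᵐᵒᵖ] LeftChar N) : Ten A M N →+ AddCircle (1 : ℚ) :=
  Ten.lift (show M →+ (N →+ AddCircle (1 : ℚ)) from g.toAddMonoidHom)
    (fun m a n => congrArg (fun φ : N →+ AddCircle (1 : ℚ) => φ n) (g.map_smul (op a) m))

theorem flatLeft_of_ideal {N : Type u} [AddCommGroup N] [Module A N]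
    (h : ∀ I : Ideal Aᵐᵒᵖ, Function.Injective
      (map A I.subtype.toAddMonoidHom (idh N) : Ten A I N →+ Ten A Aᵐᵒᵖ N)) :
    FlatLeft A N := by
  have baer : Module.Baer Aᵐᵒᵖ (LeftChar N) := fun I g => by
    obtain ⟨χ, hχ⟩ := exists_char_extension _ (h I) (leftUncurry g)
    refine ⟨leftCurry χ, fun x hx => AddMonoidHom.ext fun n => ?_⟩
    refine Eq.trans ?_ ((DFunLike.congr_fun hχ (tmul A (⟨x, hx⟩ : I) n)).trans
      (Ten.lift_tmul _ _ _ _))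
    rw [AddMonoidHom.comp_apply, Ten.map_tmul]
    rfl
  intro M M' _ _ _ _ f _ hf
  refine (injective_iff_map_eq_zero _).2 fun t ht => ?_
  by_contra hne
  obtain ⟨χ, hχ⟩ := CharacterModule.exists_character_apply_ne_zero_of_ne_zero hne
  obtain ⟨g, hg⟩ := baer.extension_property (IsLin.toLin Aᵐᵒᵖ f) hf
    (leftCurry (show Ten A M N →+ AddCircle (1 : ℚ) from χ))
  have e : (leftUncurry g).comp (map A f (idh N)) = χ := Ten.hom_ext fun m n => by
    rw [AddMonoidHom.comp_apply, Ten.map_tmul]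
    refine (Ten.lift_tmul _ _ _ _).trans ?_
    exact congrArg (fun φ : N →+ AddCircle (1 : ℚ) => φ n) (LinearMap.congr_fun hg m)
  exact hχ ((DFunLike.congr_fun e t).symm.trans ((congrArg _ ht).trans (map_zero _)))

theorem IsVonNeumannRegular.op (hA : IsVonNeumannRegular A) : IsVonNeumannRegular Aᵐᵒᵖ := by
  intro a
  obtain ⟨x, hx⟩ := hA (unop a)
  exact ⟨MulOpposite.op x, unop_injective (by simpa [mul_assoc] using hx)⟩

/-- Inductive step for the fact that finitely many elements of a left ideal have a common right unit
in it. With `b = a(1 - e)` and `b x b = b`, the element `f = x b` is idempotent with `f e = 0` and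
`b f = b`; the new unit is `e + f - e f`. It absorbs both `e` and `b`, hence `a = a e + b`. -/
theorem IsVonNeumannRegular.exists_mul_eq {I : Ideal A} (hA : IsVonNeumannRegular A) {a e : A}
    (ha : a ∈ I) (he : e ∈ I) (hee : e * e = e) :
    ∃ e' ∈ I, e' * e' = e' ∧ a * e' = a ∧ e * e' = e := by
  obtain ⟨x, hx⟩ := hA (a * (1 - e))
  set b := a * (1 - e) with hb
  have hbe : b * e = 0 := by rw [hb, mul_assoc, sub_mul, one_mul, hee, sub_self, mul_zero]
  have hbI : b ∈ I := by
    rw [hb, mul_sub, mul_one]; exact I.sub_mem ha (I.mul_mem_left _ he)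
  have hf : b * (x * b) = b := by rw [← mul_assoc, hx]
  have hff : (x * b) * (x * b) = x * b := by rw [mul_assoc, hf]
  have hfe : (x * b) * e = 0 := by rw [mul_assoc, hbe, mul_zero]
  have hea : a = a * e + b := by rw [hb, mul_sub, mul_one]; abel
  have h1 : e * (e + x * b - e * (x * b)) = e := by
    rw [mul_sub, mul_add, ← mul_assoc e e, hee]; abel
  have h2 : b * (e + x * b - e * (x * b)) = b := by
    rw [mul_sub, mul_add, hbe, hf, ← mul_assoc, hbe]; simp
  refine ⟨e + x * b - e * (x * b), ?_, ?_, ?_, h1⟩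
  · exact I.sub_mem (I.add_mem he (I.mul_mem_left _ hbI))
      (I.mul_mem_left _ (I.mul_mem_left _ hbI))
  · conv_lhs => rw [sub_mul, add_mul, h1, mul_assoc x, h2, mul_assoc e, mul_assoc x, h2]
  · conv_lhs => rw [hea, add_mul, mul_assoc, h1, h2]
    exact hea.symm

/-- Two steps starting from the idempotent `0`: the second unit `e'` satisfies `e e' = e`, so it
still fixes `a`. -/
theorem IsVonNeumannRegular.exists_mul_eq₂ {I : Ideal A} (hA : IsVonNeumannRegular A) {a b : A}
    (ha : a ∈ I) (hb : b ∈ I) : ∃ e ∈ I, a * e = a ∧ b * e = b := by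
  obtain ⟨e, he, hee, hae, -⟩ := hA.exists_mul_eq ha I.zero_mem (mul_zero 0)
  obtain ⟨e', he', -, hbe, hee'⟩ := hA.exists_mul_eq hb he hee
  exact ⟨e', he', by rw [← hae, mul_assoc, hee'], hbe⟩

theorem IsVonNeumannRegular.flatRight (hA : IsVonNeumannRegular A) (M : Type u) [AddCommGroup M]
    [Module Aᵐᵒᵖ M] : FlatRight A M := by
  refine flatRight_of_ideal fun I => ?_
  -- If `e'` is a right unit for all the ideal elements occurring in `t`, they can be moved across
  -- the tensor sign, and `t` is read off from its image in `M`. Allowing every `e'` that absorbs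
  -- `e` lets two summands share one unit.
  have key : ∀ t : Ten A M I, ∃ e : I, ∀ e' : I, (e : A) * e' = e →
      t = tmul A (rid M (map A (idh M) I.subtype.toAddMonoidHom t)) e' := by
    intro t
    induction t using Ten.induction with
    | h0 => exact ⟨0, fun e' _ => by simp⟩
    | h1 m i =>
      refine ⟨i, fun e' h => ?_⟩
      rw [Ten.map_tmul, Ten.rid_tmul, Ten.smul_tmul]
      exact congrArg _ (Subtype.ext h.symm)
    | h2 s t hs ht =>
      obtain ⟨e₁, h₁⟩ := hs
      obtain ⟨e₂, h₂⟩ := ht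
      obtain ⟨e, he, ha, hb⟩ := hA.exists_mul_eq₂ e₁.2 e₂.2
      refine ⟨⟨e, he⟩, fun e' h => ?_⟩
      conv_lhs => rw [h₁ e' (by rw [← ha, mul_assoc, h]), h₂ e' (by rw [← hb, mul_assoc, h])]
      rw [map_add, map_add, Ten.add_tmul]
  refine (injective_iff_map_eq_zero _).2 fun t ht => ?_
  obtain ⟨e, he⟩ := key t
  obtain ⟨e', he', h, -⟩ := hA.exists_mul_eq₂ e.2 e.2
  rw [he ⟨e', he'⟩ h, ht, map_zero, Ten.zero_tmul]

theorem IsVonNeumannRegular.flatLeft (hA : IsVonNeumannRegular A) (N : Type u) [AddCommGroup N]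
    [Module A N] : FlatLeft A N := by
  refine flatLeft_of_ideal fun I => ?_
  let μ : Ten A Aᵐᵒᵖ N →+ N := Ten.lift (AddMonoidHom.mk' (fun a => Ten.lmul A N (unop a))
    (fun a b => by ext; simp [add_smul])) (fun a b n => by simp [mul_smul])
  have key : ∀ t : Ten A I N, ∃ e : I, ∀ e' : I, (e : Aᵐᵒᵖ) * e' = e →
      t = tmul A e' (μ (map A I.subtype.toAddMonoidHom (idh N) t)) := by
    intro t
    induction t using Ten.induction with
    | h0 => exact ⟨0, fun e' _ => by simp⟩
    | h1 i n =>
      refine ⟨i, fun e' h => ?_⟩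
      rw [Ten.map_tmul, Ten.lift_tmul]
      change _ = tmul A e' (unop (i : Aᵐᵒᵖ) • n)
      rw [← Ten.smul_tmul]
      exact congrArg (fun x => tmul A x n) (Subtype.ext h.symm)
    | h2 s t hs ht =>
      obtain ⟨e₁, h₁⟩ := hs
      obtain ⟨e₂, h₂⟩ := ht
      obtain ⟨e, he, ha, hb⟩ := hA.op.exists_mul_eq₂ e₁.2 e₂.2
      refine ⟨⟨e, he⟩, fun e' h => ?_⟩
      conv_lhs => rw [h₁ e' (by rw [← ha, mul_assoc, h]), h₂ e' (by rw [← hb, mul_assoc, h])]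
      rw [map_add, map_add, Ten.tmul_add]
  refine (injective_iff_map_eq_zero _).2 fun t ht => ?_
  obtain ⟨e, he⟩ := key t
  obtain ⟨e', he', h, -⟩ := hA.op.exists_mul_eq₂ e.2 e.2
  rw [he ⟨e', he'⟩ h, ht, map_zero, Ten.tmul_zero]

end Flat

end Corings

namespace Corings
open Corings.Ten (map lid rid assoc tmul)

/-! ## Kernels and cokernels in preadditive categories -/

section Abstract

variable {𝒞 : Type*} [Category 𝒞] [Preadditive 𝒞] {𝒟 : Type*} [Category 𝒟] [Preadditive 𝒟]

/-- `f` is a kernel of `g`. -/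
structure IsKer {X Y Z : 𝒞} (f : X ⟶ Y) (g : Y ⟶ Z) : Prop where
  w : f ≫ g = 0
  mono : Mono f
  lift : ∀ {W : 𝒞} (k : W ⟶ Y), k ≫ g = 0 → ∃ l : W ⟶ X, l ≫ f = k

/-- `g` is a cokernel of `f`. -/
structure IsCoker {X Y Z : 𝒞} (f : X ⟶ Y) (g : Y ⟶ Z) : Prop where
  w : f ≫ g = 0
  epi : Epi g
  desc : ∀ {W : 𝒞} (k : Y ⟶ W), f ≫ k = 0 → ∃ l : Z ⟶ W, g ≫ l = k

/-- A test morphism is transposed, factored through `f`, and transposed back. Together with the dual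
statement this is what makes a functor with adjoints on both sides exact. -/
theorem IsKer.map_of_adj {L : 𝒟 ⥤ 𝒞} {F : 𝒞 ⥤ 𝒟} (adj : L ⊣ F) [F.Additive] {X Y Z : 𝒞}
    {f : X ⟶ Y} {g : Y ⟶ Z} (h : IsKer f g) : IsKer (F.map f) (F.map g) where
  w := by rw [← F.map_comp, h.w, F.map_zero]
  mono := by
    have := h.mono
    have := Functor.preservesMonomorphisms_of_adjunction adj
    infer_instance
  lift {W} k hk := by
    have := adj.left_adjoint_additive
    obtain ⟨l, hl⟩ := h.lift ((adj.homEquiv _ _).symm k) (by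
      rw [← adj.homEquiv_naturality_right_symm, hk, adj.homEquiv_counit, L.map_zero,
        Limits.zero_comp])
    exact ⟨adj.homEquiv _ _ l, by
      rw [← adj.homEquiv_naturality_right, hl, Equiv.apply_symm_apply]⟩

theorem IsCoker.map_of_adj {F : 𝒞 ⥤ 𝒟} {R : 𝒟 ⥤ 𝒞} (adj : F ⊣ R) [F.Additive] {X Y Z : 𝒞}
    {f : X ⟶ Y} {g : Y ⟶ Z} (h : IsCoker f g) : IsCoker (F.map f) (F.map g) where
  w := by rw [← F.map_comp, h.w, F.map_zero]
  epi := by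
    have := h.epi
    have := Functor.preservesEpimorphisms_of_adjunction adj
    infer_instance
  desc {W} k hk := by
    have := adj.right_adjoint_additive
    obtain ⟨l, hl⟩ := h.desc (adj.homEquiv _ _ k) (by
      rw [← adj.homEquiv_naturality_left, hk, adj.homEquiv_unit, R.map_zero, Limits.comp_zero])
    exact ⟨(adj.homEquiv _ _).symm l, by
      rw [← adj.homEquiv_naturality_left_symm, hl, Equiv.symm_apply_apply]⟩

end Abstract

variable {A B : Type u} [Ring A] [Ring B]

/-! ## The category of right comodules -/

section Right

variable {C : Coring A}

instance (C : Coring A) : Preadditive (RComod C) where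
  homGroup M N :=
    letI : Add (M ⟶ N) := ⟨fun f g =>
      { hom := f.hom + g.hom
        colin := fun m => (Ten.map_add_left (fun _ => rfl) _).trans
          ((congrArg₂ (· + ·) (f.colin m) (g.colin m)).trans (map_add N.rho _ _).symm) }⟩
    letI : Zero (M ⟶ N) := ⟨
      { hom := 0
        colin := fun m => (Ten.map_zero_left (fun _ => rfl) _).trans (map_zero N.rho).symm }⟩
    letI : Neg (M ⟶ N) := ⟨fun f =>
      { hom := -f.hom
        colin := fun m => by
          have e : map A (-f.hom) (idh C) (M.rho m) + map A f.hom (idh C) (M.rho m) = 0 :=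
            (Ten.map_add_left (f := 0) (f₁ := -f.hom) (f₂ := f.hom)
              (fun x => (neg_add_cancel (f.hom x)).symm) _).symm.trans
              (Ten.map_zero_left (fun _ => rfl) _)
          rw [eq_neg_of_add_eq_zero_left e, f.colin]
          exact (map_neg N.rho _).symm }⟩
    { AddGroup.ofLeftAxioms
        (fun f g h : M ⟶ N => RComod.hom_ext' fun _ => add_assoc _ _ _)
        (fun f : M ⟶ N => RComod.hom_ext' fun _ => zero_add _)
        (fun f : M ⟶ N => RComod.hom_ext' fun _ => neg_add_cancel _) with
      add_comm := fun f g => RComod.hom_ext' fun _ => add_comm _ _ }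
  add_comp _ _ _ f f' g := RComod.hom_ext' fun _ => map_add g.hom _ _
  comp_add _ _ _ f g g' := RComod.hom_ext' fun _ => rfl

namespace RComod

@[simp] theorem comp_apply {M N P : RComod C} (f : M ⟶ N) (g : N ⟶ P) (m : M) :
    (f ≫ g).hom m = g.hom (f.hom m) := rfl

@[simp] theorem add_apply {M N : RComod C} (f g : M ⟶ N) (m : M) :
    (f + g).hom m = f.hom m + g.hom m := rfl

theorem congr_hom {M N : RComod C} {f g : M ⟶ N} (h : f = g) (m : M) : f.hom m = g.hom m :=
  h ▸ rfl

@[simp] theorem sub_apply {M N : RComod C} (f g : M ⟶ N) (m : M) :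
    (f - g).hom m = f.hom m - g.hom m := by
  rw [eq_sub_iff_add_eq, ← add_apply, sub_add_cancel]

@[simp] theorem iso_hom_inv {M N : RComod C} (e : M ≅ N) (m : M) : e.inv.hom (e.hom.hom m) = m :=
  congr_hom e.hom_inv_id m

/-- A bijective morphism of comodules is an isomorphism. -/
noncomputable def isoOfBijective {M N : RComod C} (f : M ⟶ N) (hf : Function.Bijective f.hom) :
    M ≅ N :=
  let e := AddEquiv.ofBijective f.hom hf
  have he : ∀ m, f.hom (e.symm m) = m := fun m => e.apply_symm_apply m
  haveI : IsLin Aᵐᵒᵖ e.symm.toAddMonoidHom := ⟨fun a m => by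
    apply hf.1
    exact (he _).trans (((IsLin.smul (f := f.hom) a (e.symm m)).trans
      (congrArg _ (he m))).symm)⟩
  { hom := f
    inv :=
      { hom := e.symm.toAddMonoidHom
        colin := fun m => by
          obtain ⟨m, rfl⟩ := hf.2 m
          rw [← f.colin, Ten.map_map]
          refine (Ten.map_id' (fun x => e.symm_apply_apply x) (fun _ => rfl) _).trans ?_
          exact congrArg M.rho (e.symm_apply_apply m).symm }
    hom_inv_id := hom_ext' fun m => e.symm_apply_apply m
    inv_hom_id := hom_ext' fun m => he m }

section sub

variable (hC : FlatLeft A C) (M : RComod C) (K : Submodule Aᵐᵒᵖ M)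
  (hK : ∀ k : K, ∃ s : Ten A K C, map A K.subtype.toAddMonoidHom (idh C) s = M.rho k)

/-- The inclusion of a subcomodule. -/
noncomputable def subι : RComod.sub hC M K hK ⟶ M where
  hom := K.subtype.toAddMonoidHom
  lin := inferInstanceAs (IsLin Aᵐᵒᵖ K.subtype.toAddMonoidHom)
  colin := RComod.sub_rho hC M K hK

theorem subι_injective : Function.Injective (subι hC M K hK).hom := K.injective_subtype

theorem mem_range_subι {m : M} : (∃ k, (subι hC M K hK).hom k = m) ↔ m ∈ K :=
  ⟨fun ⟨k, hk⟩ => hk ▸ Subtype.property (p := (· ∈ K)) k, fun h => ⟨(⟨m, h⟩ : K), rfl⟩⟩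

/-- A morphism with image in a subcomodule. -/
noncomputable def subLift {P : RComod C} (f : P ⟶ M) (hf : ∀ p, f.hom p ∈ K) :
    P ⟶ RComod.sub hC M K hK :=
  let r : P →+ K := AddMonoidHom.mk' (fun p => ⟨f.hom p, hf p⟩)
    (fun p q => Subtype.ext (map_add f.hom p q))
  haveI : IsLin Aᵐᵒᵖ r := ⟨fun a p => Subtype.ext (IsLin.smul (f := f.hom) a p)⟩
  { hom := r
    lin := this
    colin := fun p => by
      apply hC _ _ K.subtype.toAddMonoidHom K.injective_subtype
      refine (Ten.map_map _ _ _ _ _).trans (Eq.trans ?_ (RComod.sub_rho hC M K hK (r p)).symm)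
      exact (Ten.map_congr (fun _ => rfl) (fun _ => rfl) _).trans (f.colin p) }

end sub

/-! ### Kernels and monomorphisms of right comodules -/

section ker

variable {M N : RComod C}

/-- Flatness enters here: exactness of `- ⊗_A C` shows that the coaction maps the linear kernel `K`
into `K ⊗_A C`, so `K` is a subcomodule. -/
theorem exists_kernel (hC : FlatLeft A C) (f : M ⟶ N) :
    ∃ (K : RComod C) (ι : K ⟶ M), Function.Injective ι.hom ∧
    (∀ m, f.hom m = 0 ↔ ∃ k, ι.hom k = m) ∧
    ∀ {P : RComod C} (g : P ⟶ M), g ≫ f = 0 → ∃ l : P ⟶ K, l ≫ ι = g := by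
  let K : Submodule Aᵐᵒᵖ M := LinearMap.ker (IsLin.toLin Aᵐᵒᵖ f.hom)
  have hK : ∀ k : K, ∃ s : Ten A K C,
      map A K.subtype.toAddMonoidHom (idh C) s = M.rho k := fun k =>
    hC.exact f.hom K (fun _ h => h) _ (by
      rw [f.colin, (show f.hom k = 0 from k.2), map_zero])
  exact ⟨_, subι hC M K hK, subι_injective hC M K hK,
    fun m => (mem_range_subι hC M K hK (m := m)).symm,
    fun g hg => ⟨subLift hC M K hK g fun p => congr_hom hg p, rfl⟩⟩

/-- A monomorphism must kill the inclusion of its own kernel, and that kernel is the linear one. -/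
theorem mono_iff (hC : FlatLeft A C) (f : M ⟶ N) : Mono f ↔ Function.Injective f.hom := by
  refine ⟨fun h => (injective_iff_map_eq_zero _).2 fun m hm => ?_, fun h => ⟨fun g g' e => ?_⟩⟩
  · obtain ⟨K, ι, -, hι, -⟩ := exists_kernel hC f
    obtain ⟨k, rfl⟩ := (hι m).1 hm
    have : ι = 0 := (cancel_mono f).1 (hom_ext' fun k =>
      ((hι _).2 ⟨k, rfl⟩).trans (map_zero f.hom).symm)
    rw [this]; rfl
  · exact hom_ext' fun m => h (congr_hom e m)

theorem isKer_iff (hC : FlatLeft A C) {P : RComod C} (f : M ⟶ N) (g : N ⟶ P) :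
    IsKer f g ↔ Function.Injective f.hom ∧ Function.Exact f.hom g.hom := by
  constructor
  · intro h
    refine ⟨(mono_iff hC f).1 h.mono, fun n => ⟨fun hn => ?_, ?_⟩⟩
    · obtain ⟨K, ι, -, hι, -⟩ := exists_kernel hC g
      obtain ⟨k, rfl⟩ := (hι n).1 hn
      obtain ⟨l, hl⟩ := h.lift ι (hom_ext' fun k => (hι _).2 ⟨k, rfl⟩)
      exact ⟨l.hom k, congr_hom hl k⟩
    · rintro ⟨m, rfl⟩
      exact congr_hom h.w m
  · rintro ⟨h, e⟩
    refine ⟨hom_ext' fun m => (e _).2 ⟨m, rfl⟩, (mono_iff hC f).2 h, fun {W} k hk => ?_⟩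
    obtain ⟨K, ι, h', hι, hl⟩ := exists_kernel hC g
    -- The comparison of `f` with the concrete kernel is bijective, so the universal property
    -- carries over to `f`.
    obtain ⟨φ, hφ⟩ := hl f (hom_ext' fun m => (e _).2 ⟨m, rfl⟩)
    have bij : Function.Bijective φ.hom := by
      refine ⟨fun x y hxy => h ?_, fun y => ?_⟩
      · rw [← hφ]; exact congrArg ι.hom hxy
      · obtain ⟨x, hx⟩ := (e (ι.hom y)).1 ((hι _).2 ⟨y, rfl⟩)
        exact ⟨x, h' (by rw [← hx, ← hφ]; rfl)⟩
    obtain ⟨l, hl⟩ := hl k hk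
    refine ⟨l ≫ (isoOfBijective φ bij).inv, ?_⟩
    rw [← hφ, Category.assoc]
    exact (congrArg (l ≫ ·) ((isoOfBijective φ bij).inv_hom_id_assoc ι)).trans hl

end ker

/-! ### Cokernels and epimorphisms of right comodules -/

section coker

variable {M N : RComod C} (f : M ⟶ N)

/-- A comodule structure descends along a surjection. -/
abbrev quot (N : RComod C) {Q : Type u} [AddCommGroup Q] [Module Aᵐᵒᵖ Q] (π : N →+ Q)
    [IsLin Aᵐᵒᵖ π] (hπ : Function.Surjective π) (ρ : Q →+ Ten A Q C) [IsLin Aᵐᵒᵖ ρ]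
    (h : ∀ n, map A π (idh C) (N.rho n) = ρ (π n)) : RComod C where
  carrier := Q
  rho := ρ
  coassoc q := by
    obtain ⟨n, rfl⟩ := hπ q
    rw [← h, Ten.map_map, Ten.map_map, Ten.map_congr (f' := (map A π (idh C)).comp N.rho)
      (g' := (idh C).comp (idh C)) (fun n => (h n).symm) (fun _ => rfl), ← Ten.map_map,
      Ten.assoc_map, N.coassoc, Ten.map_map]
    exact Ten.map_congr (fun _ => rfl) (fun c => Ten.map_id _) _
  counit q := by
    obtain ⟨n, rfl⟩ := hπ q
    rw [← h]
    have e : ∀ z, rid Q (map A (idh Q) C.ε (map A π (idh C) z)) =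
        π (rid N (map A (idh N) C.ε z)) := fun z => by
      induction z using Ten.induction with
      | h0 => simp only [map_zero]
      | h2 s t hs ht => simp only [map_add, hs, ht]
      | h1 n c =>
        simp only [Ten.map_tmul, Ten.rid_tmul]
        exact (IsLin.smul (f := π) _ _).symm
    rw [e, N.counit]

/-- In contrast to kernels, no flatness is needed: the coaction composed with `π ⊗ C` kills the
image of `f`, so it descends to the quotient module. -/
theorem exists_cokernel : ∃ (Q : RComod C) (π : N ⟶ Q), Function.Surjective π.hom ∧
    (∀ n, π.hom n = 0 ↔ ∃ m, f.hom m = n) := by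
  let K : Submodule Aᵐᵒᵖ N := LinearMap.range (IsLin.toLin Aᵐᵒᵖ f.hom)
  let π : N →+ (N ⧸ K) := K.mkQ.toAddMonoidHom
  let r : N →ₗ[Aᵐᵒᵖ] Ten A (N ⧸ K) C := IsLin.toLin Aᵐᵒᵖ ((map A π (idh C)).comp N.rho)
  have hr : K ≤ LinearMap.ker r := by
    rintro _ ⟨m, rfl⟩
    change map A π (idh C) (N.rho (f.hom m)) = 0
    rw [← f.colin, Ten.map_map]
    exact Ten.map_zero_left (fun m => (Submodule.Quotient.mk_eq_zero K).2 ⟨m, rfl⟩) _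
  refine ⟨quot N π K.mkQ_surjective (K.liftQ r hr).toAddMonoidHom (fun n => rfl),
    { hom := π, lin := inferInstanceAs (IsLin Aᵐᵒᵖ π), colin := fun n => rfl }, K.mkQ_surjective,
    fun n => ?_⟩
  exact (Submodule.Quotient.mk_eq_zero K)

theorem epi_iff : Epi f ↔ Function.Surjective f.hom := by
  refine ⟨fun h n => ?_, fun h => ⟨fun g g' e => ?_⟩⟩
  · obtain ⟨Q, π, -, hπ⟩ := exists_cokernel f
    have : π = 0 := (cancel_epi f).1 (hom_ext' fun k => (hπ _).2 ⟨k, rfl⟩)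
    exact (hπ n).1 (by rw [this]; rfl)
  · refine hom_ext' fun n => ?_
    obtain ⟨m, rfl⟩ := h n
    exact congr_hom e m

theorem isCoker_iff {P : RComod C} (g : N ⟶ P) :
    IsCoker f g ↔ Function.Surjective g.hom ∧ Function.Exact f.hom g.hom := by
  constructor
  · intro h
    refine ⟨(epi_iff g).1 h.epi, fun n => ⟨fun hn => ?_, ?_⟩⟩
    · obtain ⟨Q, π, -, hπ⟩ := exists_cokernel f
      obtain ⟨l, hl⟩ := h.desc π (hom_ext' fun k => (hπ _).2 ⟨k, rfl⟩)
      exact (hπ n).1 (by rw [← hl, comp_apply, hn, map_zero])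
    · rintro ⟨m, rfl⟩
      exact congr_hom h.w m
  · rintro ⟨h, e⟩
    refine ⟨hom_ext' fun m => (e _).2 ⟨m, rfl⟩, (epi_iff g).2 h, fun {W} k hk => ?_⟩
    have key : ∀ n n', g.hom n = g.hom n' → k.hom n = k.hom n' := fun n n' hn => by
      obtain ⟨m, hm⟩ := (e (n - n')).1 (by rw [map_sub, hn, sub_self])
      rw [← sub_eq_zero, ← map_sub, ← hm]
      exact congr_hom hk m
    let s := Function.surjInv h
    have hs : ∀ n, k.hom (s (g.hom n)) = k.hom n := fun n => key _ _ (Function.surjInv_eq h _)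
    let r : P →+ W := AddMonoidHom.mk' (fun p => k.hom (s p)) (fun p q => by
      obtain ⟨p, rfl⟩ := h p
      obtain ⟨q, rfl⟩ := h q
      rw [← map_add, hs, hs, hs, map_add])
    have : IsLin Aᵐᵒᵖ r := ⟨fun a p => by
      obtain ⟨p, rfl⟩ := h p
      change k.hom (s (a • g.hom p)) = a • k.hom (s (g.hom p))
      rw [← IsLin.smul (f := g.hom), hs, hs, IsLin.smul (f := k.hom)]⟩
    exact ⟨{ hom := r
             colin := fun p => by
               obtain ⟨p, rfl⟩ := h p
               rw [← g.colin, Ten.map_map]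
               refine ((Ten.map_congr hs (fun _ => rfl) _).trans (k.colin p)).trans ?_
               exact congrArg W.rho (hs p).symm },
      hom_ext' hs⟩

end coker

end RComod

end Right

/-! ## The category of left comodules -/

section Left

variable {C : Coring A}

instance (C : Coring A) : Preadditive (LComod C) where
  homGroup M N :=
    letI : Add (M ⟶ N) := ⟨fun f g =>
      { hom := f.hom + g.hom
        colin := fun m => (Ten.map_add_right (fun _ => rfl) _).trans
          ((congrArg₂ (· + ·) (f.colin m) (g.colin m)).trans (map_add N.lam _ _).symm) }⟩
    letI : Zero (M ⟶ N) := ⟨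
      { hom := 0
        colin := fun m => (Ten.map_zero_right (fun _ => rfl) _).trans (map_zero N.lam).symm }⟩
    letI : Neg (M ⟶ N) := ⟨fun f =>
      { hom := -f.hom
        colin := fun m => by
          have e : map A (idh C) (-f.hom) (M.lam m) + map A (idh C) f.hom (M.lam m) = 0 :=
            (Ten.map_add_right (g := 0) (g₁ := -f.hom) (g₂ := f.hom)
              (fun x => (neg_add_cancel (f.hom x)).symm) _).symm.trans
              (Ten.map_zero_right (fun _ => rfl) _)
          rw [eq_neg_of_add_eq_zero_left e, f.colin]
          exact (map_neg N.lam _).symm }⟩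
    { AddGroup.ofLeftAxioms
        (fun f g h : M ⟶ N => LComod.hom_ext' fun _ => add_assoc _ _ _)
        (fun f : M ⟶ N => LComod.hom_ext' fun _ => zero_add _)
        (fun f : M ⟶ N => LComod.hom_ext' fun _ => neg_add_cancel _) with
      add_comm := fun f g => LComod.hom_ext' fun _ => add_comm _ _ }
  add_comp _ _ _ f f' g := LComod.hom_ext' fun _ => map_add g.hom _ _
  comp_add _ _ _ f g g' := LComod.hom_ext' fun _ => rfl

namespace LComod

@[simp] theorem comp_apply {M N P : LComod C} (f : M ⟶ N) (g : N ⟶ P) (m : M) :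
    (f ≫ g).hom m = g.hom (f.hom m) := rfl

theorem congr_hom {M N : LComod C} {f g : M ⟶ N} (h : f = g) (m : M) : f.hom m = g.hom m :=
  h ▸ rfl

/-- A bijective morphism of comodules is an isomorphism. -/
noncomputable def isoOfBijective {M N : LComod C} (f : M ⟶ N) (hf : Function.Bijective f.hom) :
    M ≅ N :=
  let e := AddEquiv.ofBijective f.hom hf
  have he : ∀ m, f.hom (e.symm m) = m := fun m => e.apply_symm_apply m
  haveI : IsLin A e.symm.toAddMonoidHom := ⟨fun a m => by
    apply hf.1
    exact (he _).trans (((IsLin.smul (f := f.hom) a (e.symm m)).trans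
      (congrArg _ (he m))).symm)⟩
  { hom := f
    inv :=
      { hom := e.symm.toAddMonoidHom
        colin := fun m => by
          obtain ⟨m, rfl⟩ := hf.2 m
          rw [← f.colin, Ten.map_map]
          refine (Ten.map_id' (fun _ => rfl) (fun x => e.symm_apply_apply x) _).trans ?_
          exact congrArg M.lam (e.symm_apply_apply m).symm }
    hom_inv_id := hom_ext' fun m => e.symm_apply_apply m
    inv_hom_id := hom_ext' fun m => he m }

section sub

variable (hC : FlatRight A C) (M : LComod C) (K : Submodule A M)
  (hK : ∀ k : K, ∃ s : Ten A C K, map A (idh C) K.subtype.toAddMonoidHom s = M.lam k)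

/-- The inclusion of a subcomodule. -/
noncomputable def subι : LComod.sub hC M K hK ⟶ M where
  hom := K.subtype.toAddMonoidHom
  lin := inferInstanceAs (IsLin A K.subtype.toAddMonoidHom)
  colin := LComod.sub_lam hC M K hK

theorem subι_injective : Function.Injective (subι hC M K hK).hom := K.injective_subtype

theorem mem_range_subι {m : M} : (∃ k, (subι hC M K hK).hom k = m) ↔ m ∈ K :=
  ⟨fun ⟨k, hk⟩ => hk ▸ Subtype.property (p := (· ∈ K)) k, fun h => ⟨(⟨m, h⟩ : K), rfl⟩⟩

/-- A morphism with image in a subcomodule. -/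
noncomputable def subLift {P : LComod C} (f : P ⟶ M) (hf : ∀ p, f.hom p ∈ K) :
    P ⟶ LComod.sub hC M K hK :=
  let r : P →+ K := AddMonoidHom.mk' (fun p => ⟨f.hom p, hf p⟩)
    (fun p q => Subtype.ext (map_add f.hom p q))
  haveI : IsLin A r := ⟨fun a p => Subtype.ext (IsLin.smul (f := f.hom) a p)⟩
  { hom := r
    lin := this
    colin := fun p => by
      apply hC _ _ K.subtype.toAddMonoidHom K.injective_subtype
      refine (Ten.map_map _ _ _ _ _).trans (Eq.trans ?_ (LComod.sub_lam hC M K hK (r p)).symm)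
      exact (Ten.map_congr (fun _ => rfl) (fun _ => rfl) _).trans (f.colin p) }

end sub

section ker

variable {M N : LComod C}

/-- As for right comodules, except that `C ⊗_A -` now has to be exact, so it is the right module
`C_A` that must be flat. -/
theorem exists_kernel (hC : FlatRight A C) (f : M ⟶ N) :
    ∃ (K : LComod C) (ι : K ⟶ M), Function.Injective ι.hom ∧
    (∀ m, f.hom m = 0 ↔ ∃ k, ι.hom k = m) ∧
    ∀ {P : LComod C} (g : P ⟶ M), g ≫ f = 0 → ∃ l : P ⟶ K, l ≫ ι = g := by
  let K : Submodule A M := LinearMap.ker (IsLin.toLin A f.hom)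
  have hK : ∀ k : K, ∃ s : Ten A C K,
      map A (idh C) K.subtype.toAddMonoidHom s = M.lam k := fun k =>
    hC.exact f.hom K (fun _ h => h) _ (by
      rw [f.colin, (show f.hom k = 0 from k.2), map_zero])
  exact ⟨_, subι hC M K hK, subι_injective hC M K hK,
    fun m => (mem_range_subι hC M K hK (m := m)).symm,
    fun g hg => ⟨subLift hC M K hK g fun p => congr_hom hg p, rfl⟩⟩

theorem mono_iff (hC : FlatRight A C) (f : M ⟶ N) : Mono f ↔ Function.Injective f.hom := by
  refine ⟨fun h => (injective_iff_map_eq_zero _).2 fun m hm => ?_, fun h => ⟨fun g g' e => ?_⟩⟩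
  · obtain ⟨K, ι, -, hι, -⟩ := exists_kernel hC f
    obtain ⟨k, rfl⟩ := (hι m).1 hm
    have : ι = 0 := (cancel_mono f).1 (hom_ext' fun k =>
      ((hι _).2 ⟨k, rfl⟩).trans (map_zero f.hom).symm)
    rw [this]; rfl
  · exact hom_ext' fun m => h (congr_hom e m)

theorem isKer_iff (hC : FlatRight A C) {P : LComod C} (f : M ⟶ N) (g : N ⟶ P) :
    IsKer f g ↔ Function.Injective f.hom ∧ Function.Exact f.hom g.hom := by
  constructor
  · intro h
    refine ⟨(mono_iff hC f).1 h.mono, fun n => ⟨fun hn => ?_, ?_⟩⟩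
    · obtain ⟨K, ι, -, hι, -⟩ := exists_kernel hC g
      obtain ⟨k, rfl⟩ := (hι n).1 hn
      obtain ⟨l, hl⟩ := h.lift ι (hom_ext' fun k => (hι _).2 ⟨k, rfl⟩)
      exact ⟨l.hom k, congr_hom hl k⟩
    · rintro ⟨m, rfl⟩
      exact congr_hom h.w m
  · rintro ⟨h, e⟩
    refine ⟨hom_ext' fun m => (e _).2 ⟨m, rfl⟩, (mono_iff hC f).2 h, fun {W} k hk => ?_⟩
    obtain ⟨K, ι, h', hι, hl⟩ := exists_kernel hC g
    obtain ⟨φ, hφ⟩ := hl f (hom_ext' fun m => (e _).2 ⟨m, rfl⟩)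
    have bij : Function.Bijective φ.hom := by
      refine ⟨fun x y hxy => h ?_, fun y => ?_⟩
      · rw [← hφ]; exact congrArg ι.hom hxy
      · obtain ⟨x, hx⟩ := (e (ι.hom y)).1 ((hι _).2 ⟨y, rfl⟩)
        exact ⟨x, h' (by rw [← hx, ← hφ]; rfl)⟩
    obtain ⟨l, hl⟩ := hl k hk
    refine ⟨l ≫ (isoOfBijective φ bij).inv, ?_⟩
    rw [← hφ, Category.assoc]
    exact (congrArg (l ≫ ·) ((isoOfBijective φ bij).inv_hom_id_assoc ι)).trans hl

end ker

section coker

variable {M N : LComod C} (f : M ⟶ N)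

/-- A comodule structure descends along a surjection. -/
abbrev quot (N : LComod C) {Q : Type u} [AddCommGroup Q] [Module A Q] (π : N →+ Q)
    [IsLin A π] (hπ : Function.Surjective π) (ρ : Q →+ Ten A C Q) [IsLin A ρ]
    (h : ∀ n, map A (idh C) π (N.lam n) = ρ (π n)) : LComod C where
  carrier := Q
  lam := ρ
  coassoc q := by
    obtain ⟨n, rfl⟩ := hπ q
    have e : ∀ z, assoc A C C A Q (map A C.Δ (idh Q) (map A (idh C) π z)) =
        map A (idh C) (map A (idh C) π) (assoc A C C A N (map A C.Δ (idh N) z)) := fun z => by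
      rw [← Ten.assoc_map, Ten.map_map, Ten.map_map]
      exact congrArg _ (Ten.map_congr (fun c => (Ten.map_id _).symm) (fun _ => rfl) _)
    rw [← h, e, N.coassoc, Ten.map_map, Ten.map_map]
    exact Ten.map_congr (fun _ => rfl) h _
  counit q := by
    obtain ⟨n, rfl⟩ := hπ q
    rw [← h]
    have e : ∀ z, lid Q (map A C.ε (idh Q) (map A (idh C) π z)) =
        π (lid N (map A C.ε (idh N) z)) := fun z => by
      induction z using Ten.induction with
      | h0 => simp only [map_zero]
      | h2 s t hs ht => simp only [map_add, hs, ht]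
      | h1 c n =>
        simp only [Ten.map_tmul, Ten.lid_tmul]
        exact (IsLin.smul (f := π) _ _).symm
    rw [e, N.counit]

theorem exists_cokernel : ∃ (Q : LComod C) (π : N ⟶ Q), Function.Surjective π.hom ∧
    (∀ n, π.hom n = 0 ↔ ∃ m, f.hom m = n) := by
  let K : Submodule A N := LinearMap.range (IsLin.toLin A f.hom)
  let π : N →+ (N ⧸ K) := K.mkQ.toAddMonoidHom
  let r : N →ₗ[A] Ten A C (N ⧸ K) := IsLin.toLin A ((map A (idh C) π).comp N.lam)
  have hr : K ≤ LinearMap.ker r := by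
    rintro _ ⟨m, rfl⟩
    change map A (idh C) π (N.lam (f.hom m)) = 0
    rw [← f.colin, Ten.map_map]
    exact Ten.map_zero_right (fun m => (Submodule.Quotient.mk_eq_zero K).2 ⟨m, rfl⟩) _
  refine ⟨quot N π K.mkQ_surjective (K.liftQ r hr).toAddMonoidHom (fun n => rfl),
    { hom := π, lin := inferInstanceAs (IsLin A π), colin := fun n => rfl }, K.mkQ_surjective,
    fun n => ?_⟩
  exact (Submodule.Quotient.mk_eq_zero K)

theorem epi_iff : Epi f ↔ Function.Surjective f.hom := by
  refine ⟨fun h n => ?_, fun h => ⟨fun g g' e => ?_⟩⟩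
  · obtain ⟨Q, π, -, hπ⟩ := exists_cokernel f
    have : π = 0 := (cancel_epi f).1 (hom_ext' fun k => (hπ _).2 ⟨k, rfl⟩)
    exact (hπ n).1 (by rw [this]; rfl)
  · refine hom_ext' fun n => ?_
    obtain ⟨m, rfl⟩ := h n
    exact congr_hom e m

theorem isCoker_iff {P : LComod C} (g : N ⟶ P) :
    IsCoker f g ↔ Function.Surjective g.hom ∧ Function.Exact f.hom g.hom := by
  constructor
  · intro h
    refine ⟨(epi_iff g).1 h.epi, fun n => ⟨fun hn => ?_, ?_⟩⟩
    · obtain ⟨Q, π, -, hπ⟩ := exists_cokernel f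
      obtain ⟨l, hl⟩ := h.desc π (hom_ext' fun k => (hπ _).2 ⟨k, rfl⟩)
      exact (hπ n).1 (by rw [← hl, comp_apply, hn, map_zero])
    · rintro ⟨m, rfl⟩
      exact congr_hom h.w m
  · rintro ⟨h, e⟩
    refine ⟨hom_ext' fun m => (e _).2 ⟨m, rfl⟩, (epi_iff g).2 h, fun {W} k hk => ?_⟩
    have key : ∀ n n', g.hom n = g.hom n' → k.hom n = k.hom n' := fun n n' hn => by
      obtain ⟨m, hm⟩ := (e (n - n')).1 (by rw [map_sub, hn, sub_self])
      rw [← sub_eq_zero, ← map_sub, ← hm]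
      exact congr_hom hk m
    let s := Function.surjInv h
    have hs : ∀ n, k.hom (s (g.hom n)) = k.hom n := fun n => key _ _ (Function.surjInv_eq h _)
    let r : P →+ W := AddMonoidHom.mk' (fun p => k.hom (s p)) (fun p q => by
      obtain ⟨p, rfl⟩ := h p
      obtain ⟨q, rfl⟩ := h q
      rw [← map_add, hs, hs, hs, map_add])
    have : IsLin A r := ⟨fun a p => by
      obtain ⟨p, rfl⟩ := h p
      change k.hom (s (a • g.hom p)) = a • k.hom (s (g.hom p))
      rw [← IsLin.smul (f := g.hom), hs, hs, IsLin.smul (f := k.hom)]⟩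
    exact ⟨{ hom := r
             colin := fun p => by
               obtain ⟨p, rfl⟩ := h p
               rw [← g.colin, Ten.map_map]
               refine ((Ten.map_congr (fun _ => rfl) hs _).trans (k.colin p)).trans ?_
               exact congrArg W.lam (hs p).symm },
      hom_ext' hs⟩

end coker

end LComod

end Left

end Corings

namespace Corings
open Corings.Ten (map lid rid assoc tmul)

/-! ## Cotensor products: basic facts -/

variable {A B : Type u} [Ring A] [Ring B] {C : Coring A} {D : Coring B}

theorem Ten.assoc_tmul' {M N L : Type*} [AddCommGroup M] [Module Aᵐᵒᵖ M] [AddCommGroup N]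
    [Module A N] [Module Bᵐᵒᵖ N] [SMulCommClass A Bᵐᵒᵖ N] [AddCommGroup L] [Module B L]
    (t : Ten A M N) (l : L) :
    assoc A M N B L (tmul B t l) = map A (AddMonoidHom.id M) ((Ten.mk B N (N := L)).flip l) t := by
  induction t using Ten.induction with
  | h0 => simp only [map_zero, Ten.zero_tmul]
  | h2 s t hs ht => simp only [map_add, Ten.add_tmul, hs, ht]
  | h1 m n => simp only [Ten.assoc_tmul, Ten.map_tmul]; rfl

instance {N : Type*} [AddCommGroup N] [Module A N] [Module Bᵐᵒᵖ N] [SMulCommClass A Bᵐᵒᵖ N] :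
    IsLin Bᵐᵒᵖ (lid (A := A) N) where
  smul b t := by
    induction t using Ten.induction with
    | h0 => simp
    | h1 a n => rw [Ten.right_smul_tmul, Ten.lid_tmul, Ten.lid_tmul, smul_comm]
    | h2 s t hs ht => simp only [smul_add, map_add, hs, ht]

instance {M : Type*} [AddCommGroup M] [Module B M] [Module Aᵐᵒᵖ M] [SMulCommClass B Aᵐᵒᵖ M] :
    IsLin B (rid (A := A) M) where
  smul b t := by
    induction t using Ten.induction with
    | h0 => simp
    | h1 m a =>
      rw [Ten.left_smul_tmul, Ten.rid_tmul, Ten.rid_tmul]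
      exact (smul_comm b (op a) m).symm
    | h2 s t hs ht => simp only [smul_add, map_add, hs, ht]

theorem mem_cot {M : RComod C} {N : LComod C} {t : Ten A M N} :
    t ∈ cot M N ↔ assoc A M C A N (map A M.rho (idh N) t) = map A (idh M) N.lam t := by
  rw [← sub_eq_zero]; rfl

theorem cot_coassoc {M : RComod C} {N : LComod C} (t : cot M N) :
    assoc A M C A N (map A M.rho (idh N) t) = map A (idh M) N.lam t := mem_cot.1 t.2

theorem cotMap_comp {M M' M'' : RComod C} {N N' N'' : LComod C} (f : M ⟶ M') (f' : M' ⟶ M'')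
    (g : N ⟶ N') (g' : N' ⟶ N'') (t : cot M N) :
    cotMap (f ≫ f') (g ≫ g') t = cotMap f' g' (cotMap f g t) :=
  Subtype.ext (Ten.map_map _ _ _ _ _).symm

theorem cotMap_id {M : RComod C} {N : LComod C} (t : cot M N) : cotMap (𝟙 M) (𝟙 N) t = t :=
  Subtype.ext (Ten.map_id _)

theorem cotMap_comm {M M' : RComod C} {N N' : LComod C} (f : M ⟶ M') (g : N ⟶ N') (t : cot M N) :
    cotMap f (𝟙 N') (cotMap (𝟙 M) g t) = cotMap (𝟙 M') g (cotMap f (𝟙 N) t) :=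
  Subtype.ext ((Ten.map_map _ _ _ _ (t : Ten A M N)).trans
    (Ten.map_map f.hom (idh N) (idh M') g.hom (t : Ten A M N)).symm)

/-! ### Cotensor products with cofree right comodules -/

section Right

/-- The coaction of a right comodule, as a morphism `M → M ⊗_A C`. -/
def RComod.rhoHom (M : RComod C) : M ⟶ C.regular.tenR M where
  hom := M.rho
  lin := M.rho_right
  colin m := by
    change map A M.rho (idh C) (M.rho m) = (assoc A M C A C).symm (map A (idh M) C.Δ (M.rho m))
    rw [AddEquiv.eq_symm_apply, M.coassoc]

section

variable {V W : Type u} [AddCommGroup V] [Module Aᵐᵒᵖ V] [AddCommGroup W] [Module Aᵐᵒᵖ W]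

theorem Bicomod.tenR_rho_tmul (X : Bicomod C D) (v : V) (x : X) :
    (X.tenR V).rho (tmul A v x) = map B (Ten.mk A V v) (idh D) (X.rho x) := by
  change (assoc A V X B D).symm (map A (idh V) X.rho (tmul A v x)) = _
  rw [Ten.map_tmul]
  exact Ten.assoc_symm_tmul' v (X.rho x)

/-- The morphism `v ⊗ - : X → V ⊗_A X`. -/
def Bicomod.mkR (X : Bicomod C D) (v : V) : X.toR ⟶ X.tenR V where
  hom := Ten.mk A V v
  lin := inferInstanceAs (IsLin Bᵐᵒᵖ (Ten.mk A V v))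
  colin x := (X.tenR_rho_tmul v x).symm

/-- The morphism `f ⊗_A X`. -/
def Bicomod.tenRMap (X : Bicomod C D) (f : V →+ W) [IsLin Aᵐᵒᵖ f] : X.tenR V ⟶ X.tenR W where
  hom := map A f (idh X)
  lin := inferInstanceAs (IsLin Bᵐᵒᵖ (map A f (idh X)))
  colin (t : Ten A V X) := by
    change map B (map A f (idh X)) (idh D) ((assoc A V X B D).symm (map A (idh V) X.rho t)) =
      (assoc A W X B D).symm (map A (idh W) X.rho (map A f (idh X) t))
    rw [← Ten.assoc_symm_map, Ten.map_map, Ten.map_map]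
    exact congrArg _ (Ten.map_congr (fun _ => rfl) (fun x => Ten.map_id _) t)

/-- Two morphisms of comodules on `V ⊗_A X` agree if they agree on `v ⊗ x`. -/
theorem Bicomod.tenR_hom_ext {X : Bicomod C D} {P : RComod D} {f g : X.tenR V ⟶ P}
    (h : ∀ (v : V), X.mkR v ≫ f = X.mkR v ≫ g) : f = g :=
  RComod.hom_ext' fun t => DFunLike.congr_fun
    (Ten.hom_ext fun v x => RComod.congr_hom (h v) x : f.hom = g.hom) t

/-- The map `V ⊗_A N → (V ⊗_A C) ⊗_A N` given by the coaction of `N`. -/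
def LComod.coact (V : Type u) [AddCommGroup V] [Module Aᵐᵒᵖ V] (N : LComod C) :
    Ten A V N →+ Ten A (Ten A V C) N :=
  (assoc A V C A N).symm.toAddMonoidHom.comp (map A (idh V) N.lam)

theorem LComod.coact_tmul (N : LComod C) (v : V) (n : N) :
    N.coact V (tmul A v n) = map A (Ten.mk A V v) (idh N) (N.lam n) := by
  change (assoc A V C A N).symm (map A (idh V) N.lam (tmul A v n)) = _
  rw [Ten.map_tmul]
  exact Ten.assoc_symm_tmul' v (N.lam n)

/-- The map `V ⊗_A C → V` given by the counit. -/
def Coring.counitR (C : Coring A) (V : Type u) [AddCommGroup V] [Module Aᵐᵒᵖ V] : Ten A V C →+ V :=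
  (rid V).comp (map A (idh V) C.ε)

theorem Coring.counitR_tmul (v : V) (c : C) : C.counitR V (tmul A v c) = op (C.ε c) • v := by
  simp [Coring.counitR]

instance : IsLin Aᵐᵒᵖ (C.counitR V) where
  smul a t := by
    induction t using Ten.induction with
    | h0 => simp
    | h1 v c =>
      rw [Ten.right_smul_tmul, Coring.counitR_tmul, Coring.counitR_tmul, IsLin.smul (f := C.ε),
        smul_smul]
      rfl
    | h2 s t hs ht => simp only [smul_add, map_add, hs, ht]

theorem Coring.counitR_natural (f : V →+ W) [IsLin Aᵐᵒᵖ f] (t : Ten A V C) :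
    C.counitR W (map A f (idh C) t) = f (C.counitR V t) := by
  induction t using Ten.induction with
  | h0 => simp
  | h1 v c =>
    rw [Ten.map_tmul, Coring.counitR_tmul, Coring.counitR_tmul, IsLin.smul (f := f)]; rfl
  | h2 s t hs ht => simp only [map_add, hs, ht]

theorem RComod.counitR_rho (M : RComod C) (m : M) : C.counitR M (M.rho m) = m := M.counit m

/-- The counit axiom of `N`, tensored with `V`. It provides the retraction that makes `coact`
injective and is the candidate inverse in `LComod.cotFree`. -/
theorem LComod.counitR_coact (N : LComod C) (t : Ten A V N) :
    map A (C.counitR V) (idh N) (N.coact V t) = t := by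
  induction t using Ten.induction with
  | h0 => simp only [map_zero]
  | h2 s t hs ht => simp only [map_add, hs, ht]
  | h1 v n =>
    rw [N.coact_tmul, Ten.map_map]
    conv_rhs => rw [← N.counit n]
    induction N.lam n using Ten.induction with
    | h0 => simp only [map_zero, Ten.tmul_zero]
    | h2 s t hs ht => simp only [map_add, Ten.tmul_add, hs, ht]
    | h1 c n =>
      rw [Ten.map_tmul, Ten.map_tmul, Ten.lid_tmul, AddMonoidHom.comp_apply, Ten.mk_apply,
        Coring.counitR_tmul, Ten.smul_tmul]
      rfl

theorem LComod.coact_injective (V : Type u) [AddCommGroup V] [Module Aᵐᵒᵖ V] (N : LComod C) :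
    Function.Injective (N.coact V) :=
  Function.LeftInverse.injective N.counitR_coact

theorem LComod.coact_natural {N N' : LComod C} (f : V →+ W) [IsLin Aᵐᵒᵖ f] (g : N ⟶ N')
    (t : Ten A V N) :
    N'.coact W (map A f g.hom t) = map A (map A f (idh C)) g.hom (N.coact V t) := by
  change (assoc A W C A N').symm (map A (idh W) N'.lam (map A f g.hom t)) =
    map A (map A f (idh C)) g.hom ((assoc A V C A N).symm (map A (idh V) N.lam t))
  rw [← Ten.assoc_symm_map, Ten.map_map, Ten.map_map]
  exact congrArg _ (Ten.map_congr (fun _ => rfl) (fun n => (g.colin n).symm) t)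

theorem LComod.coact_mem_cot (N : LComod C) (t : Ten A V N) :
    N.coact V t ∈ cot (C.regular.tenR V) N := by
  induction t using Ten.induction with
  | h0 => rw [map_zero]; exact zero_mem _
  | h2 s t hs ht => rw [map_add]; exact add_mem hs ht
  | h1 v n =>
    rw [mem_cot, N.coact_tmul]
    have e1 : map A (C.regular.tenR V).rho (idh N) (map A (Ten.mk A V v) (idh N) (N.lam n)) =
        map A (map A (Ten.mk A V v) (idh C)) (idh N) (map A C.Δ (idh N) (N.lam n)) := by
      rw [Ten.map_map, Ten.map_map]
      exact Ten.map_congr (fun c => C.regular.tenR_rho_tmul v c) (fun _ => rfl) _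
    refine (congrArg _ e1).trans ((Ten.assoc_map _ _ _ _).trans ?_)
    rw [N.coassoc, Ten.map_map, Ten.map_map]
    exact Ten.map_congr (fun _ => rfl) (fun n => Ten.map_id _) _

/-- An element of the cotensor product satisfies `(V ⊗ Δ ⊗ N) t = (V ⊗ C ⊗ λ) t`. Contracting the
first copy of `C` with the counit returns `t` on the left and the coaction of the contracted `t` on
the right. -/
theorem LComod.exists_coact (N : LComod C) {t : Ten A (Ten A V C) N}
    (ht : t ∈ cot (C.regular.tenR V) N) :
    N.coact V (map A (C.counitR V) (idh N) t) = t := by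
  have e := congrArg (map A (C.counitR V) (idh (Ten A C N))) (mem_cot.1 ht)
  rw [Ten.map_map] at e
  have e1 : map A (C.counitR V) (idh (Ten A C N)) (assoc A (Ten A V C) C A N
      (map A (C.regular.tenR V).rho (idh N) t)) = assoc A V C A N t := by
    rw [Ten.map_congr (f' := C.counitR V) (g' := map A (idh C) (idh N)) (fun _ => rfl)
      (fun z => (Ten.map_id z).symm), ← Ten.assoc_map, Ten.map_map]
    congr 1
    refine Ten.map_id' (fun z => ?_) (fun _ => rfl) t
    change map A (C.counitR V) (idh C) ((C.regular.tenR V).rho z) = z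
    induction z using Ten.induction with
    | h0 => simp only [map_zero]
    | h2 s t hs ht => simp only [map_add, hs, ht]
    | h1 v c =>
      rw [Bicomod.tenR_rho_tmul, ← LComod.coact_tmul C.regular.toL v c]
      exact LComod.counitR_coact C.regular.toL _
  rw [e1] at e
  change (assoc A V C A N).symm (map A (idh V) N.lam (map A (C.counitR V) (idh N) t)) = t
  rw [AddEquiv.symm_apply_eq, Ten.map_map]
  exact e.symm

/-- The isomorphism `V ⊗_A N ≃ (V ⊗_A C) □_C N`. -/
noncomputable def LComod.cotFree (V : Type u) [AddCommGroup V] [Module Aᵐᵒᵖ V] (N : LComod C) :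
    Ten A V N ≃+ cot (C.regular.tenR V) N :=
  AddEquiv.ofBijective ((N.coact V).codRestrict (cot (C.regular.tenR V) N) N.coact_mem_cot)
    ⟨fun _ _ h => N.coact_injective V (congrArg Subtype.val h),
      fun t => ⟨_, Subtype.ext (N.exists_coact t.2)⟩⟩

theorem LComod.cotFree_natural {N N' : LComod C} (f : V →+ W) [IsLin Aᵐᵒᵖ f] (g : N ⟶ N')
    (t : Ten A V N) :
    N'.cotFree W (map A f g.hom t) = cotMap (C.regular.tenRMap f) g (N.cotFree V t) :=
  Subtype.ext (N.coact_natural f g t)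

end

theorem LComod.lam_injective (N : LComod C) : Function.Injective N.lam :=
  Function.LeftInverse.injective (g := fun t => lid N (map A C.ε (idh N) t)) N.counit

/-- The isomorphism `N ≃ C □_C N`. -/
noncomputable def LComod.cotUnit (N : LComod C) : N ≃+ cot C.regular.toR N :=
  AddEquiv.ofBijective (N.lam.codRestrict (cot C.regular.toR N) fun n => mem_cot.2 (N.coassoc n))
    ⟨fun _ _ h => N.lam_injective (congrArg Subtype.val h), fun t => ⟨lid N (map A C.ε (idh N) t), by
      apply Subtype.ext
      change N.lam (lid N (map A C.ε (idh N) (t : Ten A C N))) = t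
      -- Surjectivity: contracting the defining equation of `C □_C N` with `ε` in the first factor
      -- recovers `t` as the coaction of an element of `N`.
      have e1 : ∀ z : Ten A C N, N.lam (lid N (map A C.ε (idh N) z)) =
          lid (Ten A C N) (map A C.ε (idh (Ten A C N)) (map A (idh C) N.lam z)) := fun z => by
        induction z using Ten.induction with
        | h0 => simp only [map_zero]
        | h2 s t hs ht => simp only [map_add, hs, ht]
        | h1 c n =>
          simp only [Ten.map_tmul, Ten.lid_tmul]
          exact IsLin.smul (f := N.lam) _ _
      have e2 : ∀ z : Ten A (Ten A C C) N, lid (Ten A C N) (map A C.ε (idh (Ten A C N))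
          (assoc A C C A N z)) =
          map A ((lid C).comp (map A C.ε (idh C))) (idh N) z := fun z => by
        refine DFunLike.congr_fun (f := (lid (Ten A C N)).comp ((map A C.ε (idh (Ten A C N))).comp
          (assoc A C C A N).toAddMonoidHom)) (Ten.hom_ext₃ fun c c' n => ?_) z
        change lid (Ten A C N) (map A C.ε (idh (Ten A C N))
          (assoc A C C A N (tmul A (tmul A c c') n))) = _
        simp only [Ten.assoc_tmul, Ten.map_tmul, Ten.lid_tmul, AddMonoidHom.comp_apply]
        exact Ten.left_smul_tmul _ _ _
      rw [e1, ← cot_coassoc t, e2, Ten.map_map]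
      exact Ten.map_id' C.counit_left (fun _ => rfl) _⟩⟩

theorem LComod.cotUnit_natural {N N' : LComod C} (g : N ⟶ N') (n : N) :
    N'.cotUnit (g.hom n) = cotMap (𝟙 _) g (N.cotUnit n) := Subtype.ext (g.colin n).symm

end Right

/-! ### Cotensor products with cofree left comodules -/

section Left

/-- The coaction of a left comodule, as a morphism `N → C ⊗_A N`. -/
def LComod.lamHom (N : LComod C) : N ⟶ C.regular.tenL N where
  hom := N.lam
  lin := N.lam_left
  colin n := (N.coassoc n).symm

section

variable {V W : Type u} [AddCommGroup V] [Module B V] [AddCommGroup W] [Module B W]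

theorem Bicomod.tenL_lam_tmul (X : Bicomod C D) (v : V) (x : X) :
    (X.tenL V).lam (tmul B x v) = map A (idh C) ((Ten.mk B X (N := V)).flip v) (X.lam x) := by
  change assoc A C X B V (map B X.lam (idh V) (tmul B x v)) = _
  rw [Ten.map_tmul]
  exact Ten.assoc_tmul' (X.lam x) v

/-- The morphism `- ⊗ v : X → X ⊗_B V`. -/
def Bicomod.mkL (X : Bicomod C D) (v : V) : X.toL ⟶ X.tenL V where
  hom := (Ten.mk B X (N := V)).flip v
  lin := inferInstanceAs (IsLin A ((Ten.mk B X (N := V)).flip v))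
  colin x := (X.tenL_lam_tmul v x).symm

/-- The morphism `X ⊗_B f`. -/
def Bicomod.tenLMap (X : Bicomod C D) (f : V →+ W) [IsLin B f] : X.tenL V ⟶ X.tenL W where
  hom := map B (idh X) f
  lin := inferInstanceAs (IsLin A (map B (idh X) f))
  colin (t : Ten B X V) := by
    change map A (idh C) (map B (idh X) f) (assoc A C X B V (map B X.lam (idh V) t)) =
      assoc A C X B W (map B X.lam (idh W) (map B (idh X) f t))
    rw [← Ten.assoc_map, Ten.map_map, Ten.map_map]
    exact congrArg _ (Ten.map_congr (fun x => Ten.map_id _) (fun _ => rfl) t)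

end

section

variable {V W : Type u} [AddCommGroup V] [Module A V] [AddCommGroup W] [Module A W]

/-- The map `M ⊗_A V → M ⊗_A (C ⊗_A V)` given by the coaction of `M`. -/
def RComod.coact (V : Type u) [AddCommGroup V] [Module A V] (M : RComod C) :
    Ten A M V →+ Ten A M (Ten A C V) :=
  (assoc A M C A V).toAddMonoidHom.comp (map A M.rho (idh V))

theorem RComod.coact_tmul (M : RComod C) (m : M) (v : V) :
    M.coact V (tmul A m v) = map A (idh M) ((Ten.mk A C (N := V)).flip v) (M.rho m) := by
  change assoc A M C A V (map A M.rho (idh V) (tmul A m v)) = _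
  rw [Ten.map_tmul]
  exact Ten.assoc_tmul' (M.rho m) v

/-- The map `C ⊗_A V → V` given by the counit. -/
def Coring.counitL (C : Coring A) (V : Type u) [AddCommGroup V] [Module A V] : Ten A C V →+ V :=
  (lid V).comp (map A C.ε (idh V))

theorem Coring.counitL_tmul (c : C) (v : V) : C.counitL V (tmul A c v) = C.ε c • v := by
  simp [Coring.counitL]

instance : IsLin A (C.counitL V) where
  smul a t := by
    induction t using Ten.induction with
    | h0 => simp
    | h1 c v =>
      rw [Ten.left_smul_tmul, Coring.counitL_tmul, Coring.counitL_tmul, IsLin.smul (f := C.ε),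
        smul_smul]
      rfl
    | h2 s t hs ht => simp only [smul_add, map_add, hs, ht]

theorem Coring.counitL_natural (f : V →+ W) [IsLin A f] (t : Ten A C V) :
    C.counitL W (map A (idh C) f t) = f (C.counitL V t) := by
  induction t using Ten.induction with
  | h0 => simp
  | h1 c v =>
    rw [Ten.map_tmul, Coring.counitL_tmul, Coring.counitL_tmul, IsLin.smul (f := f)]; rfl
  | h2 s t hs ht => simp only [map_add, hs, ht]

theorem LComod.counitL_lam (N : LComod C) (n : N) : C.counitL N (N.lam n) = n := N.counit n

theorem RComod.counitL_coact (M : RComod C) (t : Ten A M V) :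
    map A (idh M) (C.counitL V) (M.coact V t) = t := by
  induction t using Ten.induction with
  | h0 => simp only [map_zero]
  | h2 s t hs ht => simp only [map_add, hs, ht]
  | h1 m v =>
    rw [M.coact_tmul, Ten.map_map]
    conv_rhs => rw [← M.counit m]
    induction M.rho m using Ten.induction with
    | h0 => simp only [map_zero, Ten.zero_tmul]
    | h2 s t hs ht => simp only [map_add, Ten.add_tmul, hs, ht]
    | h1 m c =>
      rw [Ten.map_tmul, Ten.map_tmul, Ten.rid_tmul]
      change tmul A m (C.counitL V (tmul A c v)) = tmul A (op (C.ε c) • m) v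
      rw [Coring.counitL_tmul, Ten.smul_tmul]

theorem RComod.coact_injective (V : Type u) [AddCommGroup V] [Module A V] (M : RComod C) :
    Function.Injective (M.coact V) :=
  Function.LeftInverse.injective M.counitL_coact

theorem RComod.coact_natural {M M' : RComod C} (f : M ⟶ M') (g : V →+ W) [IsLin A g]
    (t : Ten A M V) :
    M'.coact W (map A f.hom g t) = map A f.hom (map A (idh C) g) (M.coact V t) := by
  change assoc A M' C A W (map A M'.rho (idh W) (map A f.hom g t)) =
    map A f.hom (map A (idh C) g) (assoc A M C A V (map A M.rho (idh V) t))
  rw [← Ten.assoc_map, Ten.map_map, Ten.map_map]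
  exact congrArg _ (Ten.map_congr (fun n => (f.colin n).symm) (fun _ => rfl) t)

theorem RComod.coact_mem_cot (M : RComod C) (t : Ten A M V) :
    M.coact V t ∈ cot M (C.regular.tenL V) := by
  induction t using Ten.induction with
  | h0 => rw [map_zero]; exact zero_mem _
  | h2 s t hs ht => rw [map_add]; exact add_mem hs ht
  | h1 m v =>
    rw [mem_cot, M.coact_tmul]
    have e1 : map A (idh M) (C.regular.tenL V).lam
        (map A (idh M) ((Ten.mk A C (N := V)).flip v) (M.rho m)) =
        map A (idh M) (map A (idh C) ((Ten.mk A C (N := V)).flip v))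
          (map A (idh M) C.Δ (M.rho m)) := by
      rw [Ten.map_map, Ten.map_map]
      exact Ten.map_congr (fun _ => rfl) (fun c => C.regular.tenL_lam_tmul v c) _
    refine Eq.trans ?_ e1.symm
    rw [← M.coassoc, ← Ten.assoc_map, Ten.map_map, Ten.map_map]
    exact congrArg _ (Ten.map_congr (fun n => (Ten.map_id _).symm) (fun _ => rfl) _)

/-- Mirror argument: here the copy of `C` next to `V` is contracted. -/
theorem RComod.exists_coact (M : RComod C) {t : Ten A M (Ten A C V)}
    (ht : t ∈ cot M (C.regular.tenL V)) :
    M.coact V (map A (idh M) (C.counitL V) t) = t := by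
  have e₀ : map A M.rho (idh (Ten A C V)) t = (assoc A M C A (Ten A C V)).symm
      (map A (idh M) (C.regular.tenL V).lam t) := (AddEquiv.eq_symm_apply _).2
    ((mem_cot (N := C.regular.tenL V)).1 ht)
  have e := congrArg (map A (idh (Ten A M C)) (C.counitL V)) e₀
  rw [Ten.map_map] at e
  have e1 : map A (idh (Ten A M C)) (C.counitL V) ((assoc A M C A (Ten A C V)).symm
      (map A (idh M) (C.regular.tenL V).lam t)) = (assoc A M C A V).symm t := by
    have h : ∀ z : Ten A (Ten A M C) (Ten A C V), map A (idh (Ten A M C)) (C.counitL V) z =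
        map A (map A (idh M) (idh C)) (C.counitL V) z := fun z =>
      Ten.map_congr (fun z => (Ten.map_id z).symm) (fun _ => rfl) z
    refine (h _).trans ((Ten.assoc_symm_map _ _ _ _).symm.trans (congrArg _ ?_))
    refine (Ten.map_map _ _ _ _ t).trans (Ten.map_id' (fun _ => rfl) (fun z => ?_) t)
    change map A (idh C) (C.counitL V) ((C.regular.tenL V).lam z) = z
    induction z using Ten.induction with
    | h0 => simp only [map_zero]
    | h2 s t hs ht => simp only [map_add, hs, ht]
    | h1 c v =>
      rw [Bicomod.tenL_lam_tmul, ← RComod.coact_tmul C.regular.toR c v]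
      exact RComod.counitL_coact C.regular.toR _
  rw [e1] at e
  change assoc A M C A V (map A M.rho (idh V) (map A (idh M) (C.counitL V) t)) = t
  rw [← AddEquiv.eq_symm_apply, Ten.map_map]
  exact e

/-- The isomorphism `M ⊗_A V ≃ M □_C (C ⊗_A V)`. -/
noncomputable def RComod.cotFree (V : Type u) [AddCommGroup V] [Module A V] (M : RComod C) :
    Ten A M V ≃+ cot M (C.regular.tenL V) :=
  AddEquiv.ofBijective ((M.coact V).codRestrict (cot M (C.regular.tenL V)) M.coact_mem_cot)
    ⟨fun _ _ h => M.coact_injective V (congrArg Subtype.val h),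
      fun t => ⟨_, Subtype.ext (M.exists_coact t.2)⟩⟩

theorem RComod.cotFree_natural {M M' : RComod C} (f : M ⟶ M') (g : V →+ W) [IsLin A g]
    (t : Ten A M V) :
    M'.cotFree W (map A f.hom g t) = cotMap f (C.regular.tenLMap g) (M.cotFree V t) :=
  Subtype.ext (M.coact_natural f g t)

end

theorem RComod.rho_injective (M : RComod C) : Function.Injective M.rho :=
  Function.LeftInverse.injective (g := fun t => rid M (map A (idh M) C.ε t)) M.counit

/-- The isomorphism `M ≃ M □_C C`. -/
noncomputable def RComod.cotUnit (M : RComod C) : M ≃+ cot M C.regular.toL :=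
  AddEquiv.ofBijective (M.rho.codRestrict (cot M C.regular.toL) fun m => mem_cot.2 (M.coassoc m))
    ⟨fun _ _ h => M.rho_injective (congrArg Subtype.val h), fun t => ⟨rid M (map A (idh M) C.ε t), by
      apply Subtype.ext
      change M.rho (rid M (map A (idh M) C.ε (t : Ten A M C))) = t
      have e1 : ∀ z : Ten A M C, M.rho (rid M (map A (idh M) C.ε z)) =
          rid (Ten A M C) (map A (idh (Ten A M C)) C.ε (map A M.rho (idh C) z)) := fun z => by
        induction z using Ten.induction with
        | h0 => simp only [map_zero]
        | h2 s t hs ht => simp only [map_add, hs, ht]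
        | h1 m c =>
          simp only [Ten.map_tmul, Ten.rid_tmul]
          exact IsLin.smul (f := M.rho) _ _
      have e2 : ∀ z : Ten A (Ten A M C) C, rid (Ten A M C) (map A (idh (Ten A M C)) C.ε z) =
          map A (idh M) ((rid C).comp (map A (idh C) C.ε)) (assoc A M C A C z) := fun z => by
        refine DFunLike.congr_fun (f := (rid (Ten A M C)).comp (map A (idh (Ten A M C)) C.ε))
          (g := (map A (idh M) ((rid C).comp (map A (idh C) C.ε))).comp
          (assoc A M C A C).toAddMonoidHom) (Ten.hom_ext₃ fun m c c' => ?_) z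
        change _ = map A (idh M) ((rid C).comp (map A (idh C) C.ε))
          (assoc A M C A C (tmul A (tmul A m c) c'))
        simp only [Ten.assoc_tmul, Ten.map_tmul, Ten.rid_tmul, AddMonoidHom.comp_apply]
        exact Ten.right_smul_tmul _ _ _
      rw [e1, e2, cot_coassoc t, Ten.map_map]
      exact Ten.map_id' (fun _ => rfl) C.counit_right _⟩⟩

theorem RComod.cotUnit_natural {M M' : RComod C} (g : M ⟶ M') (m : M) :
    M'.cotUnit (g.hom m) = cotMap g (𝟙 _) (M.cotUnit m) := Subtype.ext (g.colin m).symm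

end Left

end Corings

namespace Corings
open Corings.Ten (map lid rid assoc tmul)

variable {A B : Type u} [Ring A] [Ring B] {C : Coring A} {D : Coring B}

/-! ## Cotensor products as comodules -/

section cotRι

variable (hD : FlatLeft B D)

/-- The inclusion `M □_C X → M ⊗_A X`. -/
noncomputable def cotRι (M : RComod C) (X : Bicomod C D) : cotRComod hD M X ⟶ X.tenR M :=
  RComod.subι hD (X.tenR M) (cotR M X) (cotR_coaction hD M X)

theorem cotRι_injective (M : RComod C) (X : Bicomod C D) :
    Function.Injective (cotRι hD M X).hom := RComod.subι_injective _ _ _ _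

theorem mem_range_cotRι {M : RComod C} {X : Bicomod C D} {t : Ten A M X} :
    (∃ k, (cotRι hD M X).hom k = t) ↔ t ∈ cot M X.toL :=
  RComod.mem_range_subι hD (X.tenR M) (cotR M X) (cotR_coaction hD M X)

theorem cotRι_mem {M : RComod C} {X : Bicomod C D} (k : cotRComod hD M X) :
    (cotRι hD M X).hom k ∈ cot M X.toL := (mem_range_cotRι hD).1 ⟨k, rfl⟩

/-- A morphism into `M □_C X` given by a morphism into `M ⊗_A X`. -/
noncomputable def cotRLift {M : RComod C} {X : Bicomod C D} {P : RComod D} (f : P ⟶ X.tenR M)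
    (hf : ∀ p, f.hom p ∈ cot M X.toL) : P ⟶ cotRComod hD M X :=
  RComod.subLift hD (X.tenR M) (cotR M X) (cotR_coaction hD M X) f hf

/-- The inclusion `M □_C X → M ⊗_A X`, as an additive map. -/
noncomputable def cotRInc (M : RComod C) (X : Bicomod C D) : cotRComod hD M X →+ Ten A M X :=
  (cotRι hD M X).hom

instance (M : RComod C) (X : Bicomod C D) : IsLin Bᵐᵒᵖ (cotRInc hD M X) := (cotRι hD M X).lin

end cotRι

section cotLι

variable (hC : FlatRight A C)

/-- The inclusion `X □_D N → X ⊗_B N`. -/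
noncomputable def cotLι (X : Bicomod C D) (N : LComod D) : cotLComod hC X N ⟶ X.tenL N :=
  LComod.subι hC (X.tenL N) (cotL X N) (cotL_coaction hC X N)

theorem cotLι_injective (X : Bicomod C D) (N : LComod D) :
    Function.Injective (cotLι hC X N).hom := LComod.subι_injective _ _ _ _

theorem mem_range_cotLι {X : Bicomod C D} {N : LComod D} {t : Ten B X N} :
    (∃ k, (cotLι hC X N).hom k = t) ↔ t ∈ cot X.toR N :=
  LComod.mem_range_subι hC (X.tenL N) (cotL X N) (cotL_coaction hC X N)

theorem cotLι_mem {X : Bicomod C D} {N : LComod D} (k : cotLComod hC X N) :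
    (cotLι hC X N).hom k ∈ cot X.toR N := (mem_range_cotLι hC).1 ⟨k, rfl⟩

/-- A morphism into `X □_D N` given by a morphism into `X ⊗_B N`. -/
noncomputable def cotLLift {X : Bicomod C D} {N : LComod D} {P : LComod C} (f : P ⟶ X.tenL N)
    (hf : ∀ p, f.hom p ∈ cot X.toR N) : P ⟶ cotLComod hC X N :=
  LComod.subLift hC (X.tenL N) (cotL X N) (cotL_coaction hC X N) f hf

/-- The inclusion `X □_D N → X ⊗_B N`, as an additive map. -/
noncomputable def cotLInc (X : Bicomod C D) (N : LComod D) : cotLComod hC X N →+ Ten B X N :=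
  (cotLι hC X N).hom

instance (X : Bicomod C D) (N : LComod D) : IsLin A (cotLInc hC X N) := (cotLι hC X N).lin

end cotLι

/-! ## Associativity of the cotensor product -/

/-- The coaction of `X ⊗_B V` only involves `X`, so its `ω` is that of `X` tensored with `V`. The
content is bookkeeping with the pentagon, and it reduces questions about `M □_C (X ⊗_B V)` to
whether `- ⊗_B V` preserves the kernel `M □_C X`. -/
theorem omega_tenL (M : RComod C) (X : Bicomod C D) (V : Type u) [AddCommGroup V] [Module B V]
    (t : Ten B (Ten A M X) V) : omega M (X.tenL V) (assoc A M X B V t) =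
      map A (idh M) (assoc A C X B V).toAddMonoidHom
        (assoc A M (Ten A C X) B V (map B (omegaR M X) (idh V) t)) := by
  rw [map_sub_left (omegaR M X) ((assoc A M C A X).toAddMonoidHom.comp (map A M.rho (idh X)))
    (map A (idh M) X.lam) (idh V) (fun _ => rfl), map_sub, map_sub]
  refine congrArg₂ (fun x y : Ten A M (Ten A C (Ten B X V)) => x - y) ?_ ?_
  · have e₁ : map A M.rho (idh (Ten B X V)) (assoc A M X B V t) =
        assoc A (Ten A M C) X B V (map B (map A M.rho (idh X)) (idh V) t) :=
      (Ten.map_congr (fun _ => rfl) (fun z => (Ten.map_id z).symm) _).trans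
        (Ten.assoc_map _ _ _ _).symm
    have e₂ := Ten.pentagon (map B (map A M.rho (idh X)) (idh V) t)
    refine (congrArg (assoc A M C A (Ten B X V)) e₁).trans (e₂.symm.trans ?_)
    exact congrArg _ (congrArg _ (Ten.map_map _ _ _ _ _))
  · rw [Ten.assoc_map, Ten.map_map]
    exact Ten.map_congr (fun _ => rfl) (fun _ => rfl) _

theorem omega_tenR (V : Type u) [AddCommGroup V] [Module Aᵐᵒᵖ V] (X : Bicomod C D) (N : LComod D)
    (t : Ten B (Ten A V X) N) : map A (idh V) (omegaL X N) (assoc A V X B N t) =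
      assoc A V X B (Ten B D N) (omega (X.tenR V) N t) := by
  rw [map_sub_right (idh V) (omegaL X N)
    ((assoc B X D B N).toAddMonoidHom.comp (map B X.rho (idh N)))
    (map B (idh X) N.lam) (fun _ => rfl)]
  refine Eq.trans (congrArg₂ (· - ·) ?_ ?_) (map_sub (assoc A V X B (Ten B D N)) _ _).symm
  · have e₂ := Ten.pentagon (map B (X.tenR V).rho (idh N) t)
    refine Eq.trans ?_ e₂
    have e₃ : map B (assoc A V X B D).toAddMonoidHom (idh N) (map B (X.tenR V).rho (idh N) t) =
        map B (map A (idh V) X.rho) (idh N) t :=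
      (Ten.map_map _ _ _ _ _).trans
        (Ten.map_congr (fun z => (assoc A V X B D).apply_symm_apply _) (fun _ => rfl) _)
    rw [e₃, Ten.assoc_map, Ten.map_map]
    exact Ten.map_congr (fun _ => rfl) (fun _ => rfl) _
  · refine (Ten.assoc_map _ _ _ _).symm.trans (congrArg _ ?_)
    exact Ten.map_congr (fun z => Ten.map_id z) (fun _ => rfl) _

/-- By `omega_tenL` the two conditions differ only by associativity isomorphisms. -/
theorem omegaR_injective_aux (M : RComod C) (X : Bicomod C D) (V : Type u) [AddCommGroup V]
    [Module B V] {t : Ten B (Ten A M X) V} :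
    assoc A M X B V t ∈ cot M (X.tenL V) ↔ map B (omegaR M X) (idh V) t = 0 := by
  change omega M (X.tenL V) (assoc A M X B V t) = 0 ↔ _
  rw [omega_tenL]
  refine ⟨fun h => ?_, fun h => by rw [h, map_zero, map_zero]⟩
  have h' := congrArg (map A (idh M) (assoc A C X B V).symm.toAddMonoidHom) h
  rw [map_zero, Ten.map_map] at h'
  apply (assoc A M (Ten A C X) B V).injective
  rw [map_zero, ← h']
  exact (Ten.map_id' (fun _ => rfl) (fun z => (assoc A C X B V).symm_apply_apply z) _).symm

theorem omegaL_injective_aux (V : Type u) [AddCommGroup V] [Module Aᵐᵒᵖ V] (X : Bicomod C D)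
    (N : LComod D) {t : Ten B (Ten A V X) N} :
    t ∈ cot (X.tenR V) N ↔ map A (idh V) (omegaL X N) (assoc A V X B N t) = 0 := by
  rw [omega_tenR, map_eq_zero_iff _ (assoc A V X B (Ten B D N)).injective]
  rfl

section assoc

variable (hC : FlatRight A C) (hD : FlatLeft B D)

/-- `V ⊗_A -` preserves the kernel `X □_D N` of `ω`. -/
structure PureL (V : Type u) [AddCommGroup V] [Module Aᵐᵒᵖ V] (X : Bicomod C D) (N : LComod D) :
    Prop where
  inj : Function.Injective (map A (idh V) (cotLInc hC X N))
  exact : ∀ t : Ten A V (Ten B X N), map A (idh V) (omegaL X N) t = 0 →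
    ∃ s, map A (idh V) (cotLInc hC X N) s = t

/-- `- ⊗_B V` preserves the kernel `M □_C X` of `ω`. -/
structure PureR (M : RComod C) (X : Bicomod C D) (V : Type u) [AddCommGroup V] [Module B V] :
    Prop where
  inj : Function.Injective (map B (cotRInc hD M X) (idh V))
  exact : ∀ t : Ten B (Ten A M X) V, map B (omegaR M X) (idh V) t = 0 →
    ∃ s, map B (cotRInc hD M X) (idh V) s = t

theorem FlatRight.pureL {V : Type u} [AddCommGroup V] [Module Aᵐᵒᵖ V] (hV : FlatRight A V)
    (X : Bicomod C D) (N : LComod D) : PureL hC V X N where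
  inj := hV _ _ (cotLInc hC X N) (cotLι_injective hC X N)
  exact t ht := hV.exact (omegaL X N) (cotL X N) (fun _ h => h) t ht

theorem FlatLeft.pureR {V : Type u} [AddCommGroup V] [Module B V] (hV : FlatLeft B V)
    (M : RComod C) (X : Bicomod C D) : PureR hD M X V where
  inj := hV _ _ (cotRInc hD M X) (cotRι_injective hD M X)
  exact t ht := hV.exact (omegaR M X) (cotR M X) (fun _ h => h) t ht

/-- The embedding of `(M □_C X) □_D N` into `M ⊗_A (X ⊗_B N)`. -/
noncomputable def cotEmbR (M : RComod C) (X : Bicomod C D) (N : LComod D) :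
    cot (cotRComod hD M X) N →+ Ten A M (Ten B X N) :=
  ((assoc A M X B N).toAddMonoidHom.comp (map B (cotRInc hD M X) (idh N))).comp
    (cot (cotRComod hD M X) N).subtype

/-- The embedding of `M □_C (X □_D N)` into `M ⊗_A (X ⊗_B N)`. -/
noncomputable def cotEmbL (M : RComod C) (X : Bicomod C D) (N : LComod D) :
    cot M (cotLComod hC X N) →+ Ten A M (Ten B X N) :=
  (map A (idh M) (cotLInc hC X N)).comp (cot M (cotLComod hC X N)).subtype

/-- Both `(M □_C X) □_D N` and `M □_C (X □_D N)` are, canonically, the same subgroup of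
`M ⊗_A (X ⊗_B N)`. -/
structure AssocAt (M : RComod C) (X : Bicomod C D) (N : LComod D) : Prop where
  injR : Function.Injective (cotEmbR hD M X N)
  injL : Function.Injective (cotEmbL hC M X N)
  range_eq : ∀ t, (∃ s, cotEmbR hD M X N s = t) ↔ ∃ s, cotEmbL hC M X N s = t

/-- Purity makes `M ⊗_A (X □_D N)` the kernel of `M ⊗ ω`. The remaining equation can be tested in `M
⊗ C ⊗ X ⊗ N`, because `h₂` says that the comparison map is injective there. The same pair of
conditions describes the other iterated product in `cotEmbR_range`. -/
theorem cotEmbL_range (M : RComod C) (X : Bicomod C D) (N : LComod D)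
    (h₁ : PureL hC M X N)
    (h₂ : Function.Injective (map A (idh M) (map A (idh C) (cotLInc hC X N))))
    (t : Ten A M (Ten B X N)) : (∃ s, cotEmbL hC M X N s = t) ↔
      t ∈ cot M (X.tenL N) ∧ map A (idh M) (omegaL X N) t = 0 := by
  constructor
  · rintro ⟨s, rfl⟩
    refine ⟨(cotMap (𝟙 M) (cotLι hC X N) s).2, ?_⟩
    refine (Ten.map_map _ _ _ _ _).trans (Ten.map_zero_right (fun k => ?_) _)
    exact cotLι_mem hC k
  · rintro ⟨h, h'⟩
    obtain ⟨s, rfl⟩ := h₁.exact t h'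
    refine ⟨⟨s, h₂ ?_⟩, rfl⟩
    rw [map_zero]
    exact (omega_natural (𝟙 M) (cotLι hC X N) s).symm.trans h

theorem cotEmbR_range (M : RComod C) (X : Bicomod C D) (N : LComod D)
    (h₁ : PureR hD M X N)
    (h₂ : Function.Injective (map B (cotRInc hD M X) (idh (Ten B D N))))
    (t : Ten A M (Ten B X N)) : (∃ s, cotEmbR hD M X N s = t) ↔
      t ∈ cot M (X.tenL N) ∧ map A (idh M) (omegaL X N) t = 0 := by
  obtain ⟨t, rfl⟩ := (assoc A M X B N).surjective t
  -- The two conditions exchange roles: the first now says that `t` comes from `(M □_C X) ⊗_B N`,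
  -- the second that it satisfies the cotensor equation over `D`.
  rw [omegaR_injective_aux, ← omegaL_injective_aux]
  constructor
  · rintro ⟨s, hs⟩
    have hs' : map B (cotRInc hD M X) (idh N) s = t := (assoc A M X B N).injective hs
    subst hs'
    refine ⟨?_, (cotMap (cotRι hD M X) (𝟙 N) s).2⟩
    refine (Ten.map_map _ _ _ _ _).trans (Ten.map_zero_left (fun k => ?_) _)
    exact cotRι_mem hD k
  · rintro ⟨h', h⟩
    obtain ⟨s, rfl⟩ := h₁.exact t h'
    refine ⟨⟨s, h₂ ?_⟩, rfl⟩
    rw [map_zero]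
    refine Eq.trans ?_ ((omega_natural (cotRι hD M X) (𝟙 N) s).symm.trans h)
    exact Ten.map_congr (fun _ => rfl) (fun z => (Ten.map_id z).symm) _

/-- Both images equal the set of elements satisfying both cotensor equations. The purity assumptions
with an extra factor `C` or `D` are needed only for injectivity of the target of `ω`. -/
theorem AssocAt.of_pure {M : RComod C} {X : Bicomod C D} {N : LComod D}
    (h₁ : PureL hC M X N) (h₂ : PureL hC (Ten A M C) X N) (h₃ : PureR hD M X N)
    (h₄ : PureR hD M X (Ten B D N)) : AssocAt hC hD M X N where
  injR _ _ h := Subtype.ext (h₃.inj ((assoc A M X B N).injective h))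
  injL _ _ h := Subtype.ext (h₁.inj h)
  range_eq t := by
    refine (cotEmbR_range hD M X N h₃ h₄.inj t).trans
      (cotEmbL_range hC M X N h₁ (fun x y h => ?_) t).symm
    apply (assoc A M C A (cotLComod hC X N)).symm.injective
    apply h₂.inj
    have e : ∀ z : Ten A M (Ten A C (cotLComod hC X N)),
        map A (idh (Ten A M C)) (cotLInc hC X N) ((assoc A M C A _).symm z) =
        (assoc A M C A _).symm (map A (idh M) (map A (idh C) (cotLInc hC X N)) z) := fun z =>
      (Ten.map_congr (fun z => (Ten.map_id z).symm) (fun _ => rfl) _).trans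
        (Ten.assoc_symm_map _ _ _ _).symm
    rw [e, e, h]

variable {hC hD}

/-- The associativity isomorphism `(M □_C X) □_D N ≃ M □_C (X □_D N)`. -/
noncomputable def AssocAt.equiv {M : RComod C} {X : Bicomod C D} {N : LComod D}
    (h : AssocAt hC hD M X N) :
    cot (cotRComod hD M X) N ≃+ cot M (cotLComod hC X N) :=
  let r : cot (cotRComod hD M X) N →+ cot M (cotLComod hC X N) :=
    AddMonoidHom.mk' (fun t => ((h.range_eq _).1 ⟨t, rfl⟩).choose) (fun s t => by
      apply h.injL
      rw [map_add (cotEmbL hC M X N), ((h.range_eq _).1 ⟨s + t, rfl⟩).choose_spec,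
        ((h.range_eq _).1 ⟨s, rfl⟩).choose_spec, ((h.range_eq _).1 ⟨t, rfl⟩).choose_spec, map_add])
  have hr : ∀ t, cotEmbL hC M X N (r t) = cotEmbR hD M X N t := fun t =>
    ((h.range_eq _).1 ⟨t, rfl⟩).choose_spec
  AddEquiv.ofBijective r ⟨fun s t e => h.injR (by rw [← hr, ← hr, e]), fun t => by
    obtain ⟨s, hs⟩ := (h.range_eq _).2 ⟨t, rfl⟩
    exact ⟨s, h.injL (by rw [hr, hs])⟩⟩

theorem AssocAt.equiv_spec {M : RComod C} {X : Bicomod C D} {N : LComod D}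
    (h : AssocAt hC hD M X N) (t : cot (cotRComod hD M X) N) :
    cotEmbL hC M X N (h.equiv t) = cotEmbR hD M X N t :=
  ((h.range_eq _).1 ⟨t, rfl⟩).choose_spec

/-- The isomorphism is characterised by compatibility with the two embeddings, and these are natural
because all maps are restrictions of `f ⊗ (X ⊗ g)`. -/
theorem AssocAt.equiv_natural {M M' : RComod C} {X : Bicomod C D} {N N' : LComod D}
    (h : AssocAt hC hD M X N) (h' : AssocAt hC hD M' X N') (f : M ⟶ M') (g : N ⟶ N')
    (t : cot (cotRComod hD M X) N) :
    h'.equiv (cotMap (cotRMap hD f X) g t) = cotMap f (cotLMap hC X g) (h.equiv t) := by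
  apply h'.injL
  have e₁ : ∀ s, cotEmbL hC M' X N' (cotMap f (cotLMap hC X g) s) =
      map A f.hom (map B (idh X) g.hom) (cotEmbL hC M X N s) := fun s =>
    (Ten.map_map f.hom (cotLMap hC X g).hom (idh M') (cotLInc hC X N') _).trans
      ((Ten.map_congr (fun _ => rfl) (fun _ => rfl) _).trans
      (Ten.map_map (idh M) (cotLInc hC X N) f.hom (map B (idh X) g.hom) _).symm)
  have e₂ : ∀ s, cotEmbR hD M' X N' (cotMap (cotRMap hD f X) g s) =
      map A f.hom (map B (idh X) g.hom) (cotEmbR hD M X N s) := fun s => by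
    obtain ⟨z, -⟩ := s
    change assoc A M' X B N' (map B (cotRInc hD M' X) (idh N')
      (map B (cotRMap hD f X).hom g.hom z)) = map A f.hom (map B (idh X) g.hom)
      (assoc A M X B N (map B (cotRInc hD M X) (idh N) z))
    rw [← Ten.assoc_map, Ten.map_map, Ten.map_map]
    exact congrArg _ (Ten.map_congr (fun _ => rfl) (fun _ => rfl) z)
  rw [h'.equiv_spec, e₁, e₂, h.equiv_spec]

end assoc

end Corings

namespace Corings
open Corings.Ten (map lid rid assoc tmul)

variable {A B : Type u} [Ring A] [Ring B] {C : Coring A} {D : Coring B}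

/-! ## Coflat comodules -/

section Right

theorem RComod.IsCoflat.exists_lift {M : RComod C} (hM : M.IsCoflat) (hC : FlatRight A C)
    {N N' : LComod C} (g : N ⟶ N') (hg : Function.Surjective g.hom) :
    Function.Surjective (cotMap (𝟙 M) g) := by
  obtain ⟨K, ι, h, hι, -⟩ := LComod.exists_kernel hC g
  exact (hM K N N' ι g h hι hg).2.2

theorem RComod.IsCoflat.exists_ker {M : RComod C} (hM : M.IsCoflat)
    {K N N' : LComod C} (ι : K ⟶ N) (g : N ⟶ N') (hι : Function.Injective ι.hom)
    (h : Function.Exact ι.hom g.hom) (hg : Function.Surjective g.hom) {t : cot M N}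
    (ht : cotMap (𝟙 M) g t = 0) : ∃ s, cotMap (𝟙 M) ι s = t :=
  ((hM K N N' ι g hι h hg).2.1 t).1 ht

theorem RComod.isCoflat_of_equiv {M : RComod C} {T : LComod C → Type u}
    [∀ N, AddCommGroup (T N)] (Tm : ∀ {N N' : LComod C}, (N ⟶ N') → (T N →+ T N'))
    (e : ∀ N, T N ≃+ cot M N)
    (he : ∀ {N N' : LComod C} (g : N ⟶ N') t, e N' (Tm g t) = cotMap (𝟙 M) g (e N t))
    (h : ∀ (N₁ N₂ N₃ : LComod C) (f : N₁ ⟶ N₂) (g : N₂ ⟶ N₃), Function.Injective f.hom →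
      Function.Exact f.hom g.hom → Function.Surjective g.hom →
      Function.Injective (Tm f) ∧ Function.Exact (Tm f) (Tm g) ∧ Function.Surjective (Tm g)) :
    M.IsCoflat := by
  intro N₁ N₂ N₃ f g hf hfg hg
  obtain ⟨h₁, h₂, h₃⟩ := h N₁ N₂ N₃ f g hf hfg hg
  refine ⟨fun x y hxy => ?_, fun t => ⟨fun ht => ?_, ?_⟩, fun t => ?_⟩
  · obtain ⟨x, rfl⟩ := (e _).surjective x
    obtain ⟨y, rfl⟩ := (e _).surjective y
    rw [← he, ← he] at hxy
    rw [h₁ ((e _).injective hxy)]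
  · obtain ⟨t, rfl⟩ := (e _).surjective t
    rw [← he, map_eq_zero_iff _ (e _).injective] at ht
    obtain ⟨s, rfl⟩ := (h₂ t).1 ht
    exact ⟨e _ s, (he f s).symm⟩
  · rintro ⟨s, rfl⟩
    obtain ⟨s, rfl⟩ := (e _).surjective s
    rw [← he, ← he, (h₂ _).2 ⟨s, rfl⟩, map_zero]
  · obtain ⟨t, rfl⟩ := (e _).surjective t
    obtain ⟨s, rfl⟩ := h₃ t
    exact ⟨e _ s, (he g s).symm⟩

/-- `C □_C -` is naturally the functor forgetting the coaction. -/
theorem Coring.isCoflat_toR (C : Coring A) : C.regular.toR.IsCoflat :=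
  RComod.isCoflat_of_equiv (T := fun N => N) (fun g => g.hom) (fun N => N.cotUnit)
    (fun g n => LComod.cotUnit_natural g n) (fun _ _ _ _ _ h₁ h₂ h₃ => ⟨h₁, h₂, h₃⟩)

theorem LComod.cotFree_natural_right {V : Type u} [AddCommGroup V] [Module Aᵐᵒᵖ V]
    {N N' : LComod C} (g : N ⟶ N') (t : Ten A V N) :
    N'.cotFree V (map A (idh V) g.hom t) = cotMap (𝟙 _) g (N.cotFree V t) := by
  refine (LComod.cotFree_natural (idh V) g t).trans (Subtype.ext ?_)
  have h : ∀ z : Ten A (Ten A V C) N, map A (map A (idh V) (idh C)) g.hom z =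
    map A (idh _) g.hom z := fun z => Ten.map_congr (fun z => Ten.map_id z) (fun _ => rfl) z
  exact h _

theorem RComod.cotFree_natural_left {V : Type u} [AddCommGroup V] [Module A V]
    {M M' : RComod C} (g : M ⟶ M') (t : Ten A M V) :
    M'.cotFree V (map A g.hom (idh V) t) = cotMap g (𝟙 _) (M.cotFree V t) := by
  refine (RComod.cotFree_natural g (idh V) t).trans (Subtype.ext ?_)
  have h : ∀ z : Ten A M (Ten A C V), map A g.hom (map A (idh C) (idh V)) z =
    map A g.hom (idh _) z := fun z => Ten.map_congr (fun _ => rfl) (fun z => Ten.map_id z) z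
  exact h _

/-- Since `(V ⊗_A C) □_C N ≅ V ⊗_A N`, coflatness of the cofree comodule reduces to exactness of `V
⊗_A -`. -/
theorem FlatRight.isCoflat_tenR {V : Type u} [AddCommGroup V] [Module Aᵐᵒᵖ V]
    (hV : FlatRight A V) : (C.regular.tenR V).IsCoflat := by
  refine RComod.isCoflat_of_equiv (T := fun N => Ten A V N) (fun g => map A (idh V) g.hom)
    (fun N => N.cotFree V) (fun g n => LComod.cotFree_natural_right g n)
    (fun N₁ N₂ N₃ f g h₁ h₂ h₃ => ⟨hV _ _ f.hom h₁, fun t => ⟨fun ht => ?_, ?_⟩,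
      Ten.map_surjective _ _ Function.surjective_id h₃⟩)
  · exact Ten.map_exact_right f.hom g.hom h₃ (fun m hm => (h₂ m).1 hm) t ht
  · rintro ⟨s, rfl⟩
    rw [Ten.map_map]
    exact Ten.map_zero_right (fun n => h₂.apply_apply_eq_zero n) s

/-- `M ⊗_A -` is the composite of `C ⊗_A -`, which preserves injections as `C_A` is flat, with `M
□_C -`. -/
theorem RComod.IsCoflat.flatRight {M : RComod C} (hM : M.IsCoflat) (hC : FlatRight A C) :
    FlatRight A M := by
  intro N N' _ _ _ _ f _ hf
  refine (injective_iff_map_eq_zero _).2 fun t ht => ?_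
  -- Coflatness speaks of short exact sequences only, so the injection is completed by its cokernel.
  obtain ⟨Q, π, hπ, h⟩ := LComod.exists_cokernel (C.regular.tenLMap f)
  have hinj := (hM _ _ _ (C.regular.tenLMap f) π (hC _ _ f hf) h hπ).1
  have e := RComod.cotFree_natural (𝟙 M) f t
  rw [show map A (𝟙 M : M ⟶ M).hom f t = 0 from ht, map_zero] at e
  have := hinj (e.symm.trans (map_zero _).symm)
  exact (M.cotFree N).injective (this.trans (map_zero _).symm)

/-! ### Coflatness implies purity and associativity -/

section pure

variable (hD : FlatLeft B D) (M : RComod C) (X : Bicomod C D)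

/-- The canonical map `(M □_C X) ⊗_B V → M □_C (X ⊗_B V)`. -/
noncomputable def cotTenR (V : Type u) [AddCommGroup V] [Module B V] :
    Ten B (cotRComod hD M X) V →+ cot M (X.tenL V) :=
  ((assoc A M X B V).toAddMonoidHom.comp (map B (cotRInc hD M X) (idh V))).codRestrict _
    fun z => (omegaR_injective_aux M X V).2 ((Ten.map_map _ _ _ _ _).trans
      (Ten.map_zero_left (fun k => by exact cotRι_mem hD k) _))

theorem cotTenR_coe {V : Type u} [AddCommGroup V] [Module B V]
    (z : Ten B (cotRComod hD M X) V) : (cotTenR hD M X V z : Ten A M (Ten B X V)) =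
      assoc A M X B V (map B (cotRInc hD M X) (idh V) z) := rfl

theorem cotTenR_natural {V W : Type u} [AddCommGroup V] [Module B V] [AddCommGroup W] [Module B W]
    (f : V →+ W) [IsLin B f] (z : Ten B (cotRComod hD M X) V) :
    cotTenR hD M X W (map B (idh _) f z) = cotMap (𝟙 M) (X.tenLMap f) (cotTenR hD M X V z) := by
  apply Subtype.ext
  refine (cotTenR_coe _ _ _ _).trans ?_
  change _ = map A (idh M) (map B (idh X) f) (assoc A M X B V (map B (cotRInc hD M X) (idh V) z))
  rw [← Ten.assoc_map, Ten.map_map, Ten.map_map]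
  exact congrArg _ (Ten.map_congr (fun m => (Ten.map_id _).symm) (fun _ => rfl) z)

variable {M}

/-- Free modules are flat, so tensoring with them preserves the kernel that defines `M □_C X`. -/
theorem cotTenR_bijective_finsupp (S : Type u) :
    Function.Bijective (cotTenR hD M X (S →₀ B)) := by
  have h := FlatLeft.pureR hD (flatLeft_finsupp (A := B) S) M X
  refine ⟨fun x y e => h.inj ((assoc A M X B _).injective ?_), ?_⟩
  · rw [← cotTenR_coe, ← cotTenR_coe, e]
  rintro ⟨t, ht⟩
  obtain ⟨t, rfl⟩ := (assoc A M X B (S →₀ B)).surjective t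
  obtain ⟨s, hs⟩ := h.exact t ((omegaR_injective_aux M X _).1 ht)
  refine ⟨s, Subtype.ext ?_⟩
  rw [cotTenR_coe, hs]

theorem exists_finsupp_surjective (V : Type u) [AddCommGroup V] [Module B V] :
    ∃ p : (V →₀ B) →ₗ[B] V, Function.Surjective p :=
  ⟨Finsupp.linearCombination B id, fun v => ⟨Finsupp.single v 1, by simp⟩⟩

/-- An element is lifted along a free cover of `V`, using that `M □_C -` preserves surjections, and
the free case applies. This and `cotTenR_injective` form the usual argument that a natural map
between right exact functors is invertible once it is so on free modules. -/
theorem cotTenR_surjective (hC : FlatRight A C) (hM : M.IsCoflat) (V : Type u) [AddCommGroup V]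
    [Module B V] : Function.Surjective (cotTenR hD M X V) := fun t => by
  obtain ⟨p, hp⟩ := exists_finsupp_surjective (B := B) V
  obtain ⟨t, rfl⟩ := hM.exists_lift hC (X.tenLMap p.toAddMonoidHom)
    (Ten.map_surjective (idh X) p.toAddMonoidHom Function.surjective_id hp) t
  obtain ⟨s, rfl⟩ := (cotTenR_bijective_finsupp hD X V).2 t
  exact ⟨_, cotTenR_natural hD M X p.toAddMonoidHom s⟩

/-- `M □_C (X ⊗_B -)` is right exact, although `X ⊗_B k` need not be injective: it factors through a
surjection onto the kernel of `X ⊗_B p`, and both that surjection and the resulting short exact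
sequence survive `M □_C -`. -/
theorem RComod.IsCoflat.exact_tenL (hM : M.IsCoflat) (hC : FlatRight A C) {U V W : Type u}
    [AddCommGroup U] [AddCommGroup V] [AddCommGroup W] [Module B U] [Module B V] [Module B W]
    (k : U →+ V) (p : V →+ W) [IsLin B k] [IsLin B p] (hp : Function.Surjective p)
    (hk : ∀ x, p (k x) = 0) (hpk : ∀ v, p v = 0 → ∃ x, k x = v) {t : cot M (X.tenL V)}
    (ht : cotMap (𝟙 M) (X.tenLMap p) t = 0) : ∃ s, cotMap (𝟙 M) (X.tenLMap k) s = t := by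
  have hpX : Function.Surjective (map B (idh X) p) :=
    Ten.map_surjective (idh X) p Function.surjective_id hp
  obtain ⟨J, ι, h, hι, hl⟩ := LComod.exists_kernel hC (X.tenLMap p)
  obtain ⟨j, rfl⟩ := hM.exists_ker ι _ h hι hpX ht
  obtain ⟨l, hl⟩ := hl (X.tenLMap k) (LComod.hom_ext' fun t =>
    (Ten.map_map (idh X) k (idh X) p t).trans (Ten.map_zero_right hk t))
  have hls : Function.Surjective l.hom := fun y => by
    obtain ⟨t, ht⟩ := Ten.map_exact_right (M := X) k p hp hpk (ι.hom y) ((hι _).2 ⟨y, rfl⟩)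
    exact ⟨t, h ((LComod.congr_hom hl t).trans ht)⟩
  obtain ⟨j, rfl⟩ := hM.exists_lift hC l hls j
  exact ⟨j, by rw [← hl, ← cotMap_comp, Category.id_comp]⟩

theorem cotTenR_injective (hC : FlatRight A C) (hM : M.IsCoflat) (V : Type u) [AddCommGroup V]
    [Module B V] : Function.Injective (cotTenR hD M X V) := by
  refine (injective_iff_map_eq_zero _).2 fun z hz => ?_
  obtain ⟨p, hp⟩ := exists_finsupp_surjective (B := B) V
  obtain ⟨s, rfl⟩ := Ten.map_surjective (idh (cotRComod hD M X)) p.toAddMonoidHom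
    Function.surjective_id hp z
  rw [cotTenR_natural] at hz
  have hk : ∀ x : LinearMap.ker p, p.toAddMonoidHom ((LinearMap.ker p).subtype.toAddMonoidHom x)
    = 0 := fun x => x.2
  have hpk : ∀ v, p.toAddMonoidHom v = 0 →
    ∃ x, (LinearMap.ker p).subtype.toAddMonoidHom x = v := fun v hv => ⟨⟨v, hv⟩, rfl⟩
  -- The lift `s` to the free cover comes from the kernel of the cover. By surjectivity for that
  -- kernel and bijectivity for the free module, `s` itself comes from the kernel, hence dies in
  -- `V`.
  obtain ⟨j, hj⟩ := hM.exact_tenL (U := LinearMap.ker p) X hC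
    (LinearMap.ker p).subtype.toAddMonoidHom p.toAddMonoidHom
    hp hk hpk hz
  obtain ⟨k, rfl⟩ := cotTenR_surjective hD X hC hM _ j
  rw [← cotTenR_natural] at hj
  rw [← (cotTenR_bijective_finsupp hD X V).1 hj, Ten.map_map]
  exact Ten.map_zero_right hk k

theorem RComod.IsCoflat.pureR (hM : M.IsCoflat) (hC : FlatRight A C) (V : Type u)
    [AddCommGroup V] [Module B V] :
    PureR hD M X V where
  inj x y h := by
    refine cotTenR_injective hD X hC hM V (Subtype.ext ?_)
    rw [cotTenR_coe, cotTenR_coe, h]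
  exact t ht := by
    obtain ⟨s, hs⟩ := cotTenR_surjective hD X hC hM V ⟨_, (omegaR_injective_aux M X V).2 ht⟩
    refine ⟨s, (assoc A M X B V).injective ?_⟩
    rw [← cotTenR_coe, hs]

variable {X}

/-- The left-hand purity comes from flatness of `M` and of `M ⊗_A C`, the right-hand purity from
coflatness of `M`; no condition on `N` is needed. -/
theorem RComod.IsCoflat.assocAt (hC : FlatRight A C) (hM : M.IsCoflat) (N : LComod D) :
    AssocAt hC hD M X N := by
  have h := hM.flatRight hC
  refine AssocAt.of_pure hC hD ?_ ?_ ?_ ?_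
  · exact FlatRight.pureL hC h X N
  · exact FlatRight.pureL hC (h.ten hC) X N
  · exact hM.pureR hD X hC N
  · exact hM.pureR hD X hC _

/-- By associativity `(M □_C X) □_D -` is the composite of the exact functors `X □_D -` and `M □_C
-`. -/
theorem RComod.IsCoflat.cotensorR (hC : FlatRight A C) (hM : M.IsCoflat) (hX : X.toR.IsCoflat) :
    (cotRComod hD M X).IsCoflat :=
  RComod.isCoflat_of_equiv (T := fun N => cot M (cotLComod hC X N))
    (fun g => cotMap (𝟙 M) (cotLMap hC X g)) (fun N => (hM.assocAt hD hC N).equiv.symm)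
    (fun {N N'} g t => by
      obtain ⟨t, rfl⟩ := (hM.assocAt hD hC N).equiv.surjective t
      rw [AddEquiv.symm_apply_apply, AddEquiv.symm_apply_eq]
      refine ((hM.assocAt hD hC N).equiv_natural (hM.assocAt hD hC N') (𝟙 M) g t).symm.trans ?_
      exact congrArg _ (congrArg (fun f => cotMap f g t) ((Corings.cotensorR hD X).map_id M)))
    (fun _ _ _ f g h₁ h₂ h₃ =>
      have h := hX _ _ _ f g h₁ h₂ h₃
      hM _ _ _ (cotLMap hC X f) (cotLMap hC X g) h.1 h.2.1 h.2.2)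

end pure

end Right

/-! ### Coflat left comodules: the mirror statements -/

section Left

theorem LComod.IsCoflat.exists_lift {N : LComod C} (hN : N.IsCoflat) (hC : FlatLeft A C)
    {M M' : RComod C} (g : M ⟶ M') (hg : Function.Surjective g.hom) :
    Function.Surjective (cotMap g (𝟙 N)) := by
  obtain ⟨K, ι, h, hι, -⟩ := RComod.exists_kernel hC g
  exact (hN K M M' ι g h hι hg).2.2

theorem LComod.IsCoflat.exists_ker {N : LComod C} (hN : N.IsCoflat)
    {K M M' : RComod C} (ι : K ⟶ M) (g : M ⟶ M') (hι : Function.Injective ι.hom)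
    (h : Function.Exact ι.hom g.hom) (hg : Function.Surjective g.hom) {t : cot M N}
    (ht : cotMap g (𝟙 N) t = 0) : ∃ s, cotMap ι (𝟙 N) s = t :=
  ((hN K M M' ι g hι h hg).2.1 t).1 ht

theorem LComod.isCoflat_of_equiv {N : LComod C} {T : RComod C → Type u}
    [∀ M, AddCommGroup (T M)] (Tm : ∀ {M M' : RComod C}, (M ⟶ M') → (T M →+ T M'))
    (e : ∀ M, T M ≃+ cot M N)
    (he : ∀ {M M' : RComod C} (g : M ⟶ M') t, e M' (Tm g t) = cotMap g (𝟙 N) (e M t))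
    (h : ∀ (M₁ M₂ M₃ : RComod C) (f : M₁ ⟶ M₂) (g : M₂ ⟶ M₃), Function.Injective f.hom →
      Function.Exact f.hom g.hom → Function.Surjective g.hom →
      Function.Injective (Tm f) ∧ Function.Exact (Tm f) (Tm g) ∧ Function.Surjective (Tm g)) :
    N.IsCoflat := by
  intro N₁ N₂ N₃ f g hf hfg hg
  obtain ⟨h₁, h₂, h₃⟩ := h N₁ N₂ N₃ f g hf hfg hg
  refine ⟨fun x y hxy => ?_, fun t => ⟨fun ht => ?_, ?_⟩, fun t => ?_⟩
  · obtain ⟨x, rfl⟩ := (e _).surjective x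
    obtain ⟨y, rfl⟩ := (e _).surjective y
    rw [← he, ← he] at hxy
    rw [h₁ ((e _).injective hxy)]
  · obtain ⟨t, rfl⟩ := (e _).surjective t
    rw [← he, map_eq_zero_iff _ (e _).injective] at ht
    obtain ⟨s, rfl⟩ := (h₂ t).1 ht
    exact ⟨e _ s, (he f s).symm⟩
  · rintro ⟨s, rfl⟩
    obtain ⟨s, rfl⟩ := (e _).surjective s
    rw [← he, ← he, (h₂ _).2 ⟨s, rfl⟩, map_zero]
  · obtain ⟨t, rfl⟩ := (e _).surjective t
    obtain ⟨s, rfl⟩ := h₃ t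
    exact ⟨e _ s, (he g s).symm⟩

theorem Coring.isCoflat_toL (C : Coring A) : C.regular.toL.IsCoflat :=
  LComod.isCoflat_of_equiv (T := fun M => M) (fun g => g.hom) (fun M => M.cotUnit)
    (fun g n => RComod.cotUnit_natural g n) (fun _ _ _ _ _ h₁ h₂ h₃ => ⟨h₁, h₂, h₃⟩)

theorem FlatLeft.isCoflat_tenL {V : Type u} [AddCommGroup V] [Module A V]
    (hV : FlatLeft A V) : (C.regular.tenL V).IsCoflat := by
  refine LComod.isCoflat_of_equiv (T := fun M => Ten A M V) (fun g => map A g.hom (idh V))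
    (fun M => M.cotFree V) (fun g n => RComod.cotFree_natural_left g n)
    (fun N₁ N₂ N₃ f g h₁ h₂ h₃ => ⟨hV _ _ f.hom h₁, fun t => ⟨fun ht => ?_, ?_⟩,
      Ten.map_surjective _ _ h₃ Function.surjective_id⟩)
  · exact Ten.map_exact_left f.hom g.hom h₃ (fun m hm => (h₂ m).1 hm) t ht
  · rintro ⟨s, rfl⟩
    rw [Ten.map_map]
    exact Ten.map_zero_left (fun n => h₂.apply_apply_eq_zero n) s

theorem LComod.IsCoflat.flatLeft {N : LComod C} (hN : N.IsCoflat) (hC : FlatLeft A C) :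
    FlatLeft A N := by
  intro M M' _ _ _ _ f _ hf
  refine (injective_iff_map_eq_zero _).2 fun t ht => ?_
  obtain ⟨Q, π, hπ, h⟩ := RComod.exists_cokernel (C.regular.tenRMap f)
  have hinj := (hN _ _ _ (C.regular.tenRMap f) π (hC _ _ f hf) h hπ).1
  have e := LComod.cotFree_natural f (𝟙 N) t
  rw [show map A f (𝟙 N : N ⟶ N).hom t = 0 from ht, map_zero] at e
  have := hinj (e.symm.trans (map_zero _).symm)
  exact (N.cotFree M).injective (this.trans (map_zero _).symm)

section pure

variable (hD : FlatRight B D) (X : Bicomod D C) (N : LComod C)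

/-- The canonical map `V ⊗_B (X □_C N) → (V ⊗_B X) □_C N`. -/
noncomputable def cotTenL (V : Type u) [AddCommGroup V] [Module Bᵐᵒᵖ V] :
    Ten B V (cotLComod hD X N) →+ cot (X.tenR V) N :=
  ((assoc B V X A N).symm.toAddMonoidHom.comp (map B (idh V) (cotLInc hD X N))).codRestrict _
    fun z => (omegaL_injective_aux V X N).2 ((congrArg _ (AddEquiv.apply_symm_apply _ _)).trans
      ((Ten.map_map _ _ _ _ _).trans
      (Ten.map_zero_right (fun k => by exact cotLι_mem hD k) _)))

theorem cotTenL_coe {V : Type u} [AddCommGroup V] [Module Bᵐᵒᵖ V]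
    (z : Ten B V (cotLComod hD X N)) : (cotTenL hD X N V z : Ten A (Ten B V X) N) =
      (assoc B V X A N).symm (map B (idh V) (cotLInc hD X N) z) := rfl

theorem cotTenL_natural {V W : Type u} [AddCommGroup V] [Module Bᵐᵒᵖ V] [AddCommGroup W]
    [Module Bᵐᵒᵖ W] (f : V →+ W) [IsLin Bᵐᵒᵖ f] (z : Ten B V (cotLComod hD X N)) :
    cotTenL hD X N W (map B f (idh _) z) = cotMap (X.tenRMap f) (𝟙 N) (cotTenL hD X N V z) := by
  apply Subtype.ext
  refine (cotTenL_coe _ _ _ _).trans ?_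
  change _ = map A (map B f (idh X)) (idh N)
    ((assoc B V X A N).symm (map B (idh V) (cotLInc hD X N) z))
  rw [← Ten.assoc_symm_map, Ten.map_map, Ten.map_map]
  exact congrArg _ (Ten.map_congr (fun _ => rfl) (fun m => (Ten.map_id _).symm) z)

variable {N}

theorem cotTenL_bijective_finsupp (S : Type u) :
    Function.Bijective (cotTenL hD X N (S →₀ Bᵐᵒᵖ)) := by
  have h := FlatRight.pureL hD (flatRight_finsupp (A := B) S) X N
  refine ⟨fun x y e => h.inj ((assoc B _ X A N).symm.injective ?_), ?_⟩
  · rw [← cotTenL_coe, ← cotTenL_coe, e]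
  rintro ⟨t, ht⟩
  obtain ⟨s, hs⟩ := h.exact _ ((omegaL_injective_aux _ X N).1 ht)
  refine ⟨s, Subtype.ext ?_⟩
  rw [cotTenL_coe, hs, AddEquiv.symm_apply_apply]

theorem cotTenL_surjective (hC : FlatLeft A C) (hN : N.IsCoflat) (V : Type u) [AddCommGroup V]
    [Module Bᵐᵒᵖ V] : Function.Surjective (cotTenL hD X N V) := fun t => by
  obtain ⟨p, hp⟩ := exists_finsupp_surjective (B := Bᵐᵒᵖ) V
  obtain ⟨t, rfl⟩ := hN.exists_lift hC (X.tenRMap p.toAddMonoidHom)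
    (Ten.map_surjective p.toAddMonoidHom (idh X) hp Function.surjective_id) t
  obtain ⟨s, rfl⟩ := (cotTenL_bijective_finsupp hD X V).2 t
  exact ⟨_, cotTenL_natural hD X N p.toAddMonoidHom s⟩

theorem LComod.IsCoflat.exact_tenR (hN : N.IsCoflat) (hC : FlatLeft A C) {U V W : Type u}
    [AddCommGroup U] [AddCommGroup V] [AddCommGroup W] [Module Bᵐᵒᵖ U] [Module Bᵐᵒᵖ V]
    [Module Bᵐᵒᵖ W] (k : U →+ V) (p : V →+ W) [IsLin Bᵐᵒᵖ k] [IsLin Bᵐᵒᵖ p]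
    (hp : Function.Surjective p) (hk : ∀ x, p (k x) = 0) (hpk : ∀ v, p v = 0 → ∃ x, k x = v)
    {t : cot (X.tenR V) N} (ht : cotMap (X.tenRMap p) (𝟙 N) t = 0) :
    ∃ s, cotMap (X.tenRMap k) (𝟙 N) s = t := by
  have hpX : Function.Surjective (map B p (idh X)) :=
    Ten.map_surjective p (idh X) hp Function.surjective_id
  obtain ⟨J, ι, h, hι, hl⟩ := RComod.exists_kernel hC (X.tenRMap p)
  obtain ⟨j, rfl⟩ := hN.exists_ker ι _ h hι hpX ht
  obtain ⟨l, hl⟩ := hl (X.tenRMap k) (RComod.hom_ext' fun t =>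
    (Ten.map_map k (idh X) p (idh X) t).trans (Ten.map_zero_left hk t))
  have hls : Function.Surjective l.hom := fun y => by
    obtain ⟨t, ht⟩ := Ten.map_exact_left (N := X) k p hp hpk (ι.hom y) ((hι _).2 ⟨y, rfl⟩)
    exact ⟨t, h ((RComod.congr_hom hl t).trans ht)⟩
  obtain ⟨j, rfl⟩ := hN.exists_lift hC l hls j
  exact ⟨j, by rw [← hl, ← cotMap_comp, Category.id_comp]⟩

theorem cotTenL_injective (hC : FlatLeft A C) (hN : N.IsCoflat) (V : Type u) [AddCommGroup V]
    [Module Bᵐᵒᵖ V] : Function.Injective (cotTenL hD X N V) := by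
  refine (injective_iff_map_eq_zero _).2 fun z hz => ?_
  obtain ⟨p, hp⟩ := exists_finsupp_surjective (B := Bᵐᵒᵖ) V
  obtain ⟨s, rfl⟩ := Ten.map_surjective p.toAddMonoidHom (idh (cotLComod hD X N)) hp
    Function.surjective_id z
  rw [cotTenL_natural] at hz
  have hk : ∀ x : LinearMap.ker p, p.toAddMonoidHom ((LinearMap.ker p).subtype.toAddMonoidHom x)
    = 0 := fun x => x.2
  have hpk : ∀ v, p.toAddMonoidHom v = 0 →
    ∃ x, (LinearMap.ker p).subtype.toAddMonoidHom x = v := fun v hv => ⟨⟨v, hv⟩, rfl⟩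
  obtain ⟨j, hj⟩ := hN.exact_tenR (U := LinearMap.ker p) X hC
    (LinearMap.ker p).subtype.toAddMonoidHom p.toAddMonoidHom hp hk hpk hz
  obtain ⟨k, rfl⟩ := cotTenL_surjective hD X hC hN _ j
  rw [← cotTenL_natural] at hj
  rw [← (cotTenL_bijective_finsupp hD X V).1 hj, Ten.map_map]
  exact Ten.map_zero_left hk k

theorem LComod.IsCoflat.pureL (hN : N.IsCoflat) (hC : FlatLeft A C) (V : Type u) [AddCommGroup V]
    [Module Bᵐᵒᵖ V] : PureL hD V X N where
  inj x y h := by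
    refine cotTenL_injective hD X hC hN V (Subtype.ext ?_)
    rw [cotTenL_coe, cotTenL_coe, h]
  exact t ht := by
    have ht' : (assoc B V X A N).symm t ∈ cot (X.tenR V) N :=
      (omegaL_injective_aux V X N).2 (by rwa [AddEquiv.apply_symm_apply])
    obtain ⟨s, hs⟩ := cotTenL_surjective hD X hC hN V ⟨_, ht'⟩
    refine ⟨s, (assoc B V X A N).symm.injective ?_⟩
    rw [← cotTenL_coe, hs]

variable {X}

theorem LComod.IsCoflat.assocAt (hC : FlatLeft A C) (hN : N.IsCoflat) (M : RComod D) :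
    AssocAt hD hC M X N := by
  have h := hN.flatLeft hC
  refine AssocAt.of_pure hD hC ?_ ?_ ?_ ?_
  · exact hN.pureL hD X hC M
  · exact hN.pureL hD X hC _
  · exact FlatLeft.pureR hC h M X
  · exact FlatLeft.pureR hC (h.ten hC) M X

theorem LComod.IsCoflat.cotensorL (hC : FlatLeft A C) (hN : N.IsCoflat) (hX : X.toL.IsCoflat) :
    (cotLComod hD X N).IsCoflat :=
  LComod.isCoflat_of_equiv (T := fun M => cot (cotRComod hC M X) N)
    (fun g => cotMap (cotRMap hC g X) (𝟙 N)) (fun M => (hN.assocAt hD hC M).equiv)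
    (fun {M M'} g t => by
      refine ((hN.assocAt hD hC M).equiv_natural (hN.assocAt hD hC M') g (𝟙 N) t).trans ?_
      exact congrArg (fun f => cotMap g f ((hN.assocAt hD hC M).equiv t))
        ((Corings.cotensorL hD X).map_id N))
    (fun _ _ _ f g h₁ h₂ h₃ =>
      have h := hX _ _ _ f g h₁ h₂ h₃
      hN _ _ _ (cotRMap hC f X) (cotRMap hC g X) h.1 h.2.1 h.2.2)

end pure

end Left

end Corings

namespace Corings
open Corings.Ten (map lid rid assoc tmul)

/-! ## Comodules as functors on comodules on the other side -/

variable {A B : Type u} [Ring A] [Ring B] {C : Coring A} {D : Coring B}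

section Right

theorem LComod.cotUnit_smul (N : LComod C) (a : A) (n : N) :
    N.cotUnit (a • n) = cotMap (C.lmulHom a) (𝟙 N) (N.cotUnit n) :=
  Subtype.ext (IsLin.smul (f := N.lam) a n)

theorem LComod.cotFree_tmul {V : Type u} [AddCommGroup V] [Module Aᵐᵒᵖ V] (N : LComod C) (v : V)
    (n : N) : N.cotFree V (tmul A v n) = cotMap (C.regular.mkR v) (𝟙 N) (N.cotUnit n) :=
  Subtype.ext (N.coact_tmul v n)

theorem RComod.cotMap_rhoHom (M : RComod C) (N : LComod C) (t : cot M N) :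
    cotMap M.rhoHom (𝟙 N) t = N.cotFree M (t : Ten A M N) :=
  Subtype.ext ((AddEquiv.eq_symm_apply _).2 (cot_coassoc t))

/-- A natural family of maps `M □_C N → M □_C N'` comes from a morphism `N → N'`. -/
theorem LComod.exists_of_natural {P : RComod C → Prop} (h₀ : P C.regular.toR)
    (h₁ : ∀ M, P M → P (C.regular.tenR M)) {N N' : LComod C}
    (τ : ∀ M, P M → (cot M N →+ cot M N'))
    (hτ : ∀ {M M'} (hM : P M) (hM' : P M') (f : M ⟶ M') (t : cot M N),
      τ M' hM' (cotMap f (𝟙 N) t) = cotMap f (𝟙 N') (τ M hM t)) :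
    ∃ g : N ⟶ N', ∀ M hM t, τ M hM t = cotMap (𝟙 M) g t := by
  let f : N →+ N' := N'.cotUnit.symm.toAddMonoidHom.comp ((τ _ h₀).comp N.cotUnit.toAddMonoidHom)
  have hf : ∀ n, N'.cotUnit (f n) = τ _ h₀ (N.cotUnit n) := fun n =>
    AddEquiv.apply_symm_apply _ _
  -- Left multiplication by `a` is an endomorphism of the right comodule `C`, so naturality gives
  -- linearity.
  have : IsLin A f := ⟨fun a n => N'.cotUnit.injective (by
    rw [hf, N.cotUnit_smul, hτ h₀ h₀, ← hf, N'.cotUnit_smul])⟩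
  -- On a cofree comodule the value is forced by naturality along the morphisms `m ⊗ - : C → M ⊗_A
  -- C`.
  have free : ∀ (M : RComod C) (hM : P (C.regular.tenR M)) (t : Ten A M N),
      τ _ hM (N.cotFree M t) = N'.cotFree M (map A (idh M) f t) := fun M hM t => by
    induction t using Ten.induction with
    | h0 => simp only [map_zero]
    | h2 s t hs ht => simp only [map_add, hs, ht]
    | h1 m n => rw [N.cotFree_tmul, hτ h₀ hM, ← hf, Ten.map_tmul, N'.cotFree_tmul]; rfl
  -- A general `M` is compared with `M ⊗_A C` by naturality along its coaction, which is injective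
  -- after the cotensor product.
  have key : ∀ (M : RComod C) (hM : P M) (t : cot M N),
      (τ M hM t : Ten A M N') = map A (idh M) f (t : Ten A M N) := fun M hM t =>
    (N'.cotFree M).injective (by
      rw [← free M (h₁ M hM), ← RComod.cotMap_rhoHom, ← RComod.cotMap_rhoHom, hτ])
  -- Colinearity of `f` is the formula `key` at `M = C`, where the unit isomorphism is the coaction.
  have hcolin : ∀ n, map A (idh C) f (N.lam n) = N'.lam (f n) := fun n =>
    (key _ h₀ (N.cotUnit n)).symm.trans (congrArg Subtype.val (hf n)).symm
  exact ⟨{ hom := f, colin := hcolin }, fun M hM t => Subtype.ext (key M hM t)⟩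

/-- The functor `N ↦ (M ↦ M □_C N)`, for `M` in a full subcategory of the right comodules. -/
def LComod.cotFunctor (P : ObjectProperty (RComod C)) :
    LComod C ⥤ P.FullSubcategory ⥤ AddCommGrpCat.{u} where
  obj N :=
    { obj := fun M => AddCommGrpCat.of (cot M.obj N)
      map := fun f => AddCommGrpCat.ofHom (cotMap f.hom (𝟙 N))
      map_id := fun _ => AddCommGrpCat.hom_ext (AddMonoidHom.ext cotMap_id)
      map_comp := fun f g => AddCommGrpCat.hom_ext (AddMonoidHom.ext fun t =>
        cotMap_comp f.hom g.hom (𝟙 N) (𝟙 N) t) }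
  map g :=
    { app := fun M => AddCommGrpCat.ofHom (cotMap (𝟙 M.obj) g)
      naturality := fun _ _ f => AddCommGrpCat.hom_ext (AddMonoidHom.ext fun t =>
        (cotMap_comm f.hom g t).symm) }
  map_id _ := NatTrans.ext (funext fun _ => AddCommGrpCat.hom_ext (AddMonoidHom.ext cotMap_id))
  map_comp f g := NatTrans.ext (funext fun M => AddCommGrpCat.hom_ext (AddMonoidHom.ext fun t =>
    cotMap_comp (𝟙 M.obj) (𝟙 M.obj) f g t))

/-- `LComod.cotFunctor` is fully faithful. -/
noncomputable def LComod.cotFunctorFullyFaithful (P : ObjectProperty (RComod C))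
    (h₀ : P C.regular.toR) (h₁ : ∀ M, P M → P (C.regular.tenR M)) :
    (LComod.cotFunctor P).FullyFaithful :=
  have hfull : (LComod.cotFunctor P).Full := ⟨fun {N N'} τ => by
    obtain ⟨g, hg⟩ := LComod.exists_of_natural h₀ h₁ (fun M hM => (τ.app ⟨M, hM⟩).hom)
      (fun hM hM' f t => DFunLike.congr_fun (congrArg AddCommGrpCat.Hom.hom
        (τ.naturality (X := ⟨_, hM⟩) (Y := ⟨_, hM'⟩) (ObjectProperty.homMk f))) t)
    exact ⟨g, NatTrans.ext (funext fun M => AddCommGrpCat.hom_ext (AddMonoidHom.ext fun t =>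
      (hg M.obj M.property t).symm))⟩⟩
  have hfaith : (LComod.cotFunctor P).Faithful := ⟨fun {N N' f g} h => LComod.hom_ext' fun n => by
    apply N'.cotUnit.injective
    refine (LComod.cotUnit_natural f n).trans (Eq.trans ?_ (LComod.cotUnit_natural g n).symm)
    exact DFunLike.congr_fun (congrArg AddCommGrpCat.Hom.hom
      (NatTrans.congr_app h ⟨C.regular.toR, h₀⟩)) (N.cotUnit n)⟩
  Functor.FullyFaithful.ofFullyFaithful _

/-- Restriction of `M ↦ M □_D N` along `- □_C X` corresponds to `X □_D -`. -/
noncomputable def cotFunctorWhiskerIso {hC : FlatRight A C} {hD : FlatLeft B D} {X : Bicomod C D}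
    (P : ObjectProperty (RComod C)) (Q : ObjectProperty (RComod D))
    (hF : ∀ M : P.FullSubcategory, Q ((P.ι ⋙ cotensorR hD X).obj M))
    (h : ∀ M, P M → ∀ N, AssocAt hC hD M X N) :
    LComod.cotFunctor Q ⋙ (Functor.whiskeringLeft _ _ _).obj (Q.lift (P.ι ⋙ cotensorR hD X) hF) ≅
      cotensorL hC X ⋙ LComod.cotFunctor P :=
  NatIso.ofComponents
    (fun N => NatIso.ofComponents (fun M => (h M.obj M.property N).equiv.toAddCommGrpIso)
      (fun {M M'} f => AddCommGrpCat.hom_ext (AddMonoidHom.ext fun t => by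
        refine (AssocAt.equiv_natural (h M.obj M.property N) (h M'.obj M'.property N) f.hom
          (𝟙 N) t).trans ?_
        exact congrArg (fun k => cotMap f.hom k ((h M.obj M.property N).equiv t))
          ((cotensorL hC X).map_id N))))
    (fun {N N'} g => NatTrans.ext (funext fun M => AddCommGrpCat.hom_ext (AddMonoidHom.ext
      fun t => by
        refine Eq.trans ?_ (AssocAt.equiv_natural (h M.obj M.property N) (h M.obj M.property N')
          (𝟙 M.obj) g t)
        exact congrArg (fun k => (h M.obj M.property N').equiv (cotMap k g t))
          ((cotensorR hD X).map_id M.obj).symm)))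

/-- An adjunction between cotensor functors on right comodules yields one, in the other direction,
on left comodules. -/
theorem adj_cotensorL_of_adj_cotensorR {hCl : FlatLeft A C} {hCr : FlatRight A C}
    {hDl : FlatLeft B D} {hDr : FlatRight B D} {X : Bicomod C D} {Λ : Bicomod D C}
    (P : ObjectProperty (RComod C)) (Q : ObjectProperty (RComod D))
    (hP₀ : P C.regular.toR) (hP₁ : ∀ M, P M → P (C.regular.tenR M))
    (hQ₀ : Q D.regular.toR) (hQ₁ : ∀ M, Q M → Q (D.regular.tenR M))
    (hF : ∀ M, P M → Q (cotRComod hDl M X)) (hG : ∀ M, Q M → P (cotRComod hCl M Λ))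
    (hX : ∀ M, P M → ∀ N, AssocAt hCr hDl M X N) (hΛ : ∀ M, Q M → ∀ N, AssocAt hDr hCl M Λ N)
    (adj : cotensorR hDl X ⊣ cotensorR hCl Λ) :
    Nonempty (cotensorL hDr Λ ⊣ cotensorL hCr X) :=
  let F' := Q.lift (P.ι ⋙ cotensorR hDl X) (fun M => hF M.obj M.property)
  let G' := P.lift (Q.ι ⋙ cotensorR hCl Λ) (fun M => hG M.obj M.property)
  -- The adjunction is first restricted to the classes `P` and `Q`, where associativity is
  -- available. Precomposition then reverses it, and the fully faithful embeddings of left comodules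
  -- descend the result.
  let adj' : F' ⊣ G' := adj.restrictFullyFaithful P.fullyFaithfulι Q.fullyFaithfulι
    (Iso.refl (F' ⋙ Q.ι)) (Iso.refl (G' ⋙ P.ι))
  ⟨(adj'.whiskerLeft AddCommGrpCat.{u}).restrictFullyFaithful
    (LComod.cotFunctorFullyFaithful P hP₀ hP₁) (LComod.cotFunctorFullyFaithful Q hQ₀ hQ₁)
    (cotFunctorWhiskerIso Q P _ hΛ) (cotFunctorWhiskerIso P Q _ hX)⟩

end Right

/-! ### Right comodules as functors on left comodules -/

section Left

/-- Right multiplication by `a`, as an endomorphism of the left comodule `C`. -/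
def Coring.rmulHom (C : Coring A) (a : Aᵐᵒᵖ) : C.regular.toL ⟶ C.regular.toL where
  hom := Ten.lmul Aᵐᵒᵖ C a
  lin := inferInstanceAs (IsLin A (Ten.lmul Aᵐᵒᵖ C a))
  colin c := (IsLin.smul (f := C.Δ) a c).symm

theorem RComod.cotUnit_smul (M : RComod C) (a : Aᵐᵒᵖ) (m : M) :
    M.cotUnit (a • m) = cotMap (𝟙 M) (C.rmulHom a) (M.cotUnit m) :=
  Subtype.ext (IsLin.smul (f := M.rho) a m)

theorem RComod.cotFree_tmul {V : Type u} [AddCommGroup V] [Module A V] (M : RComod C) (m : M)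
    (v : V) : M.cotFree V (tmul A m v) = cotMap (𝟙 M) (C.regular.mkL v) (M.cotUnit m) :=
  Subtype.ext (M.coact_tmul m v)

theorem LComod.cotMap_lamHom (M : RComod C) (N : LComod C) (t : cot M N) :
    cotMap (𝟙 M) N.lamHom t = M.cotFree N (t : Ten A M N) :=
  Subtype.ext (cot_coassoc t).symm

/-- A natural family of maps `M □_C N → M' □_C N` comes from a morphism `M → M'`. -/
theorem RComod.exists_of_natural {P : LComod C → Prop} (h₀ : P C.regular.toL)
    (h₁ : ∀ N, P N → P (C.regular.tenL N)) {M M' : RComod C}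
    (τ : ∀ N, P N → (cot M N →+ cot M' N))
    (hτ : ∀ {N N'} (hN : P N) (hN' : P N') (f : N ⟶ N') (t : cot M N),
      τ N' hN' (cotMap (𝟙 M) f t) = cotMap (𝟙 M') f (τ N hN t)) :
    ∃ g : M ⟶ M', ∀ N hN t, τ N hN t = cotMap g (𝟙 N) t := by
  let f : M →+ M' := M'.cotUnit.symm.toAddMonoidHom.comp ((τ _ h₀).comp M.cotUnit.toAddMonoidHom)
  have hf : ∀ n, M'.cotUnit (f n) = τ _ h₀ (M.cotUnit n) := fun n =>
    AddEquiv.apply_symm_apply _ _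
  have : IsLin Aᵐᵒᵖ f := ⟨fun a n => M'.cotUnit.injective (by
    rw [hf, M.cotUnit_smul, hτ h₀ h₀, ← hf, M'.cotUnit_smul])⟩
  have free : ∀ (N : LComod C) (hN : P (C.regular.tenL N)) (t : Ten A M N),
      τ _ hN (M.cotFree N t) = M'.cotFree N (map A f (idh N) t) := fun N hN t => by
    induction t using Ten.induction with
    | h0 => simp only [map_zero]
    | h2 s t hs ht => simp only [map_add, hs, ht]
    | h1 m n => rw [M.cotFree_tmul, hτ h₀ hN, ← hf, Ten.map_tmul, M'.cotFree_tmul]; rfl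
  have key : ∀ (N : LComod C) (hN : P N) (t : cot M N),
      (τ N hN t : Ten A M' N) = map A f (idh N) (t : Ten A M N) := fun N hN t =>
    (M'.cotFree N).injective (by
      rw [← free N (h₁ N hN), ← LComod.cotMap_lamHom, ← LComod.cotMap_lamHom, hτ])
  have hcolin : ∀ n, map A f (idh C) (M.rho n) = M'.rho (f n) := fun n =>
    (key _ h₀ (M.cotUnit n)).symm.trans (congrArg Subtype.val (hf n)).symm
  exact ⟨{ hom := f, colin := hcolin }, fun N hN t => Subtype.ext (key N hN t)⟩

/-- The functor `M ↦ (N ↦ M □_C N)`, for `N` in a full subcategory of the left comodules. -/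
def RComod.cotFunctor (P : ObjectProperty (LComod C)) :
    RComod C ⥤ P.FullSubcategory ⥤ AddCommGrpCat.{u} where
  obj M :=
    { obj := fun N => AddCommGrpCat.of (cot M N.obj)
      map := fun f => AddCommGrpCat.ofHom (cotMap (𝟙 M) f.hom)
      map_id := fun _ => AddCommGrpCat.hom_ext (AddMonoidHom.ext cotMap_id)
      map_comp := fun f g => AddCommGrpCat.hom_ext (AddMonoidHom.ext fun t =>
        cotMap_comp (𝟙 M) (𝟙 M) f.hom g.hom t) }
  map g :=
    { app := fun N => AddCommGrpCat.ofHom (cotMap g (𝟙 N.obj))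
      naturality := fun _ _ f => AddCommGrpCat.hom_ext (AddMonoidHom.ext fun t =>
        cotMap_comm g f.hom t) }
  map_id _ := NatTrans.ext (funext fun _ => AddCommGrpCat.hom_ext (AddMonoidHom.ext cotMap_id))
  map_comp f g := NatTrans.ext (funext fun N => AddCommGrpCat.hom_ext (AddMonoidHom.ext fun t =>
    cotMap_comp f g (𝟙 N.obj) (𝟙 N.obj) t))

/-- `RComod.cotFunctor` is fully faithful. -/
noncomputable def RComod.cotFunctorFullyFaithful (P : ObjectProperty (LComod C))
    (h₀ : P C.regular.toL) (h₁ : ∀ N, P N → P (C.regular.tenL N)) :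
    (RComod.cotFunctor P).FullyFaithful :=
  have hfull : (RComod.cotFunctor P).Full := ⟨fun {M M'} τ => by
    obtain ⟨g, hg⟩ := RComod.exists_of_natural h₀ h₁ (fun N hN => (τ.app ⟨N, hN⟩).hom)
      (fun hN hN' f t => DFunLike.congr_fun (congrArg AddCommGrpCat.Hom.hom
        (τ.naturality (X := ⟨_, hN⟩) (Y := ⟨_, hN'⟩) (ObjectProperty.homMk f))) t)
    exact ⟨g, NatTrans.ext (funext fun N => AddCommGrpCat.hom_ext (AddMonoidHom.ext fun t =>
      (hg N.obj N.property t).symm))⟩⟩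
  have hfaith : (RComod.cotFunctor P).Faithful := ⟨fun {M M' f g} h => RComod.hom_ext' fun n => by
    apply M'.cotUnit.injective
    refine (RComod.cotUnit_natural f n).trans (Eq.trans ?_ (RComod.cotUnit_natural g n).symm)
    exact DFunLike.congr_fun (congrArg AddCommGrpCat.Hom.hom
      (NatTrans.congr_app h ⟨C.regular.toL, h₀⟩)) (M.cotUnit n)⟩
  Functor.FullyFaithful.ofFullyFaithful _

/-- Restriction of `N ↦ M □_C N` along `X □_D -` corresponds to `- □_C X`. -/
noncomputable def cotFunctorWhiskerIso' {hC : FlatRight A C} {hD : FlatLeft B D} {X : Bicomod C D}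
    (P : ObjectProperty (LComod C)) (Q : ObjectProperty (LComod D))
    (hF : ∀ N : Q.FullSubcategory, P ((Q.ι ⋙ cotensorL hC X).obj N))
    (h : ∀ N, Q N → ∀ M, AssocAt hC hD M X N) :
    RComod.cotFunctor P ⋙ (Functor.whiskeringLeft _ _ _).obj (P.lift (Q.ι ⋙ cotensorL hC X) hF) ≅
      cotensorR hD X ⋙ RComod.cotFunctor Q :=
  Iso.symm <| NatIso.ofComponents
    (fun M => NatIso.ofComponents (fun N => (h N.obj N.property M).equiv.toAddCommGrpIso)
      (fun {N N'} f => AddCommGrpCat.hom_ext (AddMonoidHom.ext fun t => by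
        refine Eq.trans ?_ (AssocAt.equiv_natural (h N.obj N.property M) (h N'.obj N'.property M)
          (𝟙 M) f.hom t)
        exact congrArg (fun k => (h N'.obj N'.property M).equiv (cotMap k f.hom t))
          ((cotensorR hD X).map_id M).symm)))
    (fun {M M'} g => NatTrans.ext (funext fun N => AddCommGrpCat.hom_ext (AddMonoidHom.ext
      fun t => by
        refine (AssocAt.equiv_natural (h N.obj N.property M) (h N.obj N.property M') g
          (𝟙 N.obj) t).trans ?_
        exact congrArg (fun k => cotMap g k ((h N.obj N.property M).equiv t))
          ((cotensorL hC X).map_id N.obj))))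

/-- An adjunction between cotensor functors on left comodules yields one, in the other direction,
on right comodules. -/
theorem adj_cotensorR_of_adj_cotensorL {hCl : FlatLeft A C} {hCr : FlatRight A C}
    {hDl : FlatLeft B D} {hDr : FlatRight B D} {X : Bicomod C D} {Λ : Bicomod D C}
    (P : ObjectProperty (LComod C)) (Q : ObjectProperty (LComod D))
    (hP₀ : P C.regular.toL) (hP₁ : ∀ N, P N → P (C.regular.tenL N))
    (hQ₀ : Q D.regular.toL) (hQ₁ : ∀ N, Q N → Q (D.regular.tenL N))
    (hF : ∀ N, Q N → P (cotLComod hCr X N)) (hG : ∀ N, P N → Q (cotLComod hDr Λ N))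
    (hX : ∀ N, Q N → ∀ M, AssocAt hCr hDl M X N) (hΛ : ∀ N, P N → ∀ M, AssocAt hDr hCl M Λ N)
    (adj : cotensorL hDr Λ ⊣ cotensorL hCr X) :
    Nonempty (cotensorR hDl X ⊣ cotensorR hCl Λ) :=
  let F' := P.lift (Q.ι ⋙ cotensorL hCr X) (fun N => hF N.obj N.property)
  let G' := Q.lift (P.ι ⋙ cotensorL hDr Λ) (fun N => hG N.obj N.property)
  let adj' : G' ⊣ F' := adj.restrictFullyFaithful P.fullyFaithfulι Q.fullyFaithfulι
    (Iso.refl (G' ⋙ Q.ι)) (Iso.refl (F' ⋙ P.ι))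
  ⟨(adj'.whiskerLeft AddCommGrpCat.{u}).restrictFullyFaithful
    (RComod.cotFunctorFullyFaithful P hP₀ hP₁) (RComod.cotFunctorFullyFaithful Q hQ₀ hQ₁)
    (cotFunctorWhiskerIso' P Q _ hX) (cotFunctorWhiskerIso' Q P _ hΛ)⟩

end Left

end Corings

namespace Corings
open Corings.Ten (map lid rid assoc tmul)

/-! ## Consequences of an adjunction between cotensor functors -/

variable {A B : Type u} [Ring A] [Ring B] {C : Coring A} {D : Coring B}

section Right

instance (hD : FlatLeft B D) (X : Bicomod C D) : (cotensorR hD X).Additive where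
  map_add {_ _ f g} := RComod.hom_ext' fun t => Subtype.ext
    (Ten.map_add_left (f := (f + g).hom) (f₁ := f.hom) (f₂ := g.hom) (g := idh X)
      (fun _ => rfl) t.1)

/-- As a right adjoint `- □_C X` preserves kernels, as a left adjoint cokernels. Flatness of the
corings identifies categorical kernels with kernels of the underlying maps. -/
theorem isCoflat_toL_of_adj {hCl : FlatLeft A C} {hDl : FlatLeft B D} {X : Bicomod C D}
    {G : RComod D ⥤ RComod C} (adj₁ : cotensorR hDl X ⊣ G) (adj₂ : G ⊣ cotensorR hDl X) :
    X.toL.IsCoflat := fun M₁ M₂ M₃ f g hf hfg hg => by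
  have hk := (RComod.isKer_iff hDl _ _).1
    (((RComod.isKer_iff hCl f g).2 ⟨hf, hfg⟩).map_of_adj adj₂)
  have hc := (RComod.isCoker_iff _ _).1 (((RComod.isCoker_iff f g).2 ⟨hg, hfg⟩).map_of_adj adj₁)
  exact ⟨hk.1, hk.2, hc.1⟩

/-- The functor forgetting the coaction of a right comodule. -/
def RComod.forget (C : Coring A) : RComod C ⥤ ModuleCat.{u} Aᵐᵒᵖ where
  obj M := ModuleCat.of Aᵐᵒᵖ M
  map f := ModuleCat.ofHom (IsLin.toLin Aᵐᵒᵖ f.hom)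

theorem RComod.preservesMonomorphisms_forget (hC : FlatLeft A C) :
    (RComod.forget C).PreservesMonomorphisms where
  preserves f _ := (ModuleCat.mono_iff_injective _).2 ((RComod.mono_iff hC f).1 inferInstance)

theorem Coring.map_counitR_rho (V : Type u) [AddCommGroup V] [Module Aᵐᵒᵖ V] (z : Ten A V C) :
    map A (C.counitR V) (idh C) ((C.regular.tenR V).rho z) = z := by
  induction z using Ten.induction with
  | h0 => simp only [map_zero]
  | h2 s t hs ht => simp only [map_add, hs, ht]
  | h1 v c =>
    rw [Bicomod.tenR_rho_tmul, ← LComod.coact_tmul C.regular.toL v c]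
    exact LComod.counitR_coact C.regular.toL _

/-- The forgetful functor is left adjoint to `- ⊗_A C`. -/
def RComod.forgetAdj (C : Coring A) : RComod.forget C ⊣ C.regular.tensorR :=
  Adjunction.mkOfUnitCounit
    { unit :=
        { app := fun M => M.rhoHom
          naturality := fun M N f => RComod.hom_ext' fun m => (f.colin m).symm }
      counit :=
        { app := fun V => ModuleCat.ofHom (X := C.regular.tenR V)
            (IsLin.toLin Aᵐᵒᵖ (M := Ten A V C) (C.counitR V))
          naturality := fun V W f => ModuleCat.hom_ext (LinearMap.ext fun t =>
            Coring.counitR_natural f.hom.toAddMonoidHom t) }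
      left_triangle := by
        ext M m
        exact M.counitR_rho m
      right_triangle := NatTrans.ext (funext fun V => RComod.hom_ext' fun t =>
        C.map_counitR_rho V t) }

/-- The left coaction, as a morphism of right comodules `X → C ⊗_A X`. -/
def Bicomod.lamHomR (X : Bicomod C D) : X.toR ⟶ X.tenR C where
  hom := X.lam
  lin := X.lam_right
  colin x := (AddEquiv.eq_symm_apply _).2 (X.compat x)

instance (V : Type u) [AddCommGroup V] [Module Aᵐᵒᵖ V] (X : Bicomod C D) :
    IsLin Bᵐᵒᵖ (M := Ten A V X) (N := Ten A (Ten A V C) X) (X.toL.coact V) :=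
  inferInstanceAs (IsLin Bᵐᵒᵖ ((assoc A V C A X).symm.toAddMonoidHom.comp (map A (idh V) X.lam)))

/-- The map `V ⊗_A X → (V ⊗_A C) ⊗_A X`, as a morphism of right comodules. -/
def Bicomod.coactHom (V : Type u) [AddCommGroup V] [Module Aᵐᵒᵖ V] (X : Bicomod C D) :
    X.tenR V ⟶ X.tenR (Ten A V C) where
  hom := X.toL.coact V
  lin := inferInstanceAs (IsLin Bᵐᵒᵖ (M := Ten A V X) (N := Ten A (Ten A V C) X) (X.toL.coact V))
  colin t := by
    induction t using Ten.induction with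
    | h0 => simp only [map_zero]
    | h2 s t hs ht => simp only [map_add, hs, ht]
    | h1 v x =>
      have e₁ : map B X.lam (idh D) (X.rho x) = (X.tenR C).rho (X.lam x) := X.lamHomR.colin x
      have e₂ := tenR_colin (M := C.regular.toR) (M' := C.regular.tenR V) (C.regular.mkR v) X
        (X.lam x)
      rw [X.tenR_rho_tmul, X.toL.coact_tmul]
      refine Eq.trans ?_ ((congrArg (DFunLike.coe _) e₁).trans e₂)
      refine (Ten.map_map (M' := Ten A V X) (M'' := Ten A (Ten A V C) X) _ _ _ _ _).trans
        (Eq.trans ?_ (Ten.map_map (M' := Ten A C X) (M'' := Ten A (Ten A V C) X) _ _ _ _ _).symm)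
      exact Ten.map_congr (fun x => X.toL.coact_tmul v x) (fun _ => rfl) _

/-- The isomorphism of right comodules `V ⊗_A X ≃ (V ⊗_A C) □_C X`. -/
noncomputable def Bicomod.cotFreeIso (hD : FlatLeft B D) (X : Bicomod C D) (V : Type u)
    [AddCommGroup V] [Module Aᵐᵒᵖ V] : X.tenR V ≅ cotRComod hD (C.regular.tenR V) X :=
  RComod.isoOfBijective
    (cotRLift hD (M := C.regular.tenR V) (X.coactHom V) fun t => X.toL.coact_mem_cot t)
    (X.toL.cotFree V).bijective

/-- The isomorphism of right comodules `X ≃ C □_C X`. -/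
noncomputable def Bicomod.cotUnitIso (hD : FlatLeft B D) (X : Bicomod C D) :
    X.toR ≅ cotRComod hD C.regular.toR X :=
  RComod.isoOfBijective (cotRLift hD (M := C.regular.toR) X.lamHomR
    fun x => (X.toL.cotUnit x).2) X.toL.cotUnit.bijective

/-- The functor `- ⊗_A X` is the cotensor functor on cofree comodules. -/
noncomputable def Bicomod.tensorRIso (hD : FlatLeft B D) (X : Bicomod C D) :
    X.tensorR ≅ C.regular.tensorR ⋙ cotensorR hD X :=
  NatIso.ofComponents (fun V => X.cotFreeIso hD V) (fun {_ _} f => RComod.hom_ext' fun t =>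
    X.toL.cotFree_natural f.hom.toAddMonoidHom (𝟙 X.toL) t)

/-- A left adjoint of the cotensor functor yields one of the tensor functor. -/
noncomputable def Bicomod.tensorRAdj {hC : FlatLeft A C} {Λ : Bicomod D C}
    {F : RComod C ⥤ RComod D} (adj : F ⊣ cotensorR hC Λ) :
    F ⋙ RComod.forget D ⊣ Λ.tensorR :=
  (adj.comp (RComod.forgetAdj D)).ofNatIsoRight (Λ.tensorRIso hC).symm

theorem Bicomod.quasiFiniteR_of_adj {hC : FlatLeft A C} {Λ : Bicomod D C}
    {F : RComod C ⥤ RComod D} (adj : F ⊣ cotensorR hC Λ) : Λ.QuasiFiniteR :=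
  (Bicomod.tensorRAdj adj).isRightAdjoint

/-- The left adjoint of `- ⊗_B Λ` is `F` followed by forgetting the coaction. Both preserve
monomorphisms, `F` because it is itself a right adjoint, so `- ⊗_B Λ` preserves injectives. -/
theorem Bicomod.injectorR_of_adj {hC : FlatLeft A C} (hD : FlatLeft B D) {Λ : Bicomod D C}
    {F : RComod C ⥤ RComod D} {G : RComod D ⥤ RComod C} (adj : F ⊣ cotensorR hC Λ)
    (adj' : G ⊣ F) : Λ.InjectorR := by
  have := RComod.preservesMonomorphisms_forget hD
  have := Functor.preservesMonomorphisms_of_adjunction adj'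
  exact Functor.preservesInjectiveObjects_of_adjunction_of_preservesMonomorphisms
    (Bicomod.tensorRAdj adj)

/-- If `- □_C X` is left adjoint to `- □_D Λ`, then `X` is the co-hom `h_C(Λ, C)`. -/
theorem isoCohom_of_adj {hC : FlatLeft A C} {hD : FlatLeft B D} {X : Bicomod C D}
    {Λ : Bicomod D C} (adj : cotensorR hD X ⊣ cotensorR hC Λ) : IsoCohom hC Λ X :=
  ⟨cotensorR hD X, adj, X, X.cotUnitIso hD,
    { smul := fun a x => Subtype.ext (IsLin.smul (f := X.lam) a x)
      -- For `F = - □_C X` the canonical map is the cofree isomorphism `C ⊗_A X ≅ (C ⊗_A C) □_C X`.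
      coaction := ⟨(X.toL.cotFree C).toAddMonoidHom,
        fun c x => X.toL.cotFree_tmul c x,
        fun x => Subtype.ext ((AddEquiv.symm_apply_eq _).2 (X.lam_coassoc x).symm)⟩ },
    ⟨Iso.refl X⟩⟩

end Right

section Left

instance (hC : FlatRight A C) (X : Bicomod C D) : (cotensorL hC X).Additive where
  map_add {_ _ f g} := LComod.hom_ext' fun t => Subtype.ext
    (Ten.map_add_right (g := (f + g).hom) (g₁ := f.hom) (g₂ := g.hom) (f := idh X)
      (fun _ => rfl) t.1)

theorem isCoflat_toR_of_adj {hCr : FlatRight A C} {hDr : FlatRight B D} {X : Bicomod C D}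
    {G : LComod C ⥤ LComod D} (adj₁ : cotensorL hCr X ⊣ G) (adj₂ : G ⊣ cotensorL hCr X) :
    X.toR.IsCoflat := fun M₁ M₂ M₃ f g hf hfg hg => by
  have hk := (LComod.isKer_iff hCr _ _).1
    (((LComod.isKer_iff hDr f g).2 ⟨hf, hfg⟩).map_of_adj adj₂)
  have hc := (LComod.isCoker_iff _ _).1 (((LComod.isCoker_iff f g).2 ⟨hg, hfg⟩).map_of_adj adj₁)
  exact ⟨hk.1, hk.2, hc.1⟩

/-- The functor forgetting the coaction of a left comodule. -/
def LComod.forget (C : Coring A) : LComod C ⥤ ModuleCat.{u} A where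
  obj N := ModuleCat.of A N
  map f := ModuleCat.ofHom (IsLin.toLin A f.hom)

theorem LComod.preservesMonomorphisms_forget (hC : FlatRight A C) :
    (LComod.forget C).PreservesMonomorphisms where
  preserves f _ := (ModuleCat.mono_iff_injective _).2 ((LComod.mono_iff hC f).1 inferInstance)

theorem Coring.map_counitL_lam (V : Type u) [AddCommGroup V] [Module A V] (z : Ten A C V) :
    map A (idh C) (C.counitL V) ((C.regular.tenL V).lam z) = z := by
  induction z using Ten.induction with
  | h0 => simp only [map_zero]
  | h2 s t hs ht => simp only [map_add, hs, ht]
  | h1 c v =>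
    rw [Bicomod.tenL_lam_tmul, ← RComod.coact_tmul C.regular.toR c v]
    exact RComod.counitL_coact C.regular.toR _

/-- The forgetful functor is left adjoint to `C ⊗_A -`. -/
def LComod.forgetAdj (C : Coring A) : LComod.forget C ⊣ C.regular.tensorL :=
  Adjunction.mkOfUnitCounit
    { unit :=
        { app := fun N => N.lamHom
          naturality := fun M N f => LComod.hom_ext' fun m => (f.colin m).symm }
      counit :=
        { app := fun V => ModuleCat.ofHom (X := C.regular.tenL V)
            (IsLin.toLin A (M := Ten A C V) (C.counitL V))
          naturality := fun V W f => ModuleCat.hom_ext (LinearMap.ext fun t =>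
            Coring.counitL_natural f.hom.toAddMonoidHom t) }
      left_triangle := by
        ext N n
        exact N.counitL_lam n
      right_triangle := NatTrans.ext (funext fun V => LComod.hom_ext' fun t =>
        C.map_counitL_lam V t) }

/-- The right coaction, as a morphism of left comodules `X → X ⊗_B D`. -/
def Bicomod.rhoHomL (X : Bicomod C D) : X.toL ⟶ X.tenL D where
  hom := X.rho
  lin := X.rho_left
  colin x := (X.compat x).symm

instance (V : Type u) [AddCommGroup V] [Module B V] (X : Bicomod C D) :
    IsLin A (M := Ten B X V) (N := Ten B X (Ten B D V)) (X.toR.coact V) :=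
  inferInstanceAs (IsLin A ((assoc B X D B V).toAddMonoidHom.comp (map B X.rho (idh V))))

/-- The map `X ⊗_B V → X ⊗_B (D ⊗_B V)`, as a morphism of left comodules. -/
def Bicomod.coactHomL (V : Type u) [AddCommGroup V] [Module B V] (X : Bicomod C D) :
    X.tenL V ⟶ X.tenL (Ten B D V) where
  hom := X.toR.coact V
  lin := inferInstanceAs (IsLin A (M := Ten B X V) (N := Ten B X (Ten B D V)) (X.toR.coact V))
  colin t := by
    induction t using Ten.induction with
    | h0 => simp only [map_zero]
    | h2 s t hs ht => simp only [map_add, hs, ht]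
    | h1 x v =>
      have e₁ : map A (idh C) X.rho (X.lam x) = (X.tenL D).lam (X.rho x) := X.rhoHomL.colin x
      have e₂ := tenL_colin (N := D.regular.toL) (N' := D.regular.tenL V) X (D.regular.mkL v)
        (X.rho x)
      rw [X.tenL_lam_tmul, X.toR.coact_tmul]
      refine Eq.trans ?_ ((congrArg (DFunLike.coe _) e₁).trans e₂)
      refine (Ten.map_map (N' := Ten B X V) (N'' := Ten B X (Ten B D V)) _ _ _ _ _).trans
        (Eq.trans ?_ (Ten.map_map (N' := Ten B X D) (N'' := Ten B X (Ten B D V)) _ _ _ _ _).symm)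
      exact Ten.map_congr (fun _ => rfl) (fun x => X.toR.coact_tmul x v) _

/-- The isomorphism of left comodules `X ⊗_B V ≃ X □_D (D ⊗_B V)`. -/
noncomputable def Bicomod.cotFreeIsoL (hC : FlatRight A C) (X : Bicomod C D) (V : Type u)
    [AddCommGroup V] [Module B V] : X.tenL V ≅ cotLComod hC X (D.regular.tenL V) :=
  LComod.isoOfBijective
    (cotLLift hC (N := D.regular.tenL V) (X.coactHomL V) fun t => X.toR.coact_mem_cot t)
    (X.toR.cotFree V).bijective

/-- The functor `X ⊗_B -` is the cotensor functor on cofree comodules. -/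
noncomputable def Bicomod.tensorLIso (hC : FlatRight A C) (X : Bicomod C D) :
    X.tensorL ≅ D.regular.tensorL ⋙ cotensorL hC X :=
  NatIso.ofComponents (fun V => X.cotFreeIsoL hC V) (fun {_ _} f => LComod.hom_ext' fun t =>
    X.toR.cotFree_natural (𝟙 X.toR) f.hom.toAddMonoidHom t)

/-- A left adjoint of the cotensor functor yields one of the tensor functor. -/
noncomputable def Bicomod.tensorLAdj {hC : FlatRight A C} {X : Bicomod C D}
    {F : LComod C ⥤ LComod D} (adj : F ⊣ cotensorL hC X) :
    F ⋙ LComod.forget D ⊣ X.tensorL :=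
  (adj.comp (LComod.forgetAdj D)).ofNatIsoRight (X.tensorLIso hC).symm

theorem Bicomod.quasiFiniteL_of_adj {hC : FlatRight A C} {X : Bicomod C D}
    {F : LComod C ⥤ LComod D} (adj : F ⊣ cotensorL hC X) : X.QuasiFiniteL :=
  (Bicomod.tensorLAdj adj).isRightAdjoint

theorem Bicomod.injectorL_of_adj {hC : FlatRight A C} (hD : FlatRight B D) {X : Bicomod C D}
    {F : LComod C ⥤ LComod D} {G : LComod D ⥤ LComod C} (adj : F ⊣ cotensorL hC X)
    (adj' : G ⊣ F) : X.InjectorL := by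
  have := LComod.preservesMonomorphisms_forget hD
  have := Functor.preservesMonomorphisms_of_adjunction adj'
  exact Functor.preservesInjectiveObjects_of_adjunction_of_preservesMonomorphisms
    (Bicomod.tensorLAdj adj)

end Left

end Corings

namespace Corings
open Corings.Ten (map lid rid assoc tmul)

/-! ## Coseparable corings -/

variable {A B : Type u} [Ring A] [Ring B] {C : Coring A} {D : Coring B}

/-! ### Natural retractions of the coactions over a coseparable coring -/

section Retraction

instance {R : Type u} [Ring R] {V : Type u} [AddCommGroup V] [Module Aᵐᵒᵖ V] [Module R V]
    [SMulCommClass R Aᵐᵒᵖ V] : IsLin R (C.counitR V) :=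
  inferInstanceAs (IsLin R ((rid V).comp (map A (idh V) C.ε)))

/-- Left multiplication by `a`, as an endomorphism of the right comodule `X`. -/
def Bicomod.lmulHom (X : Bicomod C D) (a : A) : X.toR ⟶ X.toR where
  hom := Ten.lmul A X a
  lin := inferInstanceAs (IsLin Bᵐᵒᵖ (Ten.lmul A X a))
  colin x := (IsLin.smul (f := X.rho) a x).symm

/-- A natural retraction of the coactions of right comodules, by morphisms of comodules. -/
structure CoactionRetraction (C : Coring A) where
  /-- the retraction of `M → M ⊗_A C` -/
  r (M : RComod C) : Ten A M C →+ M
  [lin (M : RComod C) : IsLin Aᵐᵒᵖ (r M)]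
  colin (M : RComod C) (t : Ten A M C) :
    map A (r M) (idh C) ((C.regular.tenR M).rho t) = M.rho (r M t)
  r_rho (M : RComod C) (m : M) : r M (M.rho m) = m
  natural {M N : RComod C} (f : M ⟶ N) (t : Ten A M C) :
    r N (map A f.hom (idh C) t) = f.hom (r M t)

attribute [instance] CoactionRetraction.lin

/-- The map `m ⊗ c ↦ m₀ ⊗ π(m₁ ⊗ c)`. -/
def RComod.twist (M : RComod C) (π : Ten A C C →+ C) [IsLin A π] : Ten A M C →+ Ten A M C :=
  ((map A (idh M) π).comp (assoc A M C A C).toAddMonoidHom).comp (map A M.rho (idh C))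

instance (M : RComod C) (π : Ten A C C →+ C) [IsLin A π] [IsLin Aᵐᵒᵖ π] :
    IsLin Aᵐᵒᵖ (M.twist π) :=
  inferInstanceAs (IsLin Aᵐᵒᵖ (((map A (idh M) π).comp (assoc A M C A C).toAddMonoidHom).comp
    (map A M.rho (idh C))))

theorem RComod.twist_natural {M N : RComod C} (f : M ⟶ N) (π : Ten A C C →+ C) [IsLin A π]
    (t : Ten A M C) : N.twist π (map A f.hom (idh C) t) = map A f.hom (idh C) (M.twist π t) := by
  have e : map A N.rho (idh C) (map A f.hom (idh C) t) =
      map A (map A f.hom (idh C)) (idh C) (map A M.rho (idh C) t) := by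
    rw [Ten.map_map, Ten.map_map]
    exact Ten.map_congr (fun m => (f.colin m).symm) (fun _ => rfl) _
  change map A (idh N) π (assoc A N C A C _) = map A f.hom (idh C) (map A (idh M) π _)
  rw [e, Ten.assoc_map, Ten.map_map, Ten.map_map]
  refine Ten.map_congr (fun _ => rfl) (fun z => ?_) _
  change π (map A (idh C) (idh C) z) = π z
  rw [Ten.map_id]

/-- The map `m ⊗ c ↦ m₀ ε(π(m₁ ⊗ c))`. -/
def RComod.contract (M : RComod C) (π : Ten A C C →+ C) [IsLin A π] : Ten A M C →+ M :=
  (C.counitR M).comp (M.twist π)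

instance (M : RComod C) (π : Ten A C C →+ C) [IsLin A π] [IsLin Aᵐᵒᵖ π] :
    IsLin Aᵐᵒᵖ (M.contract π) :=
  inferInstanceAs (IsLin Aᵐᵒᵖ ((C.counitR M).comp (M.twist π)))

/-- Left colinearity of `π` puts `M.twist π t` in `M □_C C`, which is the image of the coaction.
Contracting with the counit picks out the preimage. -/
theorem RComod.rho_contract (M : RComod C) (π : Ten A C C →+ C) [IsLin A π]
    (hπ : ∀ t, map A (idh C) π (assoc A C C A C (map A C.Δ (idh C) t)) = C.Δ (π t))
    (t : Ten A M C) : M.rho (M.contract π t) = M.twist π t := by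
  have e₁ : M.rho (M.contract π t) = map A (idh M) (C.counitR C)
      (assoc A M C A C (map A M.rho (idh C) (M.twist π t))) := by
    change M.rho (C.counitR M (M.twist π t)) = _
    induction M.twist π t using Ten.induction with
    | h0 => simp only [map_zero]
    | h2 s t hs ht => simp only [map_add, hs, ht]
    | h1 m c =>
      rw [Coring.counitR_tmul, Ten.map_tmul, IsLin.smul (f := M.rho)]
      induction M.rho m using Ten.induction with
      | h0 => simp only [map_zero, Ten.zero_tmul, smul_zero]
      | h2 s t hs ht => simp only [map_add, Ten.add_tmul, smul_add, hs, ht]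
      | h1 m c' =>
        rw [Ten.right_smul_tmul]
        change _ = map A (idh M) (C.counitR C) (assoc A M C A C (tmul A (tmul A m c') c))
        rw [Ten.assoc_tmul, Ten.map_tmul, Coring.counitR_tmul]
        rfl
  -- The cotensor equation for the twist: coassociativity of `M` replaces the repeated coaction by
  -- `Δ`, and `hπ` moves `Δ` past `π`; the pentagon matches the bracketings.
  have e₂ : assoc A M C A C (map A M.rho (idh C) (M.twist π t)) =
      map A (idh M) C.Δ (M.twist π t) := by
    let u : Ten A (Ten A M C) C := map A M.rho (idh C) t
    let w : Ten A (Ten A M (Ten A C C)) C := map A (map A (idh M) C.Δ) (idh C) u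
    let v : Ten A (Ten A (Ten A M C) C) C := map A (map A M.rho (idh C)) (idh C) u
    have hv : map A (assoc A M C A C).toAddMonoidHom (idh C) v = w := by
      change map A (assoc A M C A C).toAddMonoidHom (idh C)
        (map A (map A M.rho (idh C)) (idh C) (map A M.rho (idh C) t)) =
        map A (map A (idh M) C.Δ) (idh C) (map A M.rho (idh C) t)
      rw [Ten.map_map, Ten.map_map, Ten.map_map]
      exact Ten.map_congr M.coassoc (fun _ => rfl) t
    have h₁ : assoc A M C A C (map A M.rho (idh C) (M.twist π t)) =
        map A (idh M) (map A (idh C) π)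
          (assoc A M C A (Ten A C C) (assoc A (Ten A M C) C A C v)) := by
      rw [← Ten.assoc_map]
      refine congrArg _ ?_
      have h : assoc A (Ten A M C) C A C v = map A M.rho (idh (Ten A C C)) (assoc A M C A C u) :=
        (Ten.assoc_map _ _ _ _).trans
          (Ten.map_congr (fun _ => rfl) (fun z => Ten.map_id z) _)
      rw [h]
      change map A M.rho (idh C) (map A (idh M) π (assoc A M C A C u)) = _
      rw [Ten.map_map, Ten.map_map]
      exact Ten.map_congr (fun m => (Ten.map_id _).symm) (fun _ => rfl) _
    have h₂ : map A (idh M) C.Δ (M.twist π t) = map A (idh M) (map A (idh C) π)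
        (map A (idh M) (assoc A C C A C).toAddMonoidHom (assoc A M (Ten A C C) A C w)) := by
      have h : assoc A M (Ten A C C) A C w =
          map A (idh M) (map A C.Δ (idh C)) (assoc A M C A C u) := Ten.assoc_map _ _ _ _
      rw [h]
      change map A (idh M) C.Δ (map A (idh M) π (assoc A M C A C u)) = _
      rw [Ten.map_map, Ten.map_map, Ten.map_map]
      exact Ten.map_congr (fun _ => rfl) (fun z => (hπ z).symm) _
    rw [h₁, h₂, ← hv, Ten.pentagon]
  rw [e₁, e₂, Ten.map_map]
  exact Ten.map_id' (fun _ => rfl) C.counit_right _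

/-- Here right colinearity of `π` is used: the twist is the coaction of `M` tensored with `C`,
followed by `M ⊗ π`, and both are right colinear. -/
theorem RComod.twist_colin (M : RComod C) (π : Ten A C C →+ C) [IsLin A π] [IsLin Aᵐᵒᵖ π]
    (hπ : ∀ t, map A π (idh C) ((assoc A C C A C).symm (map A (idh C) C.Δ t)) = C.Δ (π t))
    (t : Ten A M C) : map A (M.twist π) (idh C) ((C.regular.tenR M).rho t) =
      (C.regular.tenR M).rho (M.twist π t) := by
  let φ : Ten A (Ten A M C) C →+ Ten A M C :=
    (map A (idh M) π).comp (assoc A M C A C).toAddMonoidHom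
  have hφ : ∀ m c c', φ (tmul A (tmul A m c) c') = tmul A m (π (tmul A c c')) := fun m c c' => by
    change map A (idh M) π (assoc A M C A C (tmul A (tmul A m c) c')) = _
    rw [Ten.assoc_tmul, Ten.map_tmul]; rfl
  have h : (map A φ (idh C)).comp (C.regular.tenR (Ten A M C)).rho =
      (C.regular.tenR M).rho.comp φ := Ten.hom_ext₃ fun m c c' => by
    have e : map A (π.comp (Ten.mk A C c)) (idh C) (C.Δ c') = C.Δ (π (tmul A c c')) := by
      have h₁ : (assoc A C C A C).symm (map A (idh C) C.Δ (tmul A c c')) =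
          map A (Ten.mk A C c) (idh C) (C.Δ c') := (C.regular.mkR c).colin c' |>.symm
      rw [← hπ, h₁]
      exact (Ten.map_map (Ten.mk A C c) (idh C) π (idh C) (C.Δ c')).symm
    change map A φ (idh C) ((C.regular.tenR (Ten A M C)).rho (tmul A (tmul A m c) c')) =
      (C.regular.tenR M).rho (φ (tmul A (tmul A m c) c'))
    rw [hφ, C.regular.tenR_rho_tmul, C.regular.tenR_rho_tmul, ← e]
    have e₁ := Ten.map_map (Ten.mk A (Ten A M C) (tmul A m c)) (idh C) φ (idh C) (C.Δ c')
    have e₂ := Ten.map_map (π.comp (Ten.mk A C c)) (idh C) (Ten.mk A M m) (idh C) (C.Δ c')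
    exact e₁.trans (Eq.trans (Ten.map_congr (fun z => hφ m c z) (fun _ => rfl) _) e₂.symm)
  have e₁ : map A (map A M.rho (idh C)) (idh C) ((C.regular.tenR M).rho t) =
      (C.regular.tenR (Ten A M C)).rho (map A M.rho (idh C) t) := tenR_colin M.rhoHom C.regular t
  refine (Ten.map_map (map A M.rho (idh C)) (idh C) φ (idh C) _).symm.trans ?_
  rw [e₁]
  exact DFunLike.congr_fun h _

theorem RComod.twist_rho (M : RComod C) (π : Ten A C C →+ C) [IsLin A π]
    (hπ : ∀ c, π (C.Δ c) = c) (m : M) : M.twist π (M.rho m) = M.rho m := by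
  change map A (idh M) π (assoc A M C A C (map A M.rho (idh C) (M.rho m))) = M.rho m
  rw [M.coassoc, Ten.map_map]
  exact Ten.map_id' (fun _ => rfl) hπ _

/-- A splitting `π` of `Δ` spreads to all comodules by `m ⊗ c ↦ m₀ ε(π(m₁ ⊗ c))`. Each of the three
properties of `π` has its use: left colinearity identifies the coaction of this map with the twist,
right colinearity makes the map colinear, and `π Δ = id` makes it a retraction. -/
theorem Coring.IsCoseparable.nonempty_coactionRetraction (h : C.IsCoseparable) :
    Nonempty (CoactionRetraction C) := by
  obtain ⟨π, hl, hr, hπ, hΔl, hΔr⟩ := h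
  exact ⟨{
    r := fun M => M.contract π
    colin := fun M t => by
      rw [M.rho_contract π hΔl]
      refine (Ten.map_map (M.twist π) (idh C) (C.counitR M) (idh C) _).symm.trans ?_
      rw [M.twist_colin π hΔr]
      exact C.map_counitR_rho M _
    r_rho := fun M m => by
      change C.counitR M (M.twist π (M.rho m)) = m
      rw [M.twist_rho π hπ, M.counitR_rho]
    natural := fun {M N} f t => by
      change C.counitR N (N.twist π _) = f.hom (C.counitR M (M.twist π t))
      rw [RComod.twist_natural, Coring.counitR_natural] }⟩

/-- The retraction of the coaction, as a morphism of comodules. -/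
def CoactionRetraction.hom (ρ : CoactionRetraction C) (M : RComod C) : C.regular.tenR M ⟶ M where
  hom := ρ.r M
  lin := ρ.lin M
  colin := ρ.colin M

end Retraction

/-! ### Coseparability splits the kernels defining cotensor products -/

section Pure

/-- The projection of `M ⊗_A N` onto `M □_C N` given by a retraction of the coaction. -/
noncomputable def CoactionRetraction.proj (ρ : CoactionRetraction C) (M : RComod C) (N : LComod C) :
    Ten A M N →+ cot M N :=
  (cotMap (ρ.hom M) (𝟙 N)).comp (N.cotFree M).toAddMonoidHom

theorem CoactionRetraction.proj_coe (ρ : CoactionRetraction C) (M : RComod C) (N : LComod C)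
    (t : Ten A M N) : (ρ.proj M N t : Ten A M N) = map A (ρ.r M) (idh N) (N.coact M t) := rfl

theorem CoactionRetraction.map_r_rho (ρ : CoactionRetraction C) (M : RComod C) (N : LComod C)
    (t : Ten A M N) : map A (ρ.r M) (idh N) (map A M.rho (idh N) t) = t :=
  (Ten.map_map _ _ _ _ _).trans (Ten.map_id' (ρ.r_rho M) (fun _ => rfl) _)

theorem CoactionRetraction.proj_apply (ρ : CoactionRetraction C) {M : RComod C} {N : LComod C}
    (t : cot M N) : ρ.proj M N t = t :=
  Subtype.ext ((congrArg (map A (ρ.r M) (idh N))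
    ((AddEquiv.symm_apply_eq _).2 (cot_coassoc t).symm)).trans (ρ.map_r_rho M N t))

/-- With the projection this is a contracting identity `id = ι p + s ω` for the inclusion `ι` of `M
□_C N`. Such an identity of linear maps is preserved by every tensor product, hence purity without
any flatness. -/
theorem CoactionRetraction.eq_proj_add (ρ : CoactionRetraction C) (M : RComod C) (N : LComod C)
    (t : Ten A M N) : t = ρ.proj M N t +
      map A (ρ.r M) (idh N) ((assoc A M C A N).symm (omega M N t)) := by
  have e' : omega M N t = assoc A M C A N (map A M.rho (idh N) t) - map A (idh M) N.lam t := rfl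
  rw [e', map_sub, map_sub, AddEquiv.symm_apply_apply, ρ.map_r_rho, ρ.proj_coe]
  change t = map A (ρ.r M) (idh N) (N.coact M t) + (t - map A (ρ.r M) (idh N) (N.coact M t))
  abel

theorem CoactionRetraction.pureR (ρ : CoactionRetraction C) (hD : FlatLeft B D) (M : RComod C)
    (X : Bicomod C D) (V : Type u) [AddCommGroup V] [Module B V] : PureR hD M X V := by
  let p : Ten A M X →+ cotRComod hD M X := ρ.proj M X.toL
  have hp : IsLin Bᵐᵒᵖ p := ⟨fun b t => cotRι_injective hD M X
    (IsLin.smul (f := (map A (ρ.r M) (idh X)).comp ((assoc A M C A X).symm.toAddMonoidHom.comp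
      (map A (idh M) X.lam))) b t)⟩
  let s : Ten A M (Ten A C X) →+ Ten A M X :=
    (map A (ρ.r M) (idh X)).comp (assoc A M C A X).symm.toAddMonoidHom
  constructor
  · refine Function.LeftInverse.injective (g := map B p (idh V)) fun s =>
      (Ten.map_map _ _ _ _ _).trans (Ten.map_id' (fun k => ?_) (fun _ => rfl) s)
    exact ρ.proj_apply (N := X.toL) k
  · intro t ht
    refine ⟨map B p (idh V) t, ?_⟩
    have e := Ten.map_add_left (f := idh (Ten A M X)) (f₁ := (cotRInc hD M X).comp p)
      (f₂ := s.comp (omegaR M X)) (g := idh V) (fun t => ρ.eq_proj_add M X.toL t) t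
    have e₂ : map B (s.comp (omegaR M X)) (idh V) t = 0 :=
      (Ten.map_map (omegaR M X) (idh V) s (idh V) t).symm.trans
        ((congrArg _ ht).trans (map_zero _))
    rw [e₂, add_zero, Ten.map_id] at e
    exact (Ten.map_map _ _ _ _ _).trans e.symm

theorem CoactionRetraction.pureL (ρ : CoactionRetraction D) (hC : FlatRight A C) (V : Type u)
    [AddCommGroup V] [Module Aᵐᵒᵖ V] (X : Bicomod C D) (N : LComod D) : PureL hC V X N := by
  let r : Ten B X D →+ X := ρ.r X.toR
  -- Left multiplications of the bicomodule are morphisms of right comodules, so naturality of the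
  -- retraction gives linearity on the other side.
  have hr : IsLin A r := ⟨fun a t => by
    exact ρ.natural (X.lmulHom a) t⟩
  have hr' : IsLin Bᵐᵒᵖ r := ρ.lin X.toR
  let p : Ten B X N →+ cotLComod hC X N := ρ.proj X.toR N
  have hp : IsLin A p := ⟨fun b t => cotLι_injective hC X N
    (IsLin.smul (f := (map B r (idh N)).comp ((assoc B X D B N).symm.toAddMonoidHom.comp
      (map B (idh X) N.lam))) b t)⟩
  let s : Ten B X (Ten B D N) →+ Ten B X N :=
    (map B r (idh N)).comp (assoc B X D B N).symm.toAddMonoidHom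
  constructor
  · refine Function.LeftInverse.injective (g := map A (idh V) p) fun s =>
      (Ten.map_map _ _ _ _ _).trans (Ten.map_id' (fun _ => rfl) (fun k => ?_) s)
    exact ρ.proj_apply (M := X.toR) k
  · intro t ht
    refine ⟨map A (idh V) p t, ?_⟩
    have e := Ten.map_add_right (g := idh (Ten B X N)) (g₁ := (cotLInc hC X N).comp p)
      (g₂ := s.comp (omegaL X N)) (f := idh V) (fun t => ρ.eq_proj_add X.toR N t) t
    have e₂ : map A (idh V) (s.comp (omegaL X N)) t = 0 :=
      (Ten.map_map (idh V) (omegaL X N) (idh V) s t).symm.trans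
        ((congrArg _ ht).trans (map_zero _))
    rw [e₂, add_zero, Ten.map_id] at e
    exact (Ten.map_map _ _ _ _ _).trans e.symm

end Pure

end Corings

namespace Corings
open Corings.Ten (map lid rid assoc tmul)

/-! ## The co-hom functor as a cotensor functor -/

variable {A B : Type u} [Ring A] [Ring B] {C : Coring A} {D : Coring B}

/-! ### Morphisms out of a tensor product with a bicomodule -/

section Desc

variable {V W : Type u} [AddCommGroup V] [Module Aᵐᵒᵖ V] [AddCommGroup W] [Module Aᵐᵒᵖ W]

/-- The morphism out of `V ⊗_A X` given by a balanced family of morphisms out of `X`. -/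
def Bicomod.tenRDesc {X : Bicomod C D} {P : RComod D} (φ : V →+ (X.toR ⟶ P))
    (hφ : ∀ v (a : A), φ (op a • v) = X.lmulHom a ≫ φ v) : X.tenR V ⟶ P :=
  let f : Ten A V X →+ P := Ten.lift
    (AddMonoidHom.mk' (fun v => (φ v).hom) fun v w => by rw [map_add]; rfl)
    (fun v a x => RComod.congr_hom (hφ v a) x)
  have hf : ∀ v x, f (tmul A v x) = (φ v).hom x := fun v x => Ten.lift_tmul _ _ v x
  haveI : IsLin Bᵐᵒᵖ f := ⟨fun b t => by
    induction t using Ten.induction with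
    | h0 => simp only [map_zero, smul_zero]
    | h2 s t hs ht => simp only [map_add, smul_add, hs, ht]
    | h1 v x =>
      rw [Ten.right_smul_tmul, hf, hf]
      exact (φ v).lin.smul b x⟩
  { hom := f
    lin := this
    colin := fun (t : Ten A V X) => by
      induction t using Ten.induction with
      | h0 => simp only [map_zero]
      | h2 s t hs ht => simp only [map_add, hs, ht]
      | h1 v x =>
        rw [X.tenR_rho_tmul, hf]
        refine (Ten.map_map (Ten.mk A V v) (idh D) f (idh D) (X.rho x)).trans
          (Eq.trans ?_ ((φ v).colin x))
        have := (φ v).lin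
        exact Ten.map_congr (hf v) (fun _ => rfl) _ }

theorem Bicomod.mkR_tenRDesc {X : Bicomod C D} {P : RComod D} (φ : V →+ (X.toR ⟶ P))
    (hφ : ∀ v (a : A), φ (op a • v) = X.lmulHom a ≫ φ v) (v : V) :
    X.mkR v ≫ Bicomod.tenRDesc φ hφ = φ v :=
  RComod.hom_ext' fun x => Ten.lift_tmul (A := A) (M := V) (N := X) (P := P) _
    (fun v a x => RComod.congr_hom (hφ v a) x) v x

theorem Bicomod.mkR_add (X : Bicomod C D) (v w : V) : X.mkR (v + w) = X.mkR v + X.mkR w :=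
  RComod.hom_ext' fun x => Ten.add_tmul v w x

theorem Bicomod.mkR_smul (X : Bicomod C D) (v : V) (a : A) :
    X.mkR (op a • v) = X.lmulHom a ≫ X.mkR v :=
  RComod.hom_ext' fun x => Ten.smul_tmul v a x

theorem Bicomod.mkR_tenRMap (X : Bicomod C D) (f : V →+ W) [IsLin Aᵐᵒᵖ f] (v : V) :
    X.mkR v ≫ X.tenRMap f = X.mkR (f v) :=
  RComod.hom_ext' fun x => Ten.map_tmul f (idh X) v x

end Desc

/-! ### The canonical map `V ⊗_A F(C) → F(V ⊗_A C)` -/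

section Image

variable {h : RComod C ⥤ RComod D} [h.Additive] {X : Bicomod C D}
  {e : X.toR ≅ h.obj C.regular.toR} (he : IsImageOfCoring h X e)

/-- The canonical morphism `V ⊗_A F(C) → F(V ⊗_A C)`. -/
def IsImageOfCoring.can (V : Type u) [AddCommGroup V] [Module Aᵐᵒᵖ V] :
    X.tenR V ⟶ h.obj (C.regular.tenR V) :=
  Bicomod.tenRDesc
    (AddMonoidHom.mk' (fun v => e.hom ≫ h.map (C.regular.mkR v)) fun v w => by
      rw [Bicomod.mkR_add, h.map_add, Preadditive.comp_add])
    (fun v a => by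
      have ha : X.lmulHom a ≫ e.hom = e.hom ≫ h.map (C.regular.lmulHom a) :=
        RComod.hom_ext' fun x => he.smul a x
      change e.hom ≫ h.map (C.regular.mkR (op a • v)) = X.lmulHom a ≫ e.hom ≫ h.map _
      rw [Bicomod.mkR_smul, h.map_comp, reassoc_of% ha])

variable {V W : Type u} [AddCommGroup V] [Module Aᵐᵒᵖ V] [AddCommGroup W] [Module Aᵐᵒᵖ W]

theorem IsImageOfCoring.mkR_can (v : V) : X.mkR v ≫ he.can V = e.hom ≫ h.map (C.regular.mkR v) :=
  Bicomod.mkR_tenRDesc _ _ v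

theorem IsImageOfCoring.mkR_can_assoc (v : V) {P : RComod D} (g : h.obj (C.regular.tenR V) ⟶ P) :
    X.mkR v ≫ he.can V ≫ g = e.hom ≫ h.map (C.regular.mkR v) ≫ g := by
  rw [← Category.assoc, he.mkR_can, Category.assoc]

theorem IsImageOfCoring.can_natural (f : V →+ W) [IsLin Aᵐᵒᵖ f] :
    X.tenRMap f ≫ he.can W = he.can V ≫ h.map (C.regular.tenRMap f) :=
  Bicomod.tenR_hom_ext fun v => by
    rw [he.mkR_can_assoc, ← h.map_comp, Bicomod.mkR_tenRMap, ← Category.assoc,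
      Bicomod.mkR_tenRMap, he.mkR_can]

/-- The map `Υ` is prescribed on pure tensors, so it can only be `he.can C`. -/
theorem IsImageOfCoring.lamHomR_can : X.lamHomR ≫ he.can C = e.hom ≫ h.map C.comulHom := by
  obtain ⟨Υ, hΥ, hc⟩ := he.coaction
  have e' : Υ = (he.can C).hom := Ten.hom_ext fun c x =>
    (hΥ c x).trans (RComod.congr_hom (he.mkR_can c) x).symm
  exact RComod.hom_ext' fun x => (DFunLike.congr_fun e' (X.lam x)).symm.trans (hc x)

/-- Under the canonical maps, the coaction of `X` corresponds to `h` applied to `V ⊗ Δ`. Together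
with `can_natural` for a coaction, this matches the two maps defining `M □_C X` with the images
under `h` of the pair `M ⊗_A C ⇉ M ⊗_A C ⊗_A C`. -/
theorem IsImageOfCoring.coactHom_can :
    X.coactHom V ≫ he.can (Ten A V C) =
      he.can V ≫ h.map (RComod.rhoHom (C.regular.tenR V)) :=
  Bicomod.tenR_hom_ext fun v => by
    have h₁ : X.mkR v ≫ X.coactHom V = X.lamHomR ≫ X.tenRMap (Ten.mk A V v) :=
      RComod.hom_ext' fun x => X.toL.coact_tmul v x
    have h₂ : C.regular.mkR v ≫ RComod.rhoHom (C.regular.tenR V) =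
        C.comulHom ≫ C.regular.tenRMap (Ten.mk A V v) :=
      RComod.hom_ext' fun c => C.regular.tenR_rho_tmul v c
    rw [he.mkR_can_assoc, ← h.map_comp, h₂, ← Category.assoc, h₁, Category.assoc, he.can_natural,
      ← Category.assoc, he.lamHomR_can, Category.assoc, ← h.map_comp]

/-- Morphisms from either side to `P` are balanced families, indexed by `V`, of morphisms `h(C) →
P`: for `h(V ⊗_A C)` one transposes to `V ⊗_A C → G(P)` first. -/
theorem IsImageOfCoring.isIso_can {G : RComod D ⥤ RComod C} (adj : h ⊣ G)
    (V : Type u) [AddCommGroup V] [Module Aᵐᵒᵖ V] : IsIso (he.can V) := by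
  have hG : G.Additive := adj.right_adjoint_additive
  let η : C.regular.toR ⟶ G.obj X.toR := adj.unit.app _ ≫ G.map e.inv
  have hη : ∀ a : A, C.regular.lmulHom a ≫ η = η ≫ G.map (X.lmulHom a) := fun a => by
    have ha : X.lmulHom a ≫ e.hom = e.hom ≫ h.map (C.regular.lmulHom a) :=
      RComod.hom_ext' fun x => he.smul a x
    have ha' : e.inv ≫ X.lmulHom a = h.map (C.regular.lmulHom a) ≫ e.inv := by
      rw [Iso.inv_comp_eq, ← Category.assoc, ← ha, Category.assoc, e.hom_inv_id, Category.comp_id]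
    have hu := adj.unit.naturality (C.regular.lmulHom a)
    simp only [Functor.id_map, Functor.comp_map, Functor.id_obj, Functor.comp_obj] at hu
    simp only [η, Category.assoc, ← G.map_comp, ha']
    rw [← Category.assoc, hu, Category.assoc, ← G.map_comp]
  -- The transpose of `ψ` will be the inverse. It is glued from the transposes of the morphisms `v ⊗
  -- -`; `hη` makes the family balanced.
  let ψ : C.regular.tenR V ⟶ G.obj (X.tenR V) := Bicomod.tenRDesc
    (AddMonoidHom.mk' (fun v => η ≫ G.map (X.mkR v)) fun v w => by
      rw [Bicomod.mkR_add, G.map_add, Preadditive.comp_add])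
    (fun v a => by
      change η ≫ G.map (X.mkR (op a • v)) = C.regular.lmulHom a ≫ η ≫ G.map (X.mkR v)
      rw [Bicomod.mkR_smul, G.map_comp, ← Category.assoc, ← hη, Category.assoc])
  have hψ : ∀ v, C.regular.mkR v ≫ ψ = adj.homEquiv _ _ (e.inv ≫ X.mkR v) := fun v => by
    rw [adj.homEquiv_unit, G.map_comp, ← Category.assoc]
    exact Bicomod.mkR_tenRDesc _ _ v
  refine ⟨(adj.homEquiv _ _).symm ψ, Bicomod.tenR_hom_ext fun v => ?_,
    (adj.homEquiv _ _).injective (Bicomod.tenR_hom_ext fun v => ?_)⟩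
  · rw [he.mkR_can_assoc, ← adj.homEquiv_naturality_left_symm, hψ, Equiv.symm_apply_apply,
      e.hom_inv_id_assoc, Category.comp_id]
  · rw [adj.homEquiv_naturality_right, Equiv.apply_symm_apply, ← Category.assoc, hψ,
      ← adj.homEquiv_naturality_right, Category.assoc, he.mkR_can, e.inv_hom_id_assoc,
      ← adj.homEquiv_naturality_left, Category.comp_id]

theorem IsImageOfCoring.of_iso {H : Bicomod C D} {h : RComod C ⥤ RComod D}
    {e : H.toR ≅ h.obj C.regular.toR} (he : IsImageOfCoring h H e) (i : X ≅ H) :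
    ∃ e' : X.toR ≅ h.obj C.regular.toR, IsImageOfCoring h X e' := by
  let j : X.toR ≅ H.toR :=
    { hom := { hom := i.hom.hom, lin := i.hom.lin_right, colin := i.hom.colin_right }
      inv := { hom := i.inv.hom, lin := i.inv.lin_right, colin := i.inv.colin_right }
      hom_inv_id := RComod.hom_ext' fun x =>
        DFunLike.congr_fun (congrArg Bicomod.Hom.hom i.hom_inv_id) x
      inv_hom_id := RComod.hom_ext' fun x =>
        DFunLike.congr_fun (congrArg Bicomod.Hom.hom i.inv_hom_id) x }
  obtain ⟨Υ, hΥ, hc⟩ := he.coaction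
  refine ⟨j ≪≫ e, fun a x => ?_, Υ.comp (map A (idh C) i.hom.hom), fun c x => ?_, fun x => ?_⟩
  · exact (congrArg e.hom.hom (i.hom.lin_left.smul a x)).trans (he.smul a _)
  · exact (congrArg Υ (Ten.map_tmul _ _ c x)).trans (hΥ c _)
  · exact (congrArg Υ (i.hom.colin_left x)).trans (hc _)

end Image

/-! ### Preservation of the coaction equalizer and the co-hom functor -/

section Equalizer

/-- The functor `h` preserves the equalizers `M → M ⊗_A C ⇉ M ⊗_A C ⊗_A C`. -/
def PreservesCoaction (h : RComod C ⥤ RComod D) : Prop :=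
  ∀ M : RComod C, Function.Injective (h.map M.rhoHom).hom ∧
    ∀ y, (h.map (C.regular.tenRMap M.rho)).hom y =
      (h.map (RComod.rhoHom (C.regular.tenR M))).hom y → ∃ x, (h.map M.rhoHom).hom x = y

theorem RComod.rhoHom_comp (M : RComod C) : M.rhoHom ≫ C.regular.tenRMap M.rho =
    M.rhoHom ≫ RComod.rhoHom (C.regular.tenR M) :=
  RComod.hom_ext' fun m => M.rhoHom.colin m

theorem RComod.exists_rho (M : RComod C) {t : Ten A M C}
    (ht : map A M.rho (idh C) t = (C.regular.tenR M).rho t) : ∃ m, M.rho m = t := by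
  obtain ⟨m, hm⟩ := M.cotUnit.surjective
    ⟨t, (mem_cot (N := C.regular.toL)).2 ((AddEquiv.eq_symm_apply _).1 ht)⟩
  exact ⟨m, congrArg Subtype.val hm⟩

/-- The retractions, being natural, make `M → M ⊗_A C ⇉ M ⊗_A C ⊗_A C` a split equalizer, which
every functor preserves. -/
theorem CoactionRetraction.preservesCoaction (ρ : CoactionRetraction C)
    (h : RComod C ⥤ RComod D) : PreservesCoaction h := fun M => by
  have h₁ : M.rhoHom ≫ ρ.hom M = 𝟙 M := RComod.hom_ext' (ρ.r_rho M)
  have h₂ : RComod.rhoHom (C.regular.tenR M) ≫ ρ.hom (C.regular.tenR M) = 𝟙 _ :=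
    RComod.hom_ext' (ρ.r_rho _)
  have h₃ : C.regular.tenRMap M.rho ≫ ρ.hom (C.regular.tenR M) = ρ.hom M ≫ M.rhoHom :=
    RComod.hom_ext' (ρ.natural M.rhoHom)
  have k₁ : h.map M.rhoHom ≫ h.map (ρ.hom M) = 𝟙 _ := by rw [← h.map_comp, h₁, h.map_id]
  have k₂ : h.map (RComod.rhoHom (C.regular.tenR M)) ≫ h.map (ρ.hom (C.regular.tenR M)) = 𝟙 _ := by
    rw [← h.map_comp, h₂, h.map_id]
  have k₃ : h.map (C.regular.tenRMap M.rho) ≫ h.map (ρ.hom (C.regular.tenR M)) =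
      h.map (ρ.hom M) ≫ h.map M.rhoHom := by rw [← h.map_comp, ← h.map_comp, h₃]
  refine ⟨Function.LeftInverse.injective fun x => RComod.congr_hom k₁ x,
    fun y hy => ⟨(h.map (ρ.hom M)).hom y, ?_⟩⟩
  exact (RComod.congr_hom k₃ y).symm.trans
    ((congrArg _ hy).trans (RComod.congr_hom k₂ y))

/-- The difference of the parallel maps factors as a cokernel `π` of the coaction followed by an
injection `d`. As a left adjoint `h` preserves the cokernel, and by assumption it preserves
injectivity of `d`, so an element equalized by `h` of the pair comes from `h(M)`. -/
theorem preservesCoaction_of_injective {h : RComod C ⥤ RComod D} {G : RComod D ⥤ RComod C}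
    (adj : h ⊣ G) [h.Additive]
    (hinj : ∀ {M N : RComod C} (f : M ⟶ N), Function.Injective f.hom →
      Function.Injective (h.map f).hom) : PreservesCoaction h := fun M => by
  refine ⟨hinj _ M.rho_injective, fun y hy => ?_⟩
  obtain ⟨Q, π, hπ, hex⟩ := RComod.exists_cokernel M.rhoHom
  have hcok : IsCoker M.rhoHom π := (RComod.isCoker_iff _ _).2 ⟨hπ, hex⟩
  let k : C.regular.tenR M ⟶ C.regular.tenR (C.regular.tenR M) :=
    C.regular.tenRMap M.rho - RComod.rhoHom (C.regular.tenR M)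
  obtain ⟨d, hd⟩ := hcok.desc k (by
    rw [Preadditive.comp_sub, M.rhoHom_comp, sub_self])
  -- This is exactness of the original fork: the kernel of `k` is the image of the coaction, which
  -- is also the kernel of `π`.
  have hdinj : Function.Injective d.hom := by
    refine (injective_iff_map_eq_zero _).2 fun q hq => ?_
    obtain ⟨t, rfl⟩ := hπ q
    refine (hex t).2 (M.exists_rho ?_)
    have e : k.hom t = 0 := (RComod.congr_hom hd t).symm.trans hq
    exact sub_eq_zero.1 ((RComod.sub_apply _ _ _).symm.trans e)
  have hk : (h.map k).hom y = 0 := by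
    rw [h.map_sub, RComod.sub_apply, sub_eq_zero]
    exact hy
  have hπy : (h.map π).hom y = 0 := by
    apply hinj d hdinj
    rw [map_zero, ← hk, ← hd, h.map_comp]
    rfl
  exact (((RComod.isCoker_iff _ _).1 (hcok.map_of_adj adj)).2 y).1 hπy

/-- The forgetful functor after `h` is left adjoint to `- ⊗_B Λ`, which preserves injectives. Since
modules embed in injective ones, this left adjoint preserves monomorphisms. -/
theorem Bicomod.InjectorR.preservesCoaction {hC : FlatLeft A C}
    {Λ : Bicomod D C} (hΛ : Λ.InjectorR) {h : RComod C ⥤ RComod D}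
    (adj : h ⊣ cotensorR hC Λ) : PreservesCoaction h := by
  have := adj.left_adjoint_additive
  refine preservesCoaction_of_injective adj fun f hf => ?_
  have : Λ.tensorR.PreservesInjectiveObjects := hΛ
  have := Functor.preservesMonomorphisms_of_adjunction_of_preservesInjectiveObjects
    (Bicomod.tensorRAdj adj)
  have := (RComod.mono_iff hC f).2 hf
  have hm : Mono ((h ⋙ RComod.forget D).map f) := inferInstance
  exact (ModuleCat.mono_iff_injective _).1 hm

/-- A functor that preserves the coactions as equalizers is the cotensor functor of its value
at `C`. -/
theorem IsImageOfCoring.nonempty_iso (hD : FlatLeft B D) {X : Bicomod C D}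
    {h : RComod C ⥤ RComod D} {G : RComod D ⥤ RComod C} (adj : h ⊣ G) [h.Additive]
    {e : X.toR ≅ h.obj C.regular.toR} (he : IsImageOfCoring h X e) (hh : PreservesCoaction h) :
    Nonempty (h ≅ cotensorR hD X) := by
  have hiso : ∀ (V : Type u) [AddCommGroup V] [Module Aᵐᵒᵖ V], IsIso (he.can V) :=
    fun V => he.isIso_can adj V
  have hinj : ∀ (V : Type u) [AddCommGroup V] [Module Aᵐᵒᵖ V],
      Function.Injective (he.can V).hom := fun V _ _ =>
    Function.LeftInverse.injective fun t => RComod.iso_hom_inv (asIso (he.can V)) t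
  -- Through the canonical isomorphisms, the cotensor equation is the condition of being equalized
  -- by `h` of the fork.
  have key : ∀ (M : RComod C) (t : Ten A M X), t ∈ cot M X.toL ↔
      (h.map (C.regular.tenRMap M.rho)).hom ((he.can M).hom t) =
        (h.map (RComod.rhoHom (C.regular.tenR M))).hom ((he.can M).hom t) := fun M t => by
    rw [← RComod.comp_apply, ← RComod.comp_apply, ← he.can_natural, ← he.coactHom_can,
      RComod.comp_apply, RComod.comp_apply, (hinj _).eq_iff, mem_cot]
    exact (AddEquiv.eq_symm_apply _).symm
  -- This embeds `h(M)` in `M ⊗_A X`; preservation of the equalizer says that its image is exactly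
  -- `M □_C X`.
  let k : ∀ M : RComod C, h.obj M ⟶ X.tenR M := fun M => h.map M.rhoHom ≫ inv (he.can M)
  have hk : ∀ (M : RComod C) x, (he.can M).hom ((k M).hom x) = (h.map M.rhoHom).hom x := fun M x =>
    RComod.congr_hom (show k M ≫ he.can M = h.map M.rhoHom by
      rw [Category.assoc, IsIso.inv_hom_id, Category.comp_id]) x
  have hmem : ∀ (M : RComod C) x, (k M).hom x ∈ cot M X.toL := fun M x => by
    refine (key M _).2 ?_
    rw [hk, ← RComod.comp_apply, ← RComod.comp_apply, ← h.map_comp, ← h.map_comp, M.rhoHom_comp]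
  have hbij : ∀ M : RComod C, Function.Bijective (cotRLift hD (k M) (hmem M)).hom := fun M => by
    refine ⟨fun x y hxy => (hh M).1 ?_, fun t => ?_⟩
    · rw [← hk, ← hk]
      exact congrArg (he.can M).hom (congrArg Subtype.val hxy)
    · obtain ⟨x, hx⟩ := (hh M).2 _ ((key M t.1).1 t.2)
      exact ⟨x, Subtype.ext (hinj _ ((hk M x).trans hx))⟩
  have hnat : ∀ {M N : RComod C} (f : M ⟶ N), h.map f ≫ k N = k M ≫ X.tenRMap f.hom :=
    fun {M N} f => by
      have hf : f ≫ N.rhoHom = M.rhoHom ≫ C.regular.tenRMap f.hom :=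
        RComod.hom_ext' fun m => (f.colin m).symm
      rw [← cancel_mono (he.can N), Category.assoc, Category.assoc, Category.assoc,
        Category.assoc, IsIso.inv_hom_id, Category.comp_id, he.can_natural,
        IsIso.inv_hom_id_assoc, ← h.map_comp, ← h.map_comp, hf]
  exact ⟨NatIso.ofComponents (fun M => RComod.isoOfBijective _ (hbij M)) fun {M N} f =>
    RComod.hom_ext' fun x => Subtype.ext (RComod.congr_hom (hnat f) x)⟩

/-- If `X` is the co-hom `h_C(Λ, C)`, and the co-hom functor preserves coactions as equalizers,
then `- □_C X` is left adjoint to `- □_D Λ`. -/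
theorem IsoCohom.nonempty_adj {hC : FlatLeft A C} {hD : FlatLeft B D} {X : Bicomod C D}
    {Λ : Bicomod D C} (hX : IsoCohom hC Λ X)
    (hh : ∀ h : RComod C ⥤ RComod D, (h ⊣ cotensorR hC Λ) → PreservesCoaction h) :
    Nonempty (cotensorR hD X ⊣ cotensorR hC Λ) := by
  obtain ⟨h, adj, H, e, he, ⟨i⟩⟩ := hX
  have := adj.left_adjoint_additive
  obtain ⟨e', he'⟩ := he.of_iso i
  obtain ⟨j⟩ := he'.nonempty_iso hD adj (hh h adj)
  exact ⟨adj.ofNatIsoLeft j⟩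

end Equalizer

end Corings

namespace Corings

/-! ## Frobenius pairs of cotensor functors -/

section Frobenius

variable {A B : Type u} [Ring A] [Ring B] {C : Coring A} {D : Coring B}
  {hCl : FlatLeft A C} {hCr : FlatRight A C} {hDl : FlatLeft B D} {hDr : FlatRight B D}
  {X : Bicomod C D} {Λ : Bicomod D C}

/-- The embedding is applied to coflat right comodules. They include the coring, are stable under `M
↦ M ⊗_A C` since coflat comodules are flat as modules, and are stable under cotensoring with `X` and
`Λ` because these are coflat on the right. -/
theorem IsFrobeniusPair.cotensorL_of_isCoflat
    (h : IsFrobeniusPair (cotensorR hDl X) (cotensorR hCl Λ)) (hX : X.toR.IsCoflat)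
    (hΛ : Λ.toR.IsCoflat) : IsFrobeniusPair (cotensorL hDr Λ) (cotensorL hCr X) := by
  obtain ⟨⟨a₁⟩, ⟨a₂⟩⟩ := h
  have hC : ∀ M : RComod C, M.IsCoflat → (C.regular.tenR M).IsCoflat := fun M hM =>
    (hM.flatRight hCr).isCoflat_tenR
  have hD : ∀ M : RComod D, M.IsCoflat → (D.regular.tenR M).IsCoflat := fun M hM =>
    (hM.flatRight hDr).isCoflat_tenR
  have hF : ∀ M : RComod C, M.IsCoflat → (cotRComod hDl M X).IsCoflat := fun M hM =>
    RComod.IsCoflat.cotensorR hDl hCr hM hX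
  have hG : ∀ M : RComod D, M.IsCoflat → (cotRComod hCl M Λ).IsCoflat := fun M hM =>
    RComod.IsCoflat.cotensorR hCl hDr hM hΛ
  exact ⟨adj_cotensorL_of_adj_cotensorR (P := RComod.IsCoflat) (Q := RComod.IsCoflat)
      C.isCoflat_toR hC D.isCoflat_toR hD hF hG
      (fun M hM N => hM.assocAt hDl hCr N) (fun M hM N => hM.assocAt hCl hDr N) a₁,
    adj_cotensorL_of_adj_cotensorR (P := RComod.IsCoflat) (Q := RComod.IsCoflat)
      D.isCoflat_toR hD C.isCoflat_toR hC hG hF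
      (fun M hM N => hM.assocAt hCl hDr N) (fun M hM N => hM.assocAt hDl hCr N) a₂⟩

theorem IsFrobeniusPair.cotensorR_of_isCoflat
    (h : IsFrobeniusPair (cotensorL hDr Λ) (cotensorL hCr X)) (hX : X.toL.IsCoflat)
    (hΛ : Λ.toL.IsCoflat) : IsFrobeniusPair (cotensorR hDl X) (cotensorR hCl Λ) := by
  obtain ⟨⟨a₁⟩, ⟨a₂⟩⟩ := h
  have hC : ∀ N : LComod C, N.IsCoflat → (C.regular.tenL N).IsCoflat := fun N hN =>
    (hN.flatLeft hCl).isCoflat_tenL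
  have hD : ∀ N : LComod D, N.IsCoflat → (D.regular.tenL N).IsCoflat := fun N hN =>
    (hN.flatLeft hDl).isCoflat_tenL
  have hR : ∀ N : LComod D, N.IsCoflat → (cotLComod hCr X N).IsCoflat := fun N hN =>
    LComod.IsCoflat.cotensorL hCr hDl hN hX
  have hL : ∀ N : LComod C, N.IsCoflat → (cotLComod hDr Λ N).IsCoflat := fun N hN =>
    LComod.IsCoflat.cotensorL hDr hCl hN hΛ
  exact ⟨adj_cotensorR_of_adj_cotensorL (P := LComod.IsCoflat) (Q := LComod.IsCoflat)
      C.isCoflat_toL hC D.isCoflat_toL hD hR hL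
      (fun N hN M => hN.assocAt hCr hDl M) (fun N hN M => hN.assocAt hDr hCl M) a₁,
    adj_cotensorR_of_adj_cotensorL (P := LComod.IsCoflat) (Q := LComod.IsCoflat)
      D.isCoflat_toL hD C.isCoflat_toL hC hL hR
      (fun N hN M => hN.assocAt hDr hCl M) (fun N hN M => hN.assocAt hCr hDl M) a₂⟩

/-- With associativity for all comodules, the class `P` can be taken to be everything and no
coflatness is required. -/
theorem isFrobeniusPair_cotensorL_iff (hX : ∀ M N, AssocAt hCr hDl M X N)
    (hΛ : ∀ M N, AssocAt hDr hCl M Λ N) :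
    IsFrobeniusPair (cotensorR hDl X) (cotensorR hCl Λ) ↔
      IsFrobeniusPair (cotensorL hDr Λ) (cotensorL hCr X) := by
  constructor
  · rintro ⟨⟨a₁⟩, ⟨a₂⟩⟩
    exact ⟨adj_cotensorL_of_adj_cotensorR ⊤ ⊤ trivial (fun _ _ => trivial) trivial
        (fun _ _ => trivial) (fun _ _ => trivial) (fun _ _ => trivial)
        (fun M _ N => hX M N) (fun M _ N => hΛ M N) a₁,
      adj_cotensorL_of_adj_cotensorR ⊤ ⊤ trivial (fun _ _ => trivial) trivial
        (fun _ _ => trivial) (fun _ _ => trivial) (fun _ _ => trivial)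
        (fun M _ N => hΛ M N) (fun M _ N => hX M N) a₂⟩
  · rintro ⟨⟨a₁⟩, ⟨a₂⟩⟩
    exact ⟨adj_cotensorR_of_adj_cotensorL ⊤ ⊤ trivial (fun _ _ => trivial) trivial
        (fun _ _ => trivial) (fun _ _ => trivial) (fun _ _ => trivial)
        (fun N _ M => hX M N) (fun N _ M => hΛ M N) a₁,
      adj_cotensorR_of_adj_cotensorL ⊤ ⊤ trivial (fun _ _ => trivial) trivial
        (fun _ _ => trivial) (fun _ _ => trivial) (fun _ _ => trivial)
        (fun N _ M => hΛ M N) (fun N _ M => hX M N) a₂⟩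

theorem IsFrobeniusPair.isCoflat_toL (h : IsFrobeniusPair (cotensorR hDl X) (cotensorR hCl Λ)) :
    X.toL.IsCoflat ∧ Λ.toL.IsCoflat := by
  obtain ⟨⟨a₁⟩, ⟨a₂⟩⟩ := h
  exact ⟨isCoflat_toL_of_adj (hCl := hCl) a₁ a₂, isCoflat_toL_of_adj (hCl := hDl) a₂ a₁⟩

theorem IsFrobeniusPair.isCoflat_toR (h : IsFrobeniusPair (cotensorL hDr Λ) (cotensorL hCr X)) :
    X.toR.IsCoflat ∧ Λ.toR.IsCoflat := by
  obtain ⟨⟨a₁⟩, ⟨a₂⟩⟩ := h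
  exact ⟨isCoflat_toR_of_adj (hDr := hDr) a₂ a₁, isCoflat_toR_of_adj (hDr := hCr) a₁ a₂⟩

theorem IsFrobeniusPair.quasiFinite (h : IsFrobeniusPair (cotensorR hDl X) (cotensorR hCl Λ))
    (h' : IsFrobeniusPair (cotensorL hDr Λ) (cotensorL hCr X)) :
    X.QuasiFiniteL ∧ X.QuasiFiniteR ∧ Λ.QuasiFiniteL ∧ Λ.QuasiFiniteR := by
  obtain ⟨⟨a₁⟩, ⟨a₂⟩⟩ := h
  obtain ⟨⟨b₁⟩, ⟨b₂⟩⟩ := h'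
  exact ⟨Bicomod.quasiFiniteL_of_adj b₁, Bicomod.quasiFiniteR_of_adj a₂,
    Bicomod.quasiFiniteL_of_adj b₂, Bicomod.quasiFiniteR_of_adj a₁⟩

theorem IsFrobeniusPair.injector (h : IsFrobeniusPair (cotensorR hDl X) (cotensorR hCl Λ))
    (h' : IsFrobeniusPair (cotensorL hDr Λ) (cotensorL hCr X)) :
    X.InjectorL ∧ X.InjectorR ∧ Λ.InjectorL ∧ Λ.InjectorR := by
  obtain ⟨⟨a₁⟩, ⟨a₂⟩⟩ := h
  obtain ⟨⟨b₁⟩, ⟨b₂⟩⟩ := h'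
  exact ⟨Bicomod.injectorL_of_adj hDr b₁ b₂, Bicomod.injectorR_of_adj hCl a₂ a₁,
    Bicomod.injectorL_of_adj hCr b₂ b₁, Bicomod.injectorR_of_adj hDl a₁ a₂⟩

theorem IsFrobeniusPair.isoCohom (h : IsFrobeniusPair (cotensorR hDl X) (cotensorR hCl Λ)) :
    IsoCohom hCl Λ X ∧ IsoCohom hDl X Λ := by
  obtain ⟨⟨a₁⟩, ⟨a₂⟩⟩ := h
  exact ⟨isoCohom_of_adj a₁, isoCohom_of_adj a₂⟩

theorem IsoCohom.isFrobeniusPair_of_injectorR (hX : X.InjectorR) (hΛ : Λ.InjectorR)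
    (h : IsoCohom hCl Λ X) (h' : IsoCohom hDl X Λ) :
    IsFrobeniusPair (cotensorR hDl X) (cotensorR hCl Λ) :=
  ⟨h.nonempty_adj fun _ adj => hΛ.preservesCoaction adj,
    h'.nonempty_adj fun _ adj => hX.preservesCoaction adj⟩

theorem IsoCohom.isFrobeniusPair_of_coactionRetraction (ρ : CoactionRetraction C)
    (σ : CoactionRetraction D) (h : IsoCohom hCl Λ X) (h' : IsoCohom hDl X Λ) :
    IsFrobeniusPair (cotensorR hDl X) (cotensorR hCl Λ) :=
  ⟨h.nonempty_adj fun h _ => ρ.preservesCoaction h,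
    h'.nonempty_adj fun h _ => σ.preservesCoaction h⟩

theorem AssocAt.of_coactionRetraction (hC : FlatRight A C) (hD : FlatLeft B D)
    (ρ : CoactionRetraction C) (σ : CoactionRetraction D) (M : RComod C) (X : Bicomod C D)
    (N : LComod D) : AssocAt hC hD M X N :=
  AssocAt.of_pure hC hD (σ.pureL hC M X N) (σ.pureL hC _ X N) (ρ.pureR hD M X N) (ρ.pureR hD M X _)

theorem AssocAt.of_isVonNeumannRegular (hC : FlatRight A C) (hD : FlatLeft B D)
    (hA : IsVonNeumannRegular A) (hB : IsVonNeumannRegular B) (M : RComod C) (X : Bicomod C D)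
    (N : LComod D) : AssocAt hC hD M X N :=
  AssocAt.of_pure hC hD (FlatRight.pureL hC (hA.flatRight M) X N)
    (FlatRight.pureL hC (hA.flatRight (Ten A M C)) X N) (FlatLeft.pureR hD (hB.flatLeft N) M X)
    (FlatLeft.pureR hD (hB.flatLeft (Ten B D N)) M X)

end Frobenius

end Corings

theorem mainTheorem4 {A B : Type u} [Ring A] [Ring B] (C : Coring A) (D : Coring B)
    (hCl : FlatLeft A C) (hCr : FlatRight A C) (hDl : FlatLeft B D) (hDr : FlatRight B D)
    (X : Bicomod C D) (Λ : Bicomod D C) :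
    [ IsFrobeniusPair (cotensorR hDl X) (cotensorR hCl Λ) ∧ X.toR.IsCoflat ∧ Λ.toR.IsCoflat,
      IsFrobeniusPair (cotensorL hDr Λ) (cotensorL hCr X) ∧ X.toL.IsCoflat ∧ Λ.toL.IsCoflat,
      (X.toL.IsCoflat ∧ X.toR.IsCoflat ∧ Λ.toL.IsCoflat ∧ Λ.toR.IsCoflat) ∧
        (X.QuasiFiniteL ∧ X.QuasiFiniteR ∧ Λ.QuasiFiniteL ∧ Λ.QuasiFiniteR) ∧
        (X.InjectorL ∧ X.InjectorR ∧ Λ.InjectorL ∧ Λ.InjectorR) ∧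
        IsoCohom hCl Λ X ∧ IsoCohom hDl X Λ ].TFAE ∧
    (C.IsCoseparable → D.IsCoseparable →
      [ IsFrobeniusPair (cotensorR hDl X) (cotensorR hCl Λ),
        IsFrobeniusPair (cotensorL hDr Λ) (cotensorL hCr X),
        (X.QuasiFiniteL ∧ X.QuasiFiniteR ∧ Λ.QuasiFiniteL ∧ Λ.QuasiFiniteR) ∧
          IsoCohom hCl Λ X ∧ IsoCohom hDl X Λ ].TFAE) ∧
    (IsVonNeumannRegular A → IsVonNeumannRegular B →
      [ IsFrobeniusPair (cotensorR hDl X) (cotensorR hCl Λ),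
        IsFrobeniusPair (cotensorL hDr Λ) (cotensorL hCr X),
        (X.QuasiFiniteL ∧ X.QuasiFiniteR ∧ Λ.QuasiFiniteL ∧ Λ.QuasiFiniteR) ∧
          (X.InjectorL ∧ X.InjectorR ∧ Λ.InjectorL ∧ Λ.InjectorR) ∧
          IsoCohom hCl Λ X ∧ IsoCohom hDl X Λ ].TFAE) := by
  refine ⟨?_, fun hC hD => ?_, fun hA hB => ?_⟩
  · tfae_have 1 → 2 := fun ⟨h, hX, hΛ⟩ => ⟨h.cotensorL_of_isCoflat hX hΛ, h.isCoflat_toL⟩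
    tfae_have 2 → 1 := fun ⟨h, hX, hΛ⟩ => ⟨h.cotensorR_of_isCoflat hX hΛ, h.isCoflat_toR⟩
    tfae_have 1 → 3 := fun ⟨h, hX, hΛ⟩ =>
      have h' := h.cotensorL_of_isCoflat (hCr := hCr) (hDr := hDr) hX hΛ
      ⟨⟨h.isCoflat_toL.1, hX, h.isCoflat_toL.2, hΛ⟩, h.quasiFinite h', h.injector h', h.isoCohom⟩
    -- Each co-hom isomorphism gives one of the two adjunctions, with the injector property of the
    -- bicomodule inside the co-hom functor; the right-sided data suffice.
    tfae_have 3 → 1 := fun ⟨⟨_, hX, _, hΛ⟩, _, ⟨_, iX, _, iΛ⟩, h, h'⟩ =>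
      ⟨h.isFrobeniusPair_of_injectorR iX iΛ h', hX, hΛ⟩
    tfae_finish
  · obtain ⟨ρ⟩ := hC.nonempty_coactionRetraction
    obtain ⟨σ⟩ := hD.nonempty_coactionRetraction
    have e := isFrobeniusPair_cotensorL_iff (hCl := hCl) (hCr := hCr) (hDl := hDl) (hDr := hDr)
      (fun M N => AssocAt.of_coactionRetraction hCr hDl ρ σ M X N)
      (fun M N => AssocAt.of_coactionRetraction hDr hCl σ ρ M Λ N)
    tfae_have 1 ↔ 2 := e
    tfae_have 1 → 3 := fun h => ⟨h.quasiFinite (e.1 h), h.isoCohom⟩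
    -- Split equalizers replace the injector property, and the existence of the co-hom functors is
    -- part of the co-hom isomorphisms.
    tfae_have 3 → 1 := fun ⟨_, h, h'⟩ => h.isFrobeniusPair_of_coactionRetraction ρ σ h'
    tfae_finish
  · have e := isFrobeniusPair_cotensorL_iff (hCl := hCl) (hCr := hCr) (hDl := hDl) (hDr := hDr)
      (fun M N => AssocAt.of_isVonNeumannRegular hCr hDl hA hB M X N)
      (fun M N => AssocAt.of_isVonNeumannRegular hDr hCl hB hA M Λ N)
    tfae_have 1 ↔ 2 := e
    tfae_have 1 → 3 := fun h => ⟨h.quasiFinite (e.1 h), h.injector (e.1 h), h.isoCohom⟩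
    tfae_have 3 → 1 := fun ⟨_, ⟨_, iX, _, iΛ⟩, h, h'⟩ => h.isFrobeniusPair_of_injectorR iX iΛ h'
    tfae_finish
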